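/- Let $m_\alpha,T_\alpha,\nu_\alpha>0$ ($\alpha=i,e$) and $e>0$ be constants, $q_i=e$, $q_e=-e$, and assume that the cubic $$g(\lambda)=\lambda^3+(\nu_i+\nu_e)\lambda^2+\Big(\nu_i\nu_e+4\pi\big(\tfrac{e^2}{m_i}+\tfrac{e^2}{m_e}\big)\Big)\lambda+4\pi\big(\tfrac{e^2}{m_i}\nu_e+\tfrac{e^2}{m_e}\nu_i\big)$$ has nonzero discriminant. Let $U_0=[\rho_{\alpha0},u_{\alpha0},E_0,B_0]$ (with $\rho_{\alpha 0}$ real-valued and $u_{\alpha0},E_0,B_0$ $\mathbb R^3$-valued functions on $\mathbb R^3$) satisfy $\nabla\cdot E_0=4\pi\sum_{\alpha=i,e}q_\alpha\rho_{\alpha0}$ and $\nabla\cdot B_0=0$. Write $w_\parallel=-(-\Delta)^{-1}\nabla\nabla\cdot w$ for the gradient part of a vector field $w$. Let $[\rho_\alpha,u_{\alpha,\parallel}]\in C([0,\infty);L^2(\mathbb R^3))$ be the solution, in the sense of distributions, of $$\partial_t\rho_\alpha+\nabla\cdot u_{\alpha,\parallel}=0,\qquad m_\alpha\partial_tu_{\alpha,\parallel}-q_\alpha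 E_\parallel+T_\alpha\nabla\rho_\alpha+m_\alpha\nu_\alpha u_{\alpha,\parallel}=0,\qquad \alpha=i,e,$$ with $E_\parallel=4\pi e\,\Delta^{-1}\nabla(\rho_i-\rho_e)\in L^2$ and $[\rho_\alpha,u_{\alpha,\parallel}]|_{t=0}=[\rho_{\alpha0},u_{\alpha0,\parallel}]$. Let $\bar\rho$ be the solution of $$\partial_t\bar\rho=\mu_1\Delta\bar\rho,\qquad \mu_1=\frac{T_i+T_e}{m_i\nu_i+m_e\nu_e},\qquad \bar\rho|_{t=0}=\frac{m_i\nu_i\rho_{i0}+m_e\nu_e\rho_{e0}}{m_i\nu_i+m_e\nu_e},$$ that is, the convolution of $\bar\rho|_{t=0}$ with the heat kernel, and put $$\bar u_\parallel=-\mu_1\nabla\bar\rho,\qquad \bar E_\parallel=\frac{T_im_e\nu_e-T_em_i\nu_i}{e(m_i\nu_i+m_e\nu_e)}\nabla\bar\rho .$$ For $\ell\ge0$ and $1\le r\le 2\le q\le\infty$ let $[\ell+3(\frac1r-\frac1q)]_+$ be $\ell$ if $\ell$ is an integer and $r=q=2$, and the integer part of $\ell+3(\frac1r-\frac1q)$ plus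 one otherwise. Then there is $\lambda>0$ such that for all $1\le p,r\le2\le q\le\infty$, real $\ell\ge0$ and integers $m\ge1$ there is $C>0$, depending only on $m,p,r,q,\ell$ and the physical constants, such that for all such $U_0\in L^p$, all such solutions, and all $t\ge0$, $\alpha=i,e$, \begin{align*} \|\nabla^m(\rho_\alpha(t)-\bar\rho(t))\|_{L^q}\le{}& C(1+t)^{-\frac32(\frac1p-\frac1q)-\frac{m+1}2}\|U_0\|_{L^p}+Ce^{-\lambda t}\|U_0\|_{L^p}\\ &+C(1+t)^{-\frac\ell2}\|\nabla^{m+[\ell+3(\frac1r-\frac1q)]_+}U_0\|_{L^r}+Ce^{-\lambda t}\|\nabla^{m+[3(\frac1r-\frac1q)]_+}[\rho_{i0},\rho_{e0}]\|_{L^r},\\ \|\nabla^m(u_{\alpha,\parallel}(t)-\bar u_\parallel(t))\|_{L^q}\le{}& C(1+t)^{-\frac32(\frac1p-\frac1q)-\frac{m+2}2}\|U_0\|_{L^p}+Ce^{-\lambda t}\|U_0\|_{L^p}\\ &+C(1+t)^{-\frac\ell2}\|\nabla^{m+[\ell+3(\frac1r-\frac1q)]_+}U_0\|_{L^r}+Ce^{-\lambda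 t}\|\nabla^{m+1+[3(\frac1r-\frac1q)]_+}[\rho_{i0},\rho_{e0}]\|_{L^r},\\ \|\nabla^m(E_\parallel(t)-\bar E_\parallel(t))\|_{L^q}\le{}& C(1+t)^{-\frac32(\frac1p-\frac1q)-\frac{m+2}2}\|U_0\|_{L^p}+Ce^{-\lambda t}\|U_0\|_{L^p}\\ &+C(1+t)^{-\frac\ell2}\|\nabla^{m+[\ell+3(\frac1r-\frac1q)]_+}U_0\|_{L^r}+Ce^{-\lambda t}\|\nabla^{m+1+[3(\frac1r-\frac1q)]_+}[\rho_{i0},\rho_{e0}]\|_{L^r}. \end{align*} Derivatives are distributional, and a norm is $\infty$ if the distribution is not a function in the space. -/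

import Mathlib

open MeasureTheory Set
open scoped ENNReal SchwartzMap LineDeriv

/-- Physical space `ℝ³`. -/
abbrev E3 : Type := EuclideanSpace ℝ (Fin 3)

/-- The two charged species. -/
inductive Species : Type
  | ion
  | electron
  deriving DecidableEq

instance : Fintype Species :=
  ⟨{.ion, .electron}, fun x => by cases x <;> simp⟩

/-- The physical constants of the two-fluid plasma that enter the fluid part: masses, temperatures,
collision frequencies and the elementary charge, all positive. -/
structure PlasmaParams where
  m : Species → ℝ
  T : Species → ℝ
  ν : Species → ℝ
  e : ℝ
  m_pos : ∀ α, 0 < m α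
  T_pos : ∀ α, 0 < T α
  ν_pos : ∀ α, 0 < ν α
  e_pos : 0 < e

namespace PlasmaParams

/-- Charges: `q_i = e`, `q_e = -e`. -/
def q (P : PlasmaParams) : Species → ℝ
  | .ion => P.e
  | .electron => -P.e

/-- The friction coefficient `m_α ν_α`. -/
def κ (P : PlasmaParams) (α : Species) : ℝ := P.m α * P.ν α

/-- The ambipolar diffusion coefficient `μ₁ = (T_i + T_e) / (m_i ν_i + m_e ν_e)`. -/
noncomputable def μ₁ (P : PlasmaParams) : ℝ :=
  (P.T .ion + P.T .electron) / (P.κ .ion + P.κ .electron)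

/-- The coefficient of `∇ρ̄` in the limiting electric field,
`(T_i m_e ν_e - T_e m_i ν_i) / (e (m_i ν_i + m_e ν_e))`. -/
noncomputable def χ (P : PlasmaParams) : ℝ :=
  (P.T .ion * P.κ .electron - P.T .electron * P.κ .ion) / (P.e * (P.κ .ion + P.κ .electron))

/-- The cubic `g(λ) = λ³ + c₂ λ² + c₁ λ + c₀`. -/
noncomputable def g (P : PlasmaParams) : Cubic ℝ where
  a := 1
  b := P.ν .ion + P.ν .electron
  c := P.ν .ion * P.ν .electron +
    4 * Real.pi * (P.e ^ 2 / P.m .ion + P.e ^ 2 / P.m .electron)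
  d := 4 * Real.pi * (P.e ^ 2 / P.m .ion * P.ν .electron + P.e ^ 2 / P.m .electron * P.ν .ion)

end PlasmaParams

/-- The tempered distribution of a real `L^p` function. -/
noncomputable def toDist {p : ℝ≥0∞} [Fact (1 ≤ p)] (f : Lp ℝ p (volume : Measure E3)) :
    𝓢'(E3, ℂ) :=
  Lp.toTemperedDistribution (Complex.ofRealCLM.compLp f)

/-- The partial derivative `∂_j` of a tempered distribution. -/
noncomputable def pd (j : Fin 3) (T : 𝓢'(E3, ℂ)) : 𝓢'(E3, ℂ) :=
  ∂_{(EuclideanSpace.single j (1 : ℝ) : E3)} T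

/-- The divergence of a vector field of tempered distributions. -/
noncomputable def divergence (v : Fin 3 → 𝓢'(E3, ℂ)) : 𝓢'(E3, ℂ) := ∑ j, pd j (v j)

/-- `curl v = 0`. -/
def IsCurlFree (v : Fin 3 → 𝓢'(E3, ℂ)) : Prop := ∀ j l, pd j (v l) = pd l (v j)

/-- The `L^q` norm of a tempered distribution; it is `∞` if the distribution is not an `L^q`
function. -/
noncomputable def distNorm (q : ℝ≥0∞) [Fact (1 ≤ q)] (T : 𝓢'(E3, ℂ)) : ℝ≥0∞ :=
  ⨅ (f : Lp ℂ q (volume : Measure E3)) (_ : Lp.toTemperedDistribution f = T), ‖f‖ₑ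

/-- `‖∇ⁿ T‖_{L^q}`: the sum of the `L^q` norms of all the derivatives of order `n`. -/
noncomputable def gradNorm (n : ℕ) (q : ℝ≥0∞) [Fact (1 ≤ q)] (T : 𝓢'(E3, ℂ)) : ℝ≥0∞ :=
  ∑ J : Fin n → Fin 3, distNorm q (∂^{fun a => (EuclideanSpace.single (J a) (1 : ℝ) : E3)} T)

/-- Initial data `U₀ = [ρ_{α0}, u_{α0}, E₀, B₀]` in `L^p`. -/
structure InitialData (p : ℝ≥0∞) where
  ρ : Species → Lp ℝ p (volume : Measure E3)
  u : Species → Fin 3 → Lp ℝ p (volume : Measure E3)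
  E : Fin 3 → Lp ℝ p (volume : Measure E3)
  B : Fin 3 → Lp ℝ p (volume : Measure E3)

namespace InitialData

variable {p : ℝ≥0∞} [Fact (1 ≤ p)]

/-- The compatibility condition `∇·E₀ = 4π ∑ q_α ρ_{α0}`, `∇·B₀ = 0`. -/
def Compatible (U : InitialData p) (P : PlasmaParams) : Prop :=
  divergence (fun j => toDist (U.E j)) =
      (4 * Real.pi : ℝ) • ∑ α, P.q α • toDist (U.ρ α) ∧
    divergence (fun j => toDist (U.B j)) = 0

/-- `‖∇ⁿ U₀‖_{L^r}` for the whole vector `U₀`. -/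
noncomputable def gradNorm (U : InitialData p) (n : ℕ) (r : ℝ≥0∞) [Fact (1 ≤ r)] : ℝ≥0∞ :=
  (∑ α, _root_.gradNorm n r (toDist (U.ρ α))) +
    (∑ α, ∑ j, _root_.gradNorm n r (toDist (U.u α j))) +
    (∑ j, _root_.gradNorm n r (toDist (U.E j))) +
    ∑ j, _root_.gradNorm n r (toDist (U.B j))

/-- `‖∇ⁿ [ρ_{i0}, ρ_{e0}]‖_{L^r}`. -/
noncomputable def densGradNorm (U : InitialData p) (n : ℕ) (r : ℝ≥0∞) [Fact (1 ≤ r)] : ℝ≥0∞ :=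
  ∑ α, _root_.gradNorm n r (toDist (U.ρ α))

/-- `ρ̄₀ = (m_i ν_i ρ_{i0} + m_e ν_e ρ_{e0}) / (m_i ν_i + m_e ν_e)`. -/
noncomputable def ρbar₀ (U : InitialData p) (P : PlasmaParams) : 𝓢'(E3, ℂ) :=
  ∑ α, (P.κ α / (P.κ .ion + P.κ .electron)) • toDist (U.ρ α)

end InitialData

/-- The symbol `exp(-μ |k|² t)` of the heat semigroup at the wave number `k = 2πξ`. -/
noncomputable def heatSymbol (μ t : ℝ) (ξ : E3) : ℂ :=
  ((Real.exp (-(μ * t * (2 * Real.pi * ‖ξ‖) ^ 2)) : ℝ) : ℂ)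

/-- The symbol is smooth and slowly growing, so that it acts on tempered distributions. -/
theorem hasTemperateGrowth_heatSymbol {μ t : ℝ} (h : 0 ≤ μ * t) :
    (heatSymbol μ t).HasTemperateGrowth := by
  have h1 : (Real.exp ∘ fun ξ : E3 =>
      -(μ * t * (2 * Real.pi) ^ 2 * ‖ξ‖ ^ 2)).HasTemperateGrowth := by
    refine Function.HasTemperateGrowth.comp' (t := Iio (1 : ℝ)) ?_ isOpen_Iio.uniqueDiffOn
      Real.contDiff_exp.contDiffOn ?_ ?_
    · rintro - ⟨ξ, rfl⟩
      have : 0 ≤ μ * t * (2 * Real.pi) ^ 2 * ‖ξ‖ ^ 2 := by positivity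
      simp only [mem_Iio]
      linarith
    · intro N
      refine ⟨0, Real.exp 1, (Real.exp_pos 1).le, fun n _ x hx => ?_⟩
      rw [norm_iteratedFDerivWithin_eq_norm_iteratedDerivWithin,
        iteratedDerivWithin_eq_iteratedDeriv isOpen_Iio.uniqueDiffOn
          Real.contDiff_exp.contDiffAt hx, iteratedDeriv_eq_iterate, Real.iter_deriv_exp]
      simpa using (mem_Iio.1 hx).le
    · exact ((Function.HasTemperateGrowth.const _).mul
        (Function.hasTemperateGrowth_norm_sq E3)).neg
  have h2 := Function.Complex.hasTemperateGrowth_ofReal.comp h1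
  have h3 : heatSymbol μ t = Complex.ofReal ∘ (Real.exp ∘ fun ξ : E3 =>
      -(μ * t * (2 * Real.pi) ^ 2 * ‖ξ‖ ^ 2)) := by
    funext ξ
    simp only [heatSymbol, Function.comp_apply, mul_pow, mul_assoc]
  rw [h3]
  exact h2

/-- The solution `G_μ(t,·) ∗ T` at time `t` of `∂_t w = μ Δ w`, `w|_{t=0} = T`, where `G_μ` is the
heat kernel: its Fourier transform is `exp(-μ |k|² t)` times that of `T`. -/
noncomputable def heatFlow (μ t : ℝ) (T : 𝓢'(E3, ℂ)) : 𝓢'(E3, ℂ) :=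
  TemperedDistribution.fourierMultiplierCLM ℂ (heatSymbol μ t) T

section Profile

variable {p : ℝ≥0∞} [Fact (1 ≤ p)]

/-- The asymptotic density profile `ρ̄`. -/
noncomputable def ρbar (P : PlasmaParams) (U : InitialData p) (t : ℝ) : 𝓢'(E3, ℂ) :=
  heatFlow P.μ₁ t (U.ρbar₀ P)

/-- The asymptotic velocity profile `ū_∥ = -μ₁ ∇ρ̄`. -/
noncomputable def ubar (P : PlasmaParams) (U : InitialData p) (t : ℝ) (j : Fin 3) : 𝓢'(E3, ℂ) :=
  (-P.μ₁) • pd j (ρbar P U t)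

/-- The asymptotic electric profile `Ē_∥ = χ ∇ρ̄`. -/
noncomputable def Ebar (P : PlasmaParams) (U : InitialData p) (t : ℝ) (j : Fin 3) : 𝓢'(E3, ℂ) :=
  P.χ • pd j (ρbar P U t)

end Profile

/-- Real `L²` functions. -/
abbrev L2 : Type := Lp ℝ 2 (volume : Measure E3)

/-- `[ρ_α, u_{α,∥}]` in `C([0,∞); L²)`, with the field `E_∥`, is the solution of the fluid system
`∂_t ρ_α + ∇·u_{α,∥} = 0`,
`m_α ∂_t u_{α,∥} - q_α E_∥ + T_α ∇ρ_α + m_α ν_α u_{α,∥} = 0`, `E_∥ = 4π e Δ⁻¹ ∇(ρ_i - ρ_e)`,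
in the sense of distributions, with initial data `[ρ_{α0}, u_{α0,∥}]`.

The field `Δ⁻¹ ∇ h` is the unique `L²` vector field with vanishing curl and divergence `h`;
in particular `w_∥ = -(-Δ)⁻¹ ∇ ∇·w` is the one with vanishing curl and divergence `∇·w`. -/
structure IsFluidSolution {p : ℝ≥0∞} [Fact (1 ≤ p)] (P : PlasmaParams) (U₀ : InitialData p)
    (ρ : Species → ℝ → L2) (u : Species → ℝ → Fin 3 → L2) (E : ℝ → Fin 3 → L2) : Prop where
  continuousOn_ρ : ∀ α, ContinuousOn (ρ α) (Ici 0)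
  continuousOn_u : ∀ α, ContinuousOn (u α) (Ici 0)
  mass : ∀ α, ∀ t > 0, ∀ φ : 𝓢(E3, ℂ),
    HasDerivAt (fun s => toDist (ρ α s) φ)
      ((-divergence (fun j => toDist (u α t j))) φ) t
  momentum : ∀ α, ∀ j, ∀ t > 0, ∀ φ : 𝓢(E3, ℂ),
    HasDerivAt (fun s => (P.m α • toDist (u α s j)) φ)
      ((P.q α • toDist (E t j) - P.T α • pd j (toDist (ρ α t))
        - (P.m α * P.ν α) • toDist (u α t j)) φ) t
  curl_E : ∀ t ≥ 0, IsCurlFree (fun j => toDist (E t j))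
  div_E : ∀ t ≥ 0, divergence (fun j => toDist (E t j)) =
    (4 * Real.pi * P.e) • (toDist (ρ .ion t) - toDist (ρ .electron t))
  initial_ρ : ∀ α, toDist (ρ α 0) = toDist (U₀.ρ α)
  curl_initial_u : ∀ α, IsCurlFree (fun j => toDist (u α 0 j))
  div_initial_u : ∀ α, divergence (fun j => toDist (u α 0 j)) =
    divergence (fun j => toDist (U₀.u α j))

/-- `1/p` as a real number, with `1/∞ = 0`. -/
noncomputable def recip (p : ℝ≥0∞) : ℝ := (p⁻¹).toReal

/-- The index `[ℓ + 3(1/r - 1/q)]₊`: it is `ℓ` if `ℓ` is an integer and `r = q = 2`, and the integer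
part of `ℓ + 3(1/r - 1/q)` plus one otherwise. -/
noncomputable def lossIndex (ℓ : ℝ) (r q : ℝ≥0∞) : ℕ :=
  open Classical in
  if (⌊ℓ⌋₊ : ℝ) = ℓ ∧ r = 2 ∧ q = 2 then ⌊ℓ⌋₊ else ⌊ℓ + 3 * (recip r - recip q)⌋₊ + 1

/-- The right-hand side shared by the three estimates, with the extra decay `k/2` of the leading
term and `n` derivatives on the initial densities in the last term. -/
noncomputable def decayBound {p : ℝ≥0∞} [Fact (1 ≤ p)] (U₀ : InitialData p) (C lam : ℝ)
    (m k n : ℕ) (r q : ℝ≥0∞) [Fact (1 ≤ r)] (ℓ t : ℝ) : ℝ≥0∞ :=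
  ENNReal.ofReal (C * (1 + t) ^ (-(3 / 2) * (recip p - recip q) - ((m : ℝ) + k) / 2)) *
      U₀.gradNorm 0 p
    + ENNReal.ofReal (C * Real.exp (-lam * t)) * U₀.gradNorm 0 p
    + ENNReal.ofReal (C * (1 + t) ^ (-ℓ / 2)) * U₀.gradNorm (m + lossIndex ℓ r q) r
    + ENNReal.ofReal (C * Real.exp (-lam * t)) * U₀.densGradNorm (n + lossIndex 0 r q) r

/-! The Fourier transform reduces the system to ordinary differential equations. At a wave number of
modulus `s = |k|` a curl-free field is a scalar multiple of the direction of `k`, so the unknowns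
are two densities `ρ_α`, two longitudinal velocities `A_α` and a longitudinal field `β` with `s β =
4πe (ρ_i - ρ_e)`. All decay rates come from energy functionals for these five scalars.

Low frequency. Friction damps the velocities; adding a small multiple of `ρ_α A_α` to the energy
passes the damping on to `ρ` and `β`, and every mode decays like `exp(-c s² t / (1 + s²))`
(`stateSq_decay`). The slow variable `Z`, the friction-weighted mean density minus `s` times the
momentum over the total friction, satisfies `Z' = -s² Π`: friction and electric forces cancel,
leaving the pressure `Π` over the total friction. By Gauss's law both densities are `Z + O(s)`,
hence `Z' = -μ₁ s² Z + O(s³)`, and forcing over damping gives an `O(s)` distance from the heat flow.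
The state `A_α = μ₁ s Z`, `β = -χ s Z` balances the forces; deviations from it solve a strictly
damped system with forcing `O(s²)`, so they are `O(e^{-at} + s² e^{-c s² t})` (`forced_block_decay`,
`lowFreq_sq_le`). One power of `s` is worth `t^{-1/2}`, which explains the gains `(m+1)/2` and
`(m+2)/2`.

High frequency. The mode and the profile each decay exponentially. The profiles of velocity and
field carry a factor `s`, which costs one more derivative of the densities.

Return to physical space. Hausdorff–Young, applied to the data and to the solution, and Hölder with
a Gaussian or a negative power of `|k|` turn pointwise bounds in frequency into the `L^p`–`L^q`
estimates (`gradNorm_le_decayBound`). That a distributional solution really is a mode at almost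
every frequency follows from `weakSystem_eq_exp`: tested against a compactly supported function, the
solution equals its Taylor series in time, which is that of the matrix exponential. -/

open FourierTransform

/-! ### Tempered distributions represented by functions. -/

/-- The tempered distribution `T` is given by integration against the function `G`. -/
def Represents (T : 𝓢'(E3, ℂ)) (G : E3 → ℂ) : Prop :=
  ∀ φ : 𝓢(E3, ℂ), Integrable (fun x => φ x * G x) ∧ T φ = ∫ x, φ x * G x

namespace Represents

variable {T S : 𝓢'(E3, ℂ)} {G H : E3 → ℂ}

theorem add (hT : Represents T G) (hS : Represents S H) :
    Represents (T + S) (fun x => G x + H x) := by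
  intro φ
  have h1 := hT φ
  have h2 := hS φ
  have h3 : (fun x => φ x * (G x + H x)) = fun x => φ x * G x + φ x * H x := by
    funext x; ring
  rw [h3]
  refine ⟨h1.1.add h2.1, ?_⟩
  rw [integral_add h1.1 h2.1, ← h1.2, ← h2.2]
  rfl

theorem smul (c : ℂ) (hT : Represents T G) : Represents (c • T) (fun x => c * G x) := by
  intro φ
  have h1 := hT φ
  have h3 : (fun x => φ x * (c * G x)) = fun x => c * (φ x * G x) := by
    funext x; ring
  rw [h3]
  refine ⟨h1.1.const_mul c, ?_⟩
  rw [integral_const_mul, ← h1.2]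
  rfl

theorem zero : Represents 0 (fun _ => 0) := by
  intro φ
  simp

theorem sum {ι : Type*} (s : Finset ι) {T : ι → 𝓢'(E3, ℂ)} {G : ι → E3 → ℂ}
    (h : ∀ i ∈ s, Represents (T i) (G i)) :
    Represents (∑ i ∈ s, T i) (fun x => ∑ i ∈ s, G i x) := by
  classical
  induction s using Finset.induction_on with
  | empty => simpa using zero
  | insert a s ha ih =>
    simp only [Finset.sum_insert ha]
    exact (h a (by simp)).add (ih fun i hi => h i (by simp [hi]))

theorem real_smul (c : ℝ) (hT : Represents T G) : Represents (c • T) (fun x => (c : ℂ) * G x) := by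
  have h : c • T = (c : ℂ) • T := by
    ext φ
    simp
  rw [h]
  exact hT.smul c

theorem neg (hT : Represents T G) : Represents (-T) (fun x => -G x) := by
  have h : -T = (-1 : ℂ) • T := by
    ext φ
    simp
  rw [h]
  simpa using hT.smul (-1)

theorem sub (hT : Represents T G) (hS : Represents S H) :
    Represents (T - S) (fun x => G x - H x) := by
  simpa [sub_eq_add_neg] using hT.add hS.neg

theorem smulLeft {m : E3 → ℂ} (hm : m.HasTemperateGrowth) (hT : Represents T G) :
    Represents (TemperedDistribution.smulLeftCLM ℂ m T) (fun x => m x * G x) := by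
  intro φ
  have h := hT (SchwartzMap.smulLeftCLM ℂ m φ)
  simp only [SchwartzMap.smulLeftCLM_apply_apply hm, smul_eq_mul] at h
  have h3 : (fun x => φ x * (m x * G x)) = fun x => m x * φ x * G x := by
    funext x; ring
  rw [h3]
  exact h

theorem congr_ae (hT : Represents T G) (h : G =ᵐ[volume] H) : Represents T H := by
  intro φ
  have h' : (fun x => φ x * G x) =ᵐ[volume] fun x => φ x * H x := by
    filter_upwards [h] with x hx
    rw [hx]
  exact ⟨(hT φ).1.congr h', by rw [(hT φ).2, integral_congr_ae h']⟩

/-- A bump function equal to one on the compact set turns integrability against test functions into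
integrability of `G` there. -/
theorem locallyIntegrable (hT : Represents T G) : LocallyIntegrable G := by
  rw [locallyIntegrable_iff]
  intro K hK
  obtain ⟨R, hR0, hR⟩ := hK.isBounded.subset_closedBall_lt 0 (0 : E3)
  let f : ContDiffBump (0 : E3) := ⟨R, R + 1, hR0, by linarith⟩
  have hf1 : HasCompactSupport (Complex.ofRealCLM ∘ f) := f.hasCompactSupport.comp_left rfl
  have hf2 : ContDiff ℝ (⊤ : ℕ∞) (Complex.ofRealCLM ∘ f) := Complex.ofRealCLM.contDiff.comp f.contDiff
  have h := (hT (hf1.toSchwartzMap hf2)).1.integrableOn (s := K)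
  refine h.congr_fun (fun x hx => ?_) hK.measurableSet
  have : f x = 1 := f.one_of_mem_closedBall (hR hx)
  simp [this]

theorem aestronglyMeasurable (hT : Represents T G) : AEStronglyMeasurable G volume :=
  hT.locallyIntegrable.aestronglyMeasurable

theorem ae_eq (hG : Represents T G) (hH : Represents T H) : G =ᵐ[volume] H := by
  refine ae_eq_of_integral_contDiff_smul_eq hG.locallyIntegrable hH.locallyIntegrable ?_
  intro g hg hc
  have h1 : HasCompactSupport (Complex.ofRealCLM ∘ g) := hc.comp_left rfl
  have h2 : ContDiff ℝ (⊤ : ℕ∞) (Complex.ofRealCLM ∘ g) := Complex.ofRealCLM.contDiff.comp hg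
  have h := (hG (h1.toSchwartzMap h2)).2.symm.trans (hH (h1.toSchwartzMap h2)).2
  simpa using h

end Represents

theorem represents_Lp {p : ℝ≥0∞} [hp : Fact (1 ≤ p)] (f : Lp ℂ p (volume : Measure E3)) :
    Represents (Lp.toTemperedDistribution f) f := by
  intro φ
  have := ENNReal.HolderConjugate.inv_one_sub_inv' hp.out
  refine ⟨?_, by simp⟩
  have h := (Lp.memLp f).mul' (φ.memLp (1 - p⁻¹)⁻¹ volume) (r := 1)
  exact memLp_one_iff_integrable.1 h

theorem Represents.eq_toTemperedDistribution {p : ℝ≥0∞} [hp : Fact (1 ≤ p)] {T : 𝓢'(E3, ℂ)}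
    {G : E3 → ℂ} (hT : Represents T G) (hG : MemLp G p) :
    T = Lp.toTemperedDistribution (hG.toLp G) := by
  ext φ
  rw [(hT φ).2, (represents_Lp _ φ).2]
  refine integral_congr_ae ?_
  filter_upwards [hG.coeFn_toLp] with x hx
  rw [hx]

/-! ### The Hausdorff–Young inequality, up to a constant. -/

theorem fourier_toTemperedDistribution_L1 (f : Lp ℂ 1 (volume : Measure E3)) :
    ∃ g : Lp ℂ ∞ (volume : Measure E3),
      𝓕 (Lp.toTemperedDistribution f) = Lp.toTemperedDistribution g ∧ ‖g‖ₑ ≤ ‖f‖ₑ := by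
  have hf : Integrable f := L1.integrable_coeFn f
  have hbd : ∀ x, ‖𝓕 (f : E3 → ℂ) x‖ ≤ ‖f‖ := by
    intro x
    rw [L1.norm_eq_integral_norm]
    exact VectorFourier.norm_fourierIntegral_le_integral_norm _ _ _ _ _
  have hc : Continuous (𝓕 (f : E3 → ℂ)) :=
    VectorFourier.fourierIntegral_continuous Real.continuous_fourierChar continuous_inner hf
  have hm : MemLp (𝓕 (f : E3 → ℂ)) ∞ volume :=
    memLp_top_of_bound hc.aestronglyMeasurable _ (Filter.Eventually.of_forall hbd)
  have hrep : Represents (𝓕 (Lp.toTemperedDistribution f)) (𝓕 (f : E3 → ℂ)) := by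
    intro φ
    refine ⟨?_, ?_⟩
    · exact φ.integrable.mul_bdd hc.aestronglyMeasurable (Filter.Eventually.of_forall hbd)
    -- Fubini moves the Fourier transform from the test function to `f`.
    · rw [TemperedDistribution.fourier_apply, Lp.toTemperedDistribution_apply]
      simpa using! VectorFourier.integral_bilin_fourierIntegral_eq_flip (.mul ℂ ℂ) (L := innerₗ E3)
        Real.continuous_fourierChar continuous_inner φ.integrable hf
  refine ⟨hm.toLp _, hrep.eq_toTemperedDistribution hm, ?_⟩
  rw [Lp.enorm_toLp, ← ofReal_norm]
  refine (eLpNormEssSup_le_of_ae_bound (Filter.Eventually.of_forall hbd))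

theorem fourierInv_toTemperedDistribution_L1 (f : Lp ℂ 1 (volume : Measure E3)) :
    ∃ g : Lp ℂ ∞ (volume : Measure E3),
      𝓕⁻ (Lp.toTemperedDistribution f) = Lp.toTemperedDistribution g ∧ ‖g‖ₑ ≤ ‖f‖ₑ := by
  have hf : Integrable f := L1.integrable_coeFn f
  have hbd : ∀ x, ‖𝓕⁻ (f : E3 → ℂ) x‖ ≤ ‖f‖ := by
    intro x
    rw [L1.norm_eq_integral_norm]
    exact VectorFourier.norm_fourierIntegral_le_integral_norm _ _ _ _ _
  have hc : Continuous (𝓕⁻ (f : E3 → ℂ)) :=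
    VectorFourier.fourierIntegral_continuous Real.continuous_fourierChar
      (by exact (continuous_inner (𝕜 := ℝ) (E := E3)).neg) hf
  have hm : MemLp (𝓕⁻ (f : E3 → ℂ)) ∞ volume :=
    memLp_top_of_bound hc.aestronglyMeasurable _ (Filter.Eventually.of_forall hbd)
  have hrep : Represents (𝓕⁻ (Lp.toTemperedDistribution f)) (𝓕⁻ (f : E3 → ℂ)) := by
    intro φ
    refine ⟨?_, ?_⟩
    · exact φ.integrable.mul_bdd hc.aestronglyMeasurable (Filter.Eventually.of_forall hbd)
    · rw [TemperedDistribution.fourierInv_apply, Lp.toTemperedDistribution_apply]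
      have hflip : (-innerₗ E3).flip = -innerₗ E3 := by
        ext x y
        simp [real_inner_comm]
      have h := VectorFourier.integral_bilin_fourierIntegral_eq_flip (.mul ℂ ℂ)
        (L := -innerₗ E3) Real.continuous_fourierChar
        (by exact (continuous_inner (𝕜 := ℝ) (E := E3)).neg) (φ.integrable (μ := volume)) hf
      rw [hflip] at h
      simp only [SchwartzMap.fourierInv_coe]
      exact h
  refine ⟨hm.toLp _, hrep.eq_toTemperedDistribution hm, ?_⟩
  rw [Lp.enorm_toLp, ← ofReal_norm]
  refine (eLpNormEssSup_le_of_ae_bound (Filter.Eventually.of_forall hbd))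

theorem lintegral_Ioc_rpow {b s : ℝ} (hb : 0 ≤ b) (hs : -1 < s) :
    ∫⁻ x in Ioc 0 b, ENNReal.ofReal (x ^ s) = ENNReal.ofReal (b ^ (s + 1) / (s + 1)) := by
  have hint := (intervalIntegral.intervalIntegrable_rpow' (a := 0) (b := b) hs)
  rw [intervalIntegrable_iff_integrableOn_Ioc_of_le hb] at hint
  rw [← ofReal_integral_eq_lintegral_ofReal hint, ← intervalIntegral.integral_of_le hb,
    integral_rpow (Or.inl hs), Real.zero_rpow (by linarith), sub_zero]
  refine (ae_restrict_iff' measurableSet_Ioc).2 (Filter.Eventually.of_forall fun x hx => ?_)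
  exact Real.rpow_nonneg hx.1.le _

/-- The interpolation step in the Hausdorff–Young inequality: level set estimates obtained by
truncation give the strong-type bound. -/
theorem lintegral_rpow_le_of_meas_le {α : Type*} [MeasurableSpace α] {μ : Measure α} [SFinite μ]
    {f g : α → ℝ} {p q I : ℝ} (hp1 : 1 < p) (hp2 : p < 2) (hpq : p.HolderConjugate q)
    (hf : Measurable f) (hf0 : ∀ x, 0 ≤ f x) (hg : AEMeasurable g μ) (hg0 : ∀ x, 0 ≤ g x)
    (hI : 0 < I)
    (h : ∀ a t : ℝ, 0 < a → 0 < t → a ^ (1 - p) * I ≤ t / 2 →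
      μ {x | t < g x} ≤
        ENNReal.ofReal (4 * t ^ (-2 : ℝ)) * ∫⁻ x in {x | f x ≤ a}, ENNReal.ofReal (f x ^ 2) ∂μ) :
    ∫⁻ x, ENNReal.ofReal (g x ^ q) ∂μ ≤
      ENNReal.ofReal (4 * q * ((2 * I) ^ (q - 2) / (q - 2))) *
        ∫⁻ x, ENNReal.ofReal (f x ^ p) ∂μ := by
  have hp0 : 0 < p - 1 := by linarith
  have hqeq : q = p / (p - 1) := hpq.conjugate_eq
  have hq2 : 2 < q := by
    rw [hqeq, lt_div_iff₀ hp0]; linarith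
  set K := 2 * I with hK
  have hK0 : 0 < K := by positivity
  -- The truncation height at level `t` is the one with `a^(1-p) I = t / 2` exactly, the borderline
  -- case of the hypothesis `h`.
  set a : ℝ → ℝ := fun t => (K / t) ^ (1 / (p - 1)) with ha
  have ham : Measurable a := by
    rw [ha]; fun_prop
  have key : ∀ t : ℝ, 0 < t → μ {x | t < g x} * ENNReal.ofReal (t ^ (q - 1)) ≤
      ∫⁻ x, ENNReal.ofReal (4 * t ^ (q - 3)) *
        {x | f x ≤ a t}.indicator (fun x => ENNReal.ofReal (f x ^ 2)) x ∂μ := by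
    intro t ht
    have h1 := h (a t) t (by positivity) ht (by
      rw [ha]
      simp only
      rw [← Real.rpow_mul (by positivity),
        show 1 / (p - 1) * (1 - p) = -1 by rw [one_div, ← neg_sub p 1]; field_simp,
        Real.rpow_neg_one, hK]
      apply le_of_eq
      field_simp)
    rw [lintegral_const_mul _ (by
      exact Measurable.indicator (by fun_prop) (measurableSet_le hf measurable_const)),
      lintegral_indicator (measurableSet_le hf measurable_const)]
    calc _ ≤ _ := mul_le_mul_left h1 _
      _ = _ := by
        rw [mul_right_comm, ← ENNReal.ofReal_mul (by positivity), mul_assoc, ← Real.rpow_add ht]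
        congr 3
        ring_nf
  rw [lintegral_rpow_eq_lintegral_meas_lt_mul μ (Filter.Eventually.of_forall hg0) hg (by linarith)]
  have hq0 : 0 < q := by linarith
  have hset : MeasurableSet {z : ℝ × α | f z.2 ≤ a z.1} :=
    measurableSet_le (hf.comp measurable_snd) (ham.comp measurable_fst)
  have hmeas : Measurable (fun z : ℝ × α => ENNReal.ofReal (4 * z.1 ^ (q - 3)) *
      {x | f x ≤ a z.1}.indicator (fun x => ENNReal.ofReal (f x ^ 2)) z.2) := by
    have h2 : (fun z : ℝ × α =>
        {x | f x ≤ a z.1}.indicator (fun x => ENNReal.ofReal (f x ^ 2)) z.2) =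
        {z : ℝ × α | f z.2 ≤ a z.1}.indicator (fun z => ENNReal.ofReal (f z.2 ^ 2)) := by
      funext z
      simp [indicator]
    have h3 : Measurable (fun z : ℝ × α =>
        {x | f x ≤ a z.1}.indicator (fun x => ENNReal.ofReal (f x ^ 2)) z.2) := by
      rw [h2]
      exact Measurable.indicator (by fun_prop) hset
    exact Measurable.mul (by fun_prop) h3
  calc ENNReal.ofReal q * ∫⁻ t in Ioi 0, μ {x | t < g x} * ENNReal.ofReal (t ^ (q - 1))
      ≤ ENNReal.ofReal q * ∫⁻ t in Ioi 0, ∫⁻ x, ENNReal.ofReal (4 * t ^ (q - 3)) *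
        {x | f x ≤ a t}.indicator (fun x => ENNReal.ofReal (f x ^ 2)) x ∂μ := by
        refine mul_le_mul_right ?_ _
        exact setLIntegral_mono' measurableSet_Ioi fun t ht => key t ht
    _ = ENNReal.ofReal q * ∫⁻ x, (∫⁻ t in Ioi (0 : ℝ), ENNReal.ofReal (4 * t ^ (q - 3)) *
        {x | f x ≤ a t}.indicator (fun x => ENNReal.ofReal (f x ^ 2)) x) ∂μ := by
        rw [lintegral_lintegral_swap hmeas.aemeasurable]
    _ ≤ ENNReal.ofReal q * ∫⁻ x, ENNReal.ofReal (4 * (K ^ (q - 2) / (q - 2))) *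
          ENNReal.ofReal (f x ^ p) ∂μ := by
        refine mul_le_mul_right ?_ _
        refine lintegral_mono fun x => ?_
        rcases (hf0 x).eq_or_lt with h0 | h0
        · have : ∀ t : ℝ, ENNReal.ofReal (4 * t ^ (q - 3)) *
              {x | f x ≤ a t}.indicator (fun x => ENNReal.ofReal (f x ^ 2)) x = 0 := by
            intro t
            simp [indicator, ← h0]
          simp only [this, lintegral_zero]
          exact zero_le
        -- After Tonelli, `x` is fixed and `f x ≤ a t` is solved for `t`: it means `t ≤ b`. The
        -- power `t^(q-3)` is integrable at zero because `q > 2`.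
        · set b := K * f x ^ (1 - p) with hb
          have hb0 : 0 < b := by positivity
          calc _ ≤ ∫⁻ t in Ioi 0, (Ioc 0 b).indicator
                (fun t => ENNReal.ofReal (4 * f x ^ 2) * ENNReal.ofReal (t ^ (q - 3))) t := by
                refine setLIntegral_mono' measurableSet_Ioi fun t ht => ?_
                have ht : 0 < t := ht
                by_cases hfx : f x ≤ a t
                · have htb : t ∈ Ioc 0 b := by
                    refine ⟨ht, ?_⟩
                    have h4 : f x ^ (p - 1) ≤ K / t := by
                      calc f x ^ (p - 1) ≤ (a t) ^ (p - 1) :=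
                            Real.rpow_le_rpow h0.le hfx hp0.le
                        _ = K / t := by
                            rw [ha]
                            simp only
                            rw [← Real.rpow_mul (by positivity), one_div_mul_cancel hp0.ne',
                              Real.rpow_one]
                    rw [hb, ← neg_sub p 1, Real.rpow_neg h0.le, ← div_eq_mul_inv]
                    rw [le_div_iff₀ ht] at h4
                    rw [le_div_iff₀ (by positivity)]
                    linarith
                  rw [indicator_of_mem htb, indicator_of_mem (by exact hfx),
                    ← ENNReal.ofReal_mul (by positivity), ← ENNReal.ofReal_mul (by positivity)]
                  apply le_of_eq
                  congr 1
                  ring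
                · rw [indicator_of_notMem (by exact hfx)]
                  simp
            _ = ENNReal.ofReal (4 * f x ^ 2) * ENNReal.ofReal (b ^ (q - 2) / (q - 2)) := by
                rw [setLIntegral_indicator measurableSet_Ioc,
                  inter_eq_self_of_subset_left (fun t ht => ht.1),
                  lintegral_const_mul _ (by fun_prop), lintegral_Ioc_rpow hb0.le (by linarith),
                  show q - 3 + 1 = q - 2 by ring]
            _ = _ := by
                rw [← ENNReal.ofReal_mul (by positivity),
                  ← ENNReal.ofReal_mul (by
                    have : 0 < q - 2 := by linarith
                    positivity)]
                congr 1
                have h5 : b ^ (q - 2) = K ^ (q - 2) * f x ^ ((1 - p) * (q - 2)) := by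
                  rw [hb, Real.mul_rpow hK0.le (by positivity), ← Real.rpow_mul h0.le]
                have h6 : f x ^ 2 * f x ^ ((1 - p) * (q - 2)) = f x ^ p := by
                  rw [← Real.rpow_two, ← Real.rpow_add h0]
                  congr 1
                  rw [hqeq]
                  field_simp
                  ring
                rw [h5, ← h6]
                ring
    _ = _ := by
        rw [lintegral_const_mul _ (by fun_prop), ← mul_assoc, ← ENNReal.ofReal_mul hq0.le]
        congr 2
        ring

theorem lintegral_enorm_rpow_eq {α : Type*} [MeasurableSpace α] {μ : Measure α} (f : α → ℂ) {r : ℝ}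
    (hr : 0 ≤ r) :
    ∫⁻ x, ‖f x‖ₑ ^ r ∂μ = ∫⁻ x, ENNReal.ofReal (‖f x‖ ^ r) ∂μ := by
  refine lintegral_congr fun x => ?_
  rw [← ofReal_norm, ENNReal.ofReal_rpow_of_nonneg (norm_nonneg _) hr]

section Truncation

variable {f : E3 → ℂ} {p : ℝ≥0∞}

/-- Where `|f| > a`, the exponent `1 - p` is negative and `|f| = |f|^(1-p) |f|^p ≤ a^(1-p) |f|^p`.
The large part is thus in `L¹`. -/
theorem eLpNorm_one_truncation_le (hf : StronglyMeasurable f) (hp1 : 1 < p) (hp2 : p < 2)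
    {a : ℝ} (ha : 0 < a) :
    eLpNorm ({x | a < ‖f x‖}.indicator f) 1 volume ≤
      ENNReal.ofReal (a ^ (1 - p.toReal)) * ∫⁻ x, ENNReal.ofReal (‖f x‖ ^ p.toReal) := by
  have hm : Measurable fun x => ‖f x‖ := hf.norm.measurable
  have hpr : 1 < p.toReal := by
    have := (ENNReal.toReal_lt_toReal (by simp) (hp2.trans_le le_top).ne).2 hp1
    simpa using this
  rw [eLpNorm_one_eq_lintegral_enorm, ← lintegral_const_mul _ (by fun_prop)]
  refine lintegral_mono fun x => ?_
  by_cases hx : a < ‖f x‖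
  · rw [indicator_of_mem (by exact hx), ← ofReal_norm, ← ENNReal.ofReal_mul (by positivity)]
    apply ENNReal.ofReal_le_ofReal
    have hf0 : 0 < ‖f x‖ := ha.trans hx
    have h1 : ‖f x‖ ^ (1 - p.toReal) ≤ a ^ (1 - p.toReal) :=
      Real.rpow_le_rpow_of_nonpos ha hx.le (by linarith)
    calc ‖f x‖ = ‖f x‖ ^ (1 - p.toReal) * ‖f x‖ ^ p.toReal := by
          rw [← Real.rpow_add hf0]; simp
      _ ≤ _ := by gcongr
  · rw [indicator_of_notMem (by exact hx)]
    simp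

/-- Where `|f| ≤ a`, the exponent `2 - p` is positive and `|f|² ≤ a^(2-p) |f|^p`. The bounded part
is thus in `L²`. -/
theorem lintegral_sq_truncation_le (hf : StronglyMeasurable f) (hp2 : p < 2)
    {a : ℝ} (ha : 0 < a) :
    ∫⁻ x in {x | ‖f x‖ ≤ a}, ENNReal.ofReal (‖f x‖ ^ 2) ≤
      ENNReal.ofReal (a ^ (2 - p.toReal)) * ∫⁻ x, ENNReal.ofReal (‖f x‖ ^ p.toReal) := by
  have hm : Measurable fun x => ‖f x‖ := hf.norm.measurable
  have hpr : p.toReal < 2 := by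
    have := (ENNReal.toReal_lt_toReal (hp2.trans_le le_top).ne (by simp)).2 hp2
    simpa using this
  rw [← lintegral_const_mul _ (by fun_prop)]
  refine (setLIntegral_mono' (measurableSet_le hm measurable_const) fun x hx => ?_).trans
    (setLIntegral_le_lintegral _ _)
  rw [← ENNReal.ofReal_mul (by positivity)]
  apply ENNReal.ofReal_le_ofReal
  rcases (norm_nonneg (f x)).eq_or_lt with h0 | h0
  · rw [← h0]
    simp only [ne_eq, OfNat.ofNat_ne_zero, not_false_eq_true, zero_pow]
    positivity
  · have h1 : ‖f x‖ ^ (2 - p.toReal) ≤ a ^ (2 - p.toReal) :=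
      Real.rpow_le_rpow h0.le hx (by linarith)
    calc ‖f x‖ ^ 2 = ‖f x‖ ^ (2 - p.toReal) * ‖f x‖ ^ p.toReal := by
          rw [← Real.rpow_add h0, ← Real.rpow_two]; simp
      _ ≤ _ := by gcongr

theorem eLpNorm_two_sq_truncation (hf : StronglyMeasurable f) (a : ℝ) :
    eLpNorm ({x | ‖f x‖ ≤ a}.indicator f) 2 volume ^ (2 : ℝ) =
      ∫⁻ x in {x | ‖f x‖ ≤ a}, ENNReal.ofReal (‖f x‖ ^ 2) := by
  have hm : Measurable fun x => ‖f x‖ := hf.norm.measurable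
  rw [eLpNorm_eq_lintegral_rpow_enorm_toReal (by simp) (by simp), ← ENNReal.rpow_mul]
  simp only [ENNReal.toReal_ofNat, one_div, ne_eq, OfNat.ofNat_ne_zero, not_false_eq_true,
    inv_mul_cancel₀, ENNReal.rpow_one]
  rw [← lintegral_indicator (measurableSet_le hm measurable_const)]
  refine lintegral_congr fun x => ?_
  by_cases hx : ‖f x‖ ≤ a
  · rw [indicator_of_mem (by exact hx), indicator_of_mem (by exact hx), ← ofReal_norm,
      ENNReal.ofReal_rpow_of_nonneg (norm_nonneg _) (by norm_num), Real.rpow_two]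
  · rw [indicator_of_notMem (by exact hx), indicator_of_notMem (by exact hx)]
    simp

end Truncation

set_option maxHeartbeats 800000 in
/-- Hausdorff–Young, up to a constant, for an additive map on tempered distributions that maps
`L¹` to `L^∞` and `L²` to `L²` contractively. -/
theorem hausdorffYoung_of_endpoints (Φ : 𝓢'(E3, ℂ) → 𝓢'(E3, ℂ))
    (hadd : ∀ S T, Φ (S + T) = Φ S + Φ T)
    (h1 : ∀ f : Lp ℂ 1 (volume : Measure E3), ∃ g : Lp ℂ ∞ (volume : Measure E3),
      Φ (Lp.toTemperedDistribution f) = Lp.toTemperedDistribution g ∧ ‖g‖ₑ ≤ ‖f‖ₑ)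
    (h2 : ∀ f : Lp ℂ 2 (volume : Measure E3), ∃ g : Lp ℂ 2 (volume : Measure E3),
      Φ (Lp.toTemperedDistribution f) = Lp.toTemperedDistribution g ∧ ‖g‖ₑ ≤ ‖f‖ₑ)
    (p q : ℝ≥0∞) [Fact (1 ≤ p)] [Fact (1 ≤ q)] [hpq : p.HolderConjugate q] (hp : p ≤ 2) :
    ∃ C : ℝ, 0 < C ∧ ∀ f : Lp ℂ p (volume : Measure E3), ∃ g : Lp ℂ q (volume : Measure E3),
      Φ (Lp.toTemperedDistribution f) = Lp.toTemperedDistribution g ∧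
        ‖g‖ₑ ≤ ENNReal.ofReal C * ‖f‖ₑ := by
  rcases (Fact.out : 1 ≤ p).eq_or_lt with hp1 | hp1
  · subst hp1
    obtain rfl : q = ∞ := ENNReal.HolderConjugate.unique 1 q ∞
    exact ⟨1, one_pos, by simpa using h1⟩
  rcases hp.eq_or_lt with hp2 | hp2
  · subst hp2
    obtain rfl : q = 2 := ENNReal.HolderConjugate.unique 2 q 2
    exact ⟨1, one_pos, by simpa using h2⟩
  have hptop : p ≠ ∞ := (hp2.trans_le le_top).ne
  have hp0 : p ≠ 0 := (zero_lt_one.trans hp1).ne'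
  have hpr1 : 1 < p.toReal := by
    have := (ENNReal.toReal_lt_toReal (by simp) hptop).2 hp1
    simpa using this
  have hpr2 : p.toReal < 2 := by
    have := (ENNReal.toReal_lt_toReal hptop (by simp)).2 hp2
    simpa using this
  have hpqr : p.toReal.HolderConjugate q.toReal := ENNReal.HolderConjugate.toReal hpr1
  have hqr : 2 < q.toReal := by
    rw [hpqr.conjugate_eq, lt_div_iff₀ (by linarith)]; linarith
  have hqtop : q ≠ ∞ := by
    rintro rfl
    simp at hqr
    linarith
  have hq0 : q ≠ 0 := by
    rintro rfl
    simp at hqr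
    linarith
  set pr := p.toReal
  set qr := q.toReal
  have hqr2 : 0 < qr - 2 := by linarith
  refine ⟨(4 * qr * (2 ^ (qr - 2) / (qr - 2))) ^ (1 / qr), by positivity, fun f => ?_⟩
  have hfm : StronglyMeasurable f := Lp.stronglyMeasurable f
  have hm : Measurable fun x => ‖f x‖ := hfm.norm.measurable
  have hfint : Integrable (fun x => ‖f x‖ ^ pr) volume :=
    (Lp.memLp f).integrable_norm_rpow hp0 hptop
  set I := ∫ x, ‖f x‖ ^ pr with hI
  have hJ : ∫⁻ x, ENNReal.ofReal (‖f x‖ ^ pr) = ENNReal.ofReal I :=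
    (ofReal_integral_eq_lintegral_ofReal hfint
      (Filter.Eventually.of_forall fun x => by positivity)).symm
  have hI0 : 0 ≤ I := integral_nonneg fun x => by positivity
  have hfnorm : ‖f‖ₑ = ENNReal.ofReal (I ^ (1 / pr)) := by
    rw [Lp.enorm_def, eLpNorm_eq_lintegral_rpow_enorm_toReal hp0 hptop,
      lintegral_enorm_rpow_eq _ (by linarith), hJ, ENNReal.ofReal_rpow_of_nonneg hI0 (by positivity)]
  rcases hI0.eq_or_lt with hI1 | hIpos
  -- The interpolation step needs a positive integral. Since `Φ` is only additive, its value at zero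
  -- is read off the `L²` endpoint.
  · have : f = 0 := by
      rw [← hI1, Real.zero_rpow (by positivity)] at hfnorm
      simpa using hfnorm
    subst this
    obtain ⟨g, hg, hgn⟩ := h2 0
    have hg0 : g = 0 := by simpa using hgn
    refine ⟨0, ?_, by simp⟩
    have e1 : Lp.toTemperedDistribution (0 : Lp ℂ p (volume : Measure E3)) = 0 :=
      map_zero (Lp.toTemperedDistributionCLM ℂ volume p)
    have e2 : Lp.toTemperedDistribution (0 : Lp ℂ q (volume : Measure E3)) = 0 :=
      map_zero (Lp.toTemperedDistributionCLM ℂ volume q)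
    have e3 : Lp.toTemperedDistribution (0 : Lp ℂ 2 (volume : Measure E3)) = 0 :=
      map_zero (Lp.toTemperedDistributionCLM ℂ volume 2)
    rw [hg0, e3] at hg
    rw [e1, e2, hg]
  have hlo : ∀ a : ℝ, 0 < a → MemLp ({x | ‖f x‖ ≤ a}.indicator f) 2 volume := by
    intro a ha
    refine ⟨(hfm.indicator (measurableSet_le hm measurable_const)).aestronglyMeasurable, ?_⟩
    have h3 := eLpNorm_two_sq_truncation hfm a
    have h4 := lintegral_sq_truncation_le hfm hp2 ha
    rw [← h3, hJ] at h4
    by_contra hcon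
    rw [not_lt, top_le_iff] at hcon
    rw [hcon] at h4
    simp [← ENNReal.ofReal_mul (Real.rpow_nonneg ha.le (2 - p.toReal))] at h4
  have hhi : ∀ a : ℝ, 0 < a → MemLp ({x | a < ‖f x‖}.indicator f) 1 volume := by
    intro a ha
    refine ⟨(hfm.indicator (measurableSet_lt measurable_const hm)).aestronglyMeasurable, ?_⟩
    refine (eLpNorm_one_truncation_le hfm hp1 hp2 ha).trans_lt ?_
    rw [hJ]
    exact ENNReal.mul_lt_top ENNReal.ofReal_lt_top ENNReal.ofReal_lt_top
  have hsplit : ∀ a : ℝ, ∀ ha : 0 < a, Lp.toTemperedDistribution f =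
      Lp.toTemperedDistribution ((hhi a ha).toLp _) +
        Lp.toTemperedDistribution ((hlo a ha).toLp _) := by
    intro a ha
    ext φ
    have r := (represents_Lp ((hhi a ha).toLp _)).add (represents_Lp ((hlo a ha).toLp _))
    rw [(r φ).2, (represents_Lp f φ).2]
    refine integral_congr_ae ?_
    filter_upwards [(hhi a ha).coeFn_toLp, (hlo a ha).coeFn_toLp] with x hx hx'
    rw [hx, hx']
    by_cases h : ‖f x‖ ≤ a
    · simp [indicator, h, not_lt.2 h]
    · simp [indicator, h, not_le.1 h]
  choose gh hgh hghn using fun a : Ioi (0 : ℝ) => h1 ((hhi a a.2).toLp _)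
  choose gl hgl hgln using fun a : Ioi (0 : ℝ) => h2 ((hlo a a.2).toLp _)
  have hrep : ∀ a : Ioi (0 : ℝ), Represents (Φ (Lp.toTemperedDistribution f))
      (fun x => gh a x + gl a x) := by
    intro a
    rw [hsplit a a.2, hadd, hgh, hgl]
    exact (represents_Lp _).add (represents_Lp _)
  -- The splitting at height one provides the representative. A splitting at any other height
  -- represents the same distribution, so it gives the same function almost everywhere and the
  -- height may vary with the level.
  set G : E3 → ℂ := fun x => gh ⟨1, mem_Ioi.2 one_pos⟩ x + gl ⟨1, mem_Ioi.2 one_pos⟩ x with hG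
  have hGrep := hrep ⟨1, mem_Ioi.2 one_pos⟩
  have hGm : AEStronglyMeasurable G volume := hGrep.aestronglyMeasurable
  have key := lintegral_rpow_le_of_meas_le (μ := (volume : Measure E3)) (f := fun x => ‖f x‖)
    (g := fun x => ‖G x‖) hpr1 hpr2 hpqr hm (fun x => norm_nonneg _) hGm.norm.aemeasurable
    (fun x => norm_nonneg _) hIpos (by
      intro a t ha ht hat
      have e1 : ∀ᵐ x, ‖gh ⟨a, ha⟩ x‖ ≤ t / 2 := by
        have h3 : eLpNorm (gh ⟨a, ha⟩) ∞ volume ≤ ENNReal.ofReal (t / 2) := by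
          rw [← Lp.enorm_def]
          refine (hghn ⟨a, ha⟩).trans ?_
          rw [Lp.enorm_toLp]
          refine (eLpNorm_one_truncation_le hfm hp1 hp2 ha).trans ?_
          rw [hJ, ← ENNReal.ofReal_mul (by positivity)]
          exact ENNReal.ofReal_le_ofReal hat
        rw [eLpNorm_exponent_top] at h3
        filter_upwards [ae_le_eLpNormEssSup (f := gh ⟨a, ha⟩) (μ := volume)] with x hx
        have := hx.trans h3
        rwa [← ofReal_norm, ENNReal.ofReal_le_ofReal_iff (by positivity)] at this
      have e2 : ∀ᵐ x, G x = gh ⟨a, ha⟩ x + gl ⟨a, ha⟩ x := hGrep.ae_eq (hrep ⟨a, ha⟩)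
      -- The image of the large part is at most `t / 2`, so the image of the bounded part exceeds `t
      -- / 2` wherever `|G| > t`; Chebyshev in `L²` measures that set.
      calc volume {x | t < ‖G x‖}
          ≤ volume {x | ENNReal.ofReal (t / 2) ≤ ‖gl ⟨a, ha⟩ x‖ₑ} := by
            refine measure_mono_ae ?_
            filter_upwards [e1, e2] with x hx1 hx2 hx3
            change t < ‖G x‖ at hx3
            change ENNReal.ofReal (t / 2) ≤ ‖gl ⟨a, ha⟩ x‖ₑ
            rw [← ofReal_norm]
            apply ENNReal.ofReal_le_ofReal
            rw [hx2] at hx3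
            have := norm_add_le (gh ⟨a, ha⟩ x) (gl ⟨a, ha⟩ x)
            linarith
        _ ≤ (ENNReal.ofReal (t / 2))⁻¹ ^ (2 : ℝ) * eLpNorm (gl ⟨a, ha⟩) 2 volume ^ (2 : ℝ) := by
            have := meas_ge_le_mul_pow_eLpNorm_enorm (p := 2) volume (by simp) (by simp)
              (Lp.aestronglyMeasurable (gl ⟨a, ha⟩)) (ε := ENNReal.ofReal (t / 2))
              (by simpa using ht) (by simp)
            simpa using this
        _ ≤ ENNReal.ofReal (4 * t ^ (-2 : ℝ)) *
            eLpNorm ({x | ‖f x‖ ≤ a}.indicator f) 2 volume ^ (2 : ℝ) := by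
            gcongr
            · rw [← ENNReal.ofReal_inv_of_pos (by positivity),
                ENNReal.ofReal_rpow_of_nonneg (by positivity) (by norm_num)]
              apply ENNReal.ofReal_le_ofReal
              rw [Real.rpow_neg ht.le, Real.rpow_two, Real.rpow_two]
              apply le_of_eq
              field_simp
              norm_num
            · have := hgln ⟨a, ha⟩
              rwa [Lp.enorm_def, Lp.enorm_toLp] at this
        _ = _ := by rw [eLpNorm_two_sq_truncation hfm a])
  have hGnorm : eLpNorm G q volume ≤
      ENNReal.ofReal ((4 * qr * (2 ^ (qr - 2) / (qr - 2))) ^ (1 / qr)) * ‖f‖ₑ := by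
    rw [eLpNorm_eq_lintegral_rpow_enorm_toReal hq0 hqtop, lintegral_enorm_rpow_eq _ (by linarith)]
    rw [hJ, ← ENNReal.ofReal_mul (by positivity)] at key
    refine (ENNReal.rpow_le_rpow key (by positivity)).trans ?_
    rw [hfnorm, ← ENNReal.ofReal_mul (by positivity),
      ENNReal.ofReal_rpow_of_nonneg (by positivity) (by positivity)]
    apply le_of_eq
    congr 1
    have e3 : 4 * qr * ((2 * I) ^ (qr - 2) / (qr - 2)) * I =
        (4 * qr * (2 ^ (qr - 2) / (qr - 2))) * I ^ (qr - 1) := by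
      rw [Real.mul_rpow (by norm_num) hI0, show qr - 1 = (qr - 2) + 1 by ring,
        Real.rpow_add hIpos, Real.rpow_one]
      ring
    rw [e3, Real.mul_rpow (by positivity) (by positivity), ← Real.rpow_mul hI0]
    congr 2
    -- The power of `I` is `(q - 1) / q = 1 / p`, as homogeneity in `f` requires.
    have hinv := hpqr.inv_add_inv_eq_one
    rw [one_div, one_div, sub_mul, mul_inv_cancel₀ (by positivity), one_mul]
    linarith
  have hGmem : MemLp G q volume := ⟨hGm, hGnorm.trans_lt (ENNReal.mul_lt_top (by simp) (by simp))⟩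
  refine ⟨hGmem.toLp G, hGrep.eq_toTemperedDistribution hGmem, ?_⟩
  rw [Lp.enorm_toLp]
  exact hGnorm

/-- If the Fourier transform of `T` is the function `G`, then `‖G‖_{r'} ≤ C ‖T‖_r` for `r ≤ 2`. -/
theorem eLpNorm_fourier_le_distNorm (r r' : ℝ≥0∞) [Fact (1 ≤ r)] [Fact (1 ≤ r')]
    [r.HolderConjugate r'] (hr : r ≤ 2) :
    ∃ C : ℝ, 0 < C ∧ ∀ (T : 𝓢'(E3, ℂ)) (G : E3 → ℂ), Represents (𝓕 T) G →
      eLpNorm G r' volume ≤ ENNReal.ofReal C * distNorm r T := by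
  obtain ⟨C, hC, h⟩ := hausdorffYoung_of_endpoints (fun T => 𝓕 T) (fun S T => fourier_add S T)
    fourier_toTemperedDistribution_L1
    (fun f => ⟨𝓕 f, Lp.fourier_toTemperedDistribution_eq f, by
      rw [← ofReal_norm, ← ofReal_norm, Lp.norm_fourier_eq]⟩) r r' hr
  refine ⟨C, hC, fun T G hG => ?_⟩
  have hC0 : ENNReal.ofReal C ≠ 0 := by simpa using hC
  rw [distNorm]
  simp only [ENNReal.mul_iInf_of_ne hC0 ENNReal.ofReal_ne_top]
  refine le_iInf fun f => le_iInf fun hf => ?_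
  obtain ⟨g, hg, hgn⟩ := h f
  rw [hf] at hg
  refine le_trans (le_of_eq ?_) hgn
  rw [Lp.enorm_def]
  rw [hg] at hG
  exact eLpNorm_congr_ae (hG.ae_eq (represents_Lp g))

/-- If the Fourier transform of `T` is the function `G`, then `‖T‖_q ≤ C ‖G‖_{q'}` for `q ≥ 2`. -/
theorem distNorm_le_eLpNorm_fourier (q q' : ℝ≥0∞) [Fact (1 ≤ q)] [Fact (1 ≤ q')]
    [q'.HolderConjugate q] (hq : q' ≤ 2) :
    ∃ C : ℝ, 0 < C ∧ ∀ (T : 𝓢'(E3, ℂ)) (G : E3 → ℂ), Represents (𝓕 T) G →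
      distNorm q T ≤ ENNReal.ofReal C * eLpNorm G q' volume := by
  obtain ⟨C, hC, h⟩ := hausdorffYoung_of_endpoints (fun T => 𝓕⁻ T) (fun S T => fourierInv_add S T)
    fourierInv_toTemperedDistribution_L1
    (fun f => ⟨𝓕⁻ f, Lp.fourierInv_toTemperedDistribution_eq f, by
      rw [← ofReal_norm, ← ofReal_norm, ← Lp.norm_fourier_eq (𝓕⁻ f), fourier_fourierInv_eq]⟩) q' q hq
  refine ⟨C, hC, fun T G hG => ?_⟩
  have hC0 : ENNReal.ofReal C ≠ 0 := by simpa using hC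
  by_cases htop : eLpNorm G q' volume = ∞
  · rw [htop, ENNReal.mul_top hC0]
    exact le_top
  have hmem : MemLp G q' volume := ⟨hG.aestronglyMeasurable, lt_top_iff_ne_top.2 htop⟩
  obtain ⟨g, hg, hgn⟩ := h (hmem.toLp G)
  rw [Lp.enorm_toLp] at hgn
  refine le_trans ?_ hgn
  refine iInf₂_le g ?_
  rw [← hg, ← hG.eq_toTemperedDistribution hmem, fourierInv_fourier_eq]

/-! ### Wave numbers, derivative symbols and gradient norms on the Fourier side. -/

/-- The modulus `|k| = 2π|ξ|` of the wave number. -/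
noncomputable def waveNumber (ξ : E3) : ℝ := 2 * Real.pi * ‖ξ‖

theorem waveNumber_nonneg (ξ : E3) : 0 ≤ waveNumber ξ := by
  unfold waveNumber; positivity

theorem continuous_waveNumber : Continuous waveNumber := by
  unfold waveNumber; fun_prop

/-- The symbol `i k_j` of `∂_j`. -/
noncomputable def derivSymbol (j : Fin 3) (ξ : E3) : ℂ := 2 * Real.pi * Complex.I * (ξ j : ℂ)

theorem hasTemperateGrowth_derivSymbol (j : Fin 3) : (derivSymbol j).HasTemperateGrowth := by
  have h1 : (fun ξ : E3 => ξ j).HasTemperateGrowth :=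
    (EuclideanSpace.proj (𝕜 := ℝ) j).hasTemperateGrowth
  have h2 := Function.Complex.hasTemperateGrowth_ofReal.comp h1
  exact (Function.HasTemperateGrowth.const (2 * Real.pi * Complex.I)).mul h2

theorem norm_derivSymbol (j : Fin 3) (ξ : E3) : ‖derivSymbol j ξ‖ = 2 * Real.pi * |ξ j| := by
  simp [derivSymbol, abs_of_pos Real.pi_pos]

theorem norm_derivSymbol_le (j : Fin 3) (ξ : E3) : ‖derivSymbol j ξ‖ ≤ waveNumber ξ := by
  rw [norm_derivSymbol, waveNumber]
  have := PiLp.norm_apply_le ξ j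
  rw [Real.norm_eq_abs] at this
  have := Real.pi_pos
  gcongr

theorem waveNumber_le_sum (ξ : E3) : waveNumber ξ ≤ ∑ j, ‖derivSymbol j ξ‖ := by
  simp only [norm_derivSymbol, waveNumber, ← Finset.mul_sum]
  have h : ‖ξ‖ ≤ ∑ j, |ξ j| := by
    rw [EuclideanSpace.norm_eq, Real.sqrt_le_left (Finset.sum_nonneg fun _ _ => abs_nonneg _)]
    simp only [Real.norm_eq_abs, Fin.sum_univ_three]
    have h0 := abs_nonneg (ξ 0)
    have h1 := abs_nonneg (ξ 1)
    have h2 := abs_nonneg (ξ 2)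
    nlinarith [mul_nonneg h0 h1, mul_nonneg h0 h2, mul_nonneg h1 h2]
  have := Real.pi_pos
  gcongr

theorem sum_normSq_derivSymbol (ξ : E3) : ∑ j, derivSymbol j ξ ^ 2 = -(waveNumber ξ : ℂ) ^ 2 := by
  have h : ‖ξ‖ ^ 2 = ∑ j, ξ j ^ 2 := by
    rw [EuclideanSpace.norm_sq_eq]
    simp
  have h' : ((‖ξ‖ : ℝ) : ℂ) ^ 2 = ∑ j, (ξ j : ℂ) ^ 2 := by
    exact_mod_cast congrArg (fun x : ℝ => (x : ℂ)) h
  simp only [derivSymbol, waveNumber, mul_pow, Complex.I_sq, ← Finset.mul_sum, Complex.ofReal_mul,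
    h']
  push_cast
  ring

theorem Represents.pd {T : 𝓢'(E3, ℂ)} {G : E3 → ℂ} (h : Represents (𝓕 T) G) (j : Fin 3) :
    Represents (𝓕 (pd j T)) (fun ξ => derivSymbol j ξ * G ξ) := by
  rw [_root_.pd, TemperedDistribution.fourier_lineDerivOp_eq]
  have h1 : (fun ξ : E3 => ((inner ℝ ξ (EuclideanSpace.single j (1 : ℝ)) : ℝ) : ℂ)).HasTemperateGrowth
      := Function.Complex.hasTemperateGrowth_ofReal.comp (by fun_prop)
  have h2 := (h.smulLeft h1).smul (2 * Real.pi * Complex.I)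
  convert h2 using 2 with ξ
  simp [derivSymbol, EuclideanSpace.inner_single_right]
  ring

theorem Represents.iteratedLineDeriv {n : ℕ} {T : 𝓢'(E3, ℂ)} {G : E3 → ℂ}
    (h : Represents (𝓕 T) G) (J : Fin n → Fin 3) :
    Represents (𝓕 (∂^{fun a => (EuclideanSpace.single (J a) (1 : ℝ) : E3)} T))
      (fun ξ => (∏ a, derivSymbol (J a) ξ) * G ξ) := by
  induction n with
  | zero => simpa using h
  | succ n ih =>
    have h1 := (ih (Fin.tail J)).pd (J 0)
    rw [LineDeriv.iteratedLineDerivOp_succ_left]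
    simp only [Fin.prod_univ_succ, mul_assoc]
    exact h1

/-- Expanding the `n`-th power enumerates all index strings of length `n`; this makes the full
`n`-th gradient comparable to `|k|^n`. -/
theorem sum_prod_norm_derivSymbol (n : ℕ) (ξ : E3) :
    ∑ J : Fin n → Fin 3, ‖∏ a, derivSymbol (J a) ξ‖ = (∑ j, ‖derivSymbol j ξ‖) ^ n := by
  simp only [norm_prod, Fintype.sum_pow]

/-- Since `|k|^n ≤ (∑ |k_j|)^n`, the weight is dominated by the sum of the symbols of all
derivatives of order `n`, and Hausdorff–Young applies to each. The constant does not depend on `n`.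
-/
theorem eLpNorm_waveNumber_pow_le_gradNorm (r r' : ℝ≥0∞) [Fact (1 ≤ r)] [hr' : Fact (1 ≤ r')]
    [r.HolderConjugate r'] (hr : r ≤ 2) :
    ∃ C : ℝ, 0 < C ∧ ∀ (n : ℕ) (T : 𝓢'(E3, ℂ)) (G : E3 → ℂ), Represents (𝓕 T) G →
      eLpNorm (fun ξ => waveNumber ξ ^ n * ‖G ξ‖) r' volume ≤
        ENNReal.ofReal C * gradNorm n r T := by
  obtain ⟨C, hC, h⟩ := eLpNorm_fourier_le_distNorm r r' hr
  refine ⟨C, hC, fun n T G hG => ?_⟩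
  have hm : ∀ J : Fin n → Fin 3, AEStronglyMeasurable
      (fun ξ => ‖(∏ a, derivSymbol (J a) ξ) * G ξ‖) volume :=
    fun J => (hG.iteratedLineDeriv J).aestronglyMeasurable.norm
  calc eLpNorm (fun ξ => waveNumber ξ ^ n * ‖G ξ‖) r' volume
      ≤ eLpNorm (∑ J : Fin n → Fin 3, fun ξ => ‖(∏ a, derivSymbol (J a) ξ) * G ξ‖) r' volume := by
        refine eLpNorm_mono_real fun ξ => ?_
        rw [Real.norm_of_nonneg (mul_nonneg (pow_nonneg (waveNumber_nonneg ξ) _) (norm_nonneg _)),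
          Finset.sum_apply]
        simp only [norm_mul, ← Finset.sum_mul]
        rw [sum_prod_norm_derivSymbol]
        gcongr
        · exact waveNumber_nonneg ξ
        · exact waveNumber_le_sum ξ
    _ ≤ ∑ J : Fin n → Fin 3, eLpNorm (fun ξ => ‖(∏ a, derivSymbol (J a) ξ) * G ξ‖) r' volume :=
        eLpNorm_sum_le (fun J _ => hm J) hr'.out
    _ ≤ ENNReal.ofReal C * gradNorm n r T := by
        rw [gradNorm, Finset.mul_sum]
        refine Finset.sum_le_sum fun J _ => ?_
        rw [eLpNorm_norm]
        exact h _ _ (hG.iteratedLineDeriv J)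

/-- Each of the `3^n` derivatives has a symbol bounded by `|k|^n`. -/
theorem gradNorm_le_eLpNorm_waveNumber_pow (q q' : ℝ≥0∞) [Fact (1 ≤ q)] [Fact (1 ≤ q')]
    [q'.HolderConjugate q] (hq : q' ≤ 2) (n : ℕ) :
    ∃ C : ℝ, 0 < C ∧ ∀ (T : 𝓢'(E3, ℂ)) (G : E3 → ℂ), Represents (𝓕 T) G →
      gradNorm n q T ≤
        ENNReal.ofReal C * eLpNorm (fun ξ => waveNumber ξ ^ n * ‖G ξ‖) q' volume := by
  obtain ⟨C, hC, h⟩ := distNorm_le_eLpNorm_fourier q q' hq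
  refine ⟨3 ^ n * C, by positivity, fun T G hG => ?_⟩
  calc gradNorm n q T ≤ ∑ _J : Fin n → Fin 3,
        ENNReal.ofReal C * eLpNorm (fun ξ => waveNumber ξ ^ n * ‖G ξ‖) q' volume := by
        refine Finset.sum_le_sum fun J _ => ?_
        refine (h _ _ (hG.iteratedLineDeriv J)).trans (mul_le_mul_right ?_ _)
        refine eLpNorm_mono_real fun ξ => ?_
        rw [norm_mul, norm_prod]
        gcongr
        calc ∏ a, ‖derivSymbol (J a) ξ‖ ≤ ∏ _a : Fin n, waveNumber ξ :=
              Finset.prod_le_prod (fun _ _ => norm_nonneg _) fun a _ => norm_derivSymbol_le _ _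
          _ = waveNumber ξ ^ n := by simp
    _ = _ := by
        simp only [Finset.sum_const, Finset.card_univ, Fintype.card_pi, Fintype.card_fin,
          Finset.prod_const, nsmul_eq_mul]
        rw [ENNReal.ofReal_mul (by positivity), ← mul_assoc]
        congr 2
        simp [ENNReal.ofReal_pow]

theorem represents_fourier_toDist_L2 (f : L2) :
    Represents (𝓕 (toDist f)) (𝓕 (Complex.ofRealCLM.compLp f) : Lp ℂ 2 (volume : Measure E3)) := by
  rw [toDist, Lp.fourier_toTemperedDistribution_eq]
  exact represents_Lp _

theorem Represents.heatFlow {T : 𝓢'(E3, ℂ)} {G : E3 → ℂ} (h : Represents (𝓕 T) G) {μ t : ℝ}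
    (hμ : 0 ≤ μ * t) :
    Represents (𝓕 (heatFlow μ t T)) (fun ξ => heatSymbol μ t ξ * G ξ) := by
  rw [_root_.heatFlow, TemperedDistribution.fourierMultiplierCLM_apply, fourier_fourierInv_eq]
  exact h.smulLeft (hasTemperateGrowth_heatSymbol hμ)

theorem exists_represents_fourier_toDist {p p' : ℝ≥0∞} [Fact (1 ≤ p)] [Fact (1 ≤ p')]
    [p.HolderConjugate p'] (hp : p ≤ 2) (f : Lp ℝ p (volume : Measure E3)) :
    ∃ G : E3 → ℂ, Represents (𝓕 (toDist f)) G := by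
  obtain ⟨C, hC, h⟩ := hausdorffYoung_of_endpoints (fun T => 𝓕 T) (fun S T => fourier_add S T)
    fourier_toTemperedDistribution_L1
    (fun f => ⟨𝓕 f, Lp.fourier_toTemperedDistribution_eq f, by
      rw [← ofReal_norm, ← ofReal_norm, Lp.norm_fourier_eq]⟩) p p' hp
  obtain ⟨g, hg, -⟩ := h (Complex.ofRealCLM.compLp f)
  refine ⟨g, ?_⟩
  rw [toDist, hg]
  exact represents_Lp g

theorem recip_sub_eq {p q : ℝ≥0∞} (hp : 1 ≤ p) (hpq : p ≤ q) :
    recip p - recip q = (p⁻¹ - q⁻¹).toReal := by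
  rw [recip, recip, ENNReal.toReal_sub_of_le (ENNReal.inv_le_inv.2 hpq)]
  simpa using (zero_lt_one.trans_le hp).ne'

/-- A multiplier in `L^a` with `1/a = 1/p - 1/q` maps `L^{p'}` to `L^{q'}` by Hölder. At low
frequency it will be a Gaussian, at high frequency a negative power of `|k|`. -/
theorem holderTriple_inv_sub_inv {p q p' q' : ℝ≥0∞} [hp : p.HolderConjugate p']
    [hq : q'.HolderConjugate q] (hpq : p ≤ q) : (p⁻¹ - q⁻¹)⁻¹.HolderTriple p' q' := by
  constructor
  have h1 : p⁻¹ + p'⁻¹ = 1 := by simpa using hp.inv_add_inv_eq_inv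
  have h2 : q'⁻¹ + q⁻¹ = 1 := by simpa using hq.inv_add_inv_eq_inv
  have hq0 : q⁻¹ ≠ ∞ := by
    intro h
    rw [h] at h2
    simp at h2
  rw [inv_inv]
  have h3 : (p⁻¹ - q⁻¹ + p'⁻¹) + q⁻¹ = q'⁻¹ + q⁻¹ := by
    rw [h2, ← h1, add_right_comm, tsub_add_cancel_of_le (ENNReal.inv_le_inv.2 hpq)]
  exact (ENNReal.add_left_inj hq0).1 h3

/-! ### Multiplier estimates at low and at high frequency. -/

theorem lintegral_exp_neg_mul_sq_norm {b : ℝ} (hb : 0 < b) :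
    ∫⁻ ξ : E3, ENNReal.ofReal (Real.exp (-b * ‖ξ‖ ^ 2)) =
      ENNReal.ofReal ((Real.pi / b) ^ (3 / 2 : ℝ)) := by
  have h := GaussianFourier.integral_rexp_neg_mul_sq_norm (V := E3) hb
  have hpos : 0 < (Real.pi / b) ^ (Module.finrank ℝ E3 / 2 : ℝ) := by
    have := Real.pi_pos
    positivity
  have hint : Integrable (fun ξ : E3 => Real.exp (-b * ‖ξ‖ ^ 2)) := by
    by_contra hcon
    rw [integral_undef hcon] at h
    exact hpos.ne h
  rw [← ofReal_integral_eq_lintegral_ofReal hint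
    (Filter.Eventually.of_forall fun ξ => (Real.exp_pos _).le), h]
  simp

/-- Scaling of a three-dimensional Gaussian gives `τ^(-3/(2a))`; for `a = ∞` the power is zero. -/
theorem eLpNorm_gaussian_le (a : ℝ≥0∞) (ha : a ≠ 0) {b : ℝ} (hb : 0 < b) :
    ∃ C : ℝ, 0 < C ∧ ∀ τ : ℝ, 0 < τ →
      eLpNorm (fun ξ : E3 => Real.exp (-(b * waveNumber ξ ^ 2 * τ))) a volume ≤
        ENNReal.ofReal (C * τ ^ (-(3 / 2) * (a⁻¹).toReal)) := by
  have hpi := Real.pi_pos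
  by_cases htop : a = ∞
  · subst htop
    refine ⟨1, one_pos, fun τ hτ => ?_⟩
    simp only [ENNReal.inv_top, ENNReal.toReal_zero, mul_zero, Real.rpow_zero, mul_one,
      ENNReal.ofReal_one]
    rw [eLpNorm_exponent_top]
    refine (eLpNormEssSup_le_of_ae_bound (C := 1) (Filter.Eventually.of_forall fun ξ => ?_)).trans
      (by simp)
    rw [Real.norm_of_nonneg (Real.exp_pos _).le, Real.exp_le_one_iff]
    have : 0 ≤ b * waveNumber ξ ^ 2 * τ := by positivity
    linarith
  have har : 0 < a.toReal := ENNReal.toReal_pos ha htop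
  refine ⟨((Real.pi / (a.toReal * b * (2 * Real.pi) ^ 2)) ^ (3 / 2 : ℝ)) ^ (1 / a.toReal),
    by positivity, fun τ hτ => ?_⟩
  rw [eLpNorm_eq_lintegral_rpow_enorm_toReal ha htop]
  have h1 : ∀ ξ : E3, ‖Real.exp (-(b * waveNumber ξ ^ 2 * τ))‖ₑ ^ a.toReal =
      ENNReal.ofReal (Real.exp (-(a.toReal * b * (2 * Real.pi) ^ 2 * τ) * ‖ξ‖ ^ 2)) := by
    intro ξ
    rw [← ofReal_norm, Real.norm_of_nonneg (Real.exp_pos _).le,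
      ENNReal.ofReal_rpow_of_nonneg (Real.exp_pos _).le har.le, ← Real.exp_mul, waveNumber]
    congr 2
    ring
  simp only [h1]
  rw [lintegral_exp_neg_mul_sq_norm (by positivity),
    ENNReal.ofReal_rpow_of_nonneg (by positivity) (by positivity)]
  apply ENNReal.ofReal_le_ofReal
  apply le_of_eq
  rw [← div_div, Real.div_rpow (by positivity) hτ.le, Real.div_rpow (by positivity) (by positivity),
    div_eq_mul_inv]
  congr 1
  rw [← Real.rpow_mul hτ.le, ← Real.rpow_neg hτ.le]
  congr 1
  rw [ENNReal.toReal_inv]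
  ring

/-- From `x ≤ 1 + x²` and a single term of the exponential series at `b (1 + x²)`. -/
theorem pow_mul_exp_neg_sq_le (n : ℕ) {b : ℝ} (hb : 0 < b) :
    ∃ K : ℝ, 0 < K ∧ ∀ x : ℝ, 0 ≤ x → x ^ n * Real.exp (-(b * x ^ 2)) ≤ K := by
  refine ⟨n.factorial * (1 / b) ^ n * Real.exp b, by positivity, fun x hx => ?_⟩
  have h1 : (b * (1 + x ^ 2)) ^ n / n.factorial ≤ Real.exp (b * (1 + x ^ 2)) :=
    Real.pow_div_factorial_le_exp _ (by positivity) n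
  have h2 : x ^ n ≤ (1 + x ^ 2) ^ n := by
    gcongr
    nlinarith [sq_nonneg (x - 1)]
  rw [div_le_iff₀ (by positivity), mul_pow] at h1
  have h3 : (1 + x ^ 2) ^ n ≤ n.factorial * (1 / b) ^ n * Real.exp (b * (1 + x ^ 2)) := by
    have hbn : 0 < b ^ n := by positivity
    rw [one_div, inv_pow, mul_right_comm, ← div_eq_mul_inv, le_div_iff₀ hbn]
    linarith
  calc x ^ n * Real.exp (-(b * x ^ 2))
      ≤ (n.factorial * (1 / b) ^ n * Real.exp (b * (1 + x ^ 2))) * Real.exp (-(b * x ^ 2)) := by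
        gcongr
        exact h2.trans h3
    _ = _ := by
        rw [mul_assoc, ← Real.exp_add]
        congr 2
        ring

/-- Low-frequency estimate: diffusive decay from `L^{p'}` to `L^{q'}` on the Fourier side. -/
theorem eLpNorm_lowFreq_le {p q p' q' : ℝ≥0∞} [hp1 : Fact (1 ≤ p)] [hp : p.HolderConjugate p']
    [hq : q'.HolderConjugate q] (hpq : p ≤ q) (n : ℕ) {c δ : ℝ} (hc : 0 < c) :
    ∃ C : ℝ, 0 < C ∧ ∀ t : ℝ, 0 ≤ t → ∀ X : E3 → ℝ, AEStronglyMeasurable X volume →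
      eLpNorm ({ξ | waveNumber ξ ≤ δ}.indicator
          fun ξ => waveNumber ξ ^ n * Real.exp (-(c * waveNumber ξ ^ 2 * t)) * X ξ) q' volume ≤
        ENNReal.ofReal (C * (1 + t) ^ (-(3 / 2) * (recip p - recip q) - (n : ℝ) / 2)) *
          eLpNorm X p' volume := by
  have hT : (p⁻¹ - q⁻¹)⁻¹.HolderTriple p' q' := holderTriple_inv_sub_inv hpq
  have ha0 : (p⁻¹ - q⁻¹)⁻¹ ≠ 0 := by
    simp only [ne_eq, ENNReal.inv_eq_zero]
    intro h
    have : p⁻¹ = ∞ := by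
      by_contra hcon
      exact (ENNReal.sub_ne_top hcon) h
    rw [ENNReal.inv_eq_top] at this
    have := hp1.out
    simp_all
  obtain ⟨C, hC, hgauss⟩ := eLpNorm_gaussian_le (p⁻¹ - q⁻¹)⁻¹ ha0 (b := c / 2) (by positivity)
  obtain ⟨K, hK, hpow⟩ := pow_mul_exp_neg_sq_le n (b := c / 2) (by positivity)
  refine ⟨Real.exp (c * δ ^ 2) * K * C, by positivity, fun t ht X hX => ?_⟩
  -- Passing from `t` to `1 + t` costs `exp(c δ²)`, because `s ≤ δ`. Half of the Gaussian exponent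
  -- then absorbs `s^n` as `τ^(-n/2)`; the other half is kept for Hölder.
  set τ := 1 + t with hτ
  have hτ0 : 0 < τ := by linarith
  set A := Real.exp (c * δ ^ 2) * K * τ ^ (-(n : ℝ) / 2) with hA
  have hA0 : 0 ≤ A := by positivity
  have hpt : ∀ ξ, ‖{ξ | waveNumber ξ ≤ δ}.indicator
      (fun ξ => waveNumber ξ ^ n * Real.exp (-(c * waveNumber ξ ^ 2 * t)) * X ξ) ξ‖ ≤
      A * ‖((fun ξ => Real.exp (-(c / 2 * waveNumber ξ ^ 2 * τ))) • X) ξ‖ := by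
    intro ξ
    have hs := waveNumber_nonneg ξ
    set s := waveNumber ξ with hsdef
    by_cases hξ : s ≤ δ
    · rw [indicator_of_mem (by exact hξ)]
      simp only [Pi.smul_apply', smul_eq_mul, norm_mul, norm_pow,
        Real.norm_of_nonneg (Real.exp_pos _).le, ← hsdef, Real.norm_of_nonneg hs]
      rw [← mul_assoc]
      refine mul_le_mul_of_nonneg_right ?_ (abs_nonneg _)
      have h1 := hpow (s * Real.sqrt τ) (by positivity)
      rw [mul_pow, mul_pow, Real.sq_sqrt hτ0.le] at h1
      have h2 : Real.sqrt τ ^ n = τ ^ ((n : ℝ) / 2) := by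
        rw [Real.sqrt_eq_rpow, ← Real.rpow_natCast, ← Real.rpow_mul hτ0.le]
        congr 1
        ring
      rw [h2] at h1
      have h3 : s ^ n * Real.exp (-(c / 2 * (s ^ 2 * τ))) ≤ K * τ ^ (-(n : ℝ) / 2) := by
        rw [neg_div, Real.rpow_neg hτ0.le, ← div_eq_mul_inv, le_div_iff₀ (by positivity)]
        linarith
      calc s ^ n * Real.exp (-(c * s ^ 2 * t))
          = Real.exp (c * s ^ 2) * (s ^ n * Real.exp (-(c / 2 * (s ^ 2 * τ)))) *
              Real.exp (-(c / 2 * s ^ 2 * τ)) := by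
            have : Real.exp (-(c * s ^ 2 * t)) = Real.exp (c * s ^ 2) *
                Real.exp (-(c / 2 * (s ^ 2 * τ))) * Real.exp (-(c / 2 * s ^ 2 * τ)) := by
              rw [← Real.exp_add, ← Real.exp_add]
              congr 1
              rw [hτ]
              ring
            rw [this]
            ring
        _ ≤ Real.exp (c * δ ^ 2) * (K * τ ^ (-(n : ℝ) / 2)) *
              Real.exp (-(c / 2 * s ^ 2 * τ)) := by gcongr
        _ = _ := by rw [hA]; ring
    · rw [indicator_of_notMem (by exact hξ), norm_zero]
      positivity
  refine (eLpNorm_le_mul_eLpNorm_of_ae_le_mul (Filter.Eventually.of_forall hpt) q').trans ?_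
  have hgm : AEStronglyMeasurable
      (fun ξ : E3 => Real.exp (-(c / 2 * waveNumber ξ ^ 2 * τ))) volume := by
    have := continuous_waveNumber
    exact Continuous.aestronglyMeasurable (by fun_prop)
  calc _ ≤ ENNReal.ofReal A * (eLpNorm (fun ξ : E3 =>
          Real.exp (-(c / 2 * waveNumber ξ ^ 2 * τ))) (p⁻¹ - q⁻¹)⁻¹ volume *
          eLpNorm X p' volume) :=
        mul_le_mul_right (eLpNorm_smul_le_mul_eLpNorm hX hgm) _
    _ ≤ ENNReal.ofReal A * (ENNReal.ofReal (C * τ ^ (-(3 / 2) * (p⁻¹ - q⁻¹).toReal)) *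
          eLpNorm X p' volume) := by
        have := hgauss τ hτ0
        rw [inv_inv] at this
        gcongr
    _ = _ := by
        rw [← mul_assoc, ← ENNReal.ofReal_mul hA0, recip_sub_eq hp1.out hpq]
        congr 2
        rw [hA, sub_eq_add_neg, Real.rpow_add hτ0, neg_div]
        ring

theorem one_add_norm_le_waveNumber {δ : ℝ} (hδ : 0 < δ) {ξ : E3} (h : δ < waveNumber ξ) :
    1 + ‖ξ‖ ≤ (1 / δ + 1) * waveNumber ξ := by
  have h1 : 1 ≤ 1 / δ * waveNumber ξ := by
    rw [one_div, ← div_eq_inv_mul, le_div_iff₀ hδ]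
    linarith
  have h2 : ‖ξ‖ ≤ waveNumber ξ := by
    rw [waveNumber]
    have := Real.pi_gt_three
    nlinarith [norm_nonneg ξ]
  linarith

/-- In dimension three `|k|^(-N)` is in `L^a` at infinity once `N a > 3`, and the cutoff at `δ`
removes the singularity at the origin. -/
theorem eLpNorm_inv_waveNumber_pow_lt_top {a : ℝ≥0∞} (ha : a ≠ 0) {N : ℕ}
    (hN : 3 * (a⁻¹).toReal < N ∨ a = ∞) {δ : ℝ} (hδ : 0 < δ) :
    eLpNorm ({ξ : E3 | δ < waveNumber ξ}.indicator fun ξ => (waveNumber ξ ^ N)⁻¹) a volume < ∞ := by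
  by_cases htop : a = ∞
  · subst htop
    rw [eLpNorm_exponent_top]
    refine (eLpNormEssSup_le_of_ae_bound (C := (δ ^ N)⁻¹)
      (Filter.Eventually.of_forall fun ξ => ?_)).trans_lt ENNReal.ofReal_lt_top
    by_cases hξ : δ < waveNumber ξ
    · rw [indicator_of_mem (by exact hξ), Real.norm_of_nonneg
        (inv_nonneg.2 (pow_nonneg (waveNumber_nonneg ξ) _))]
      gcongr
    · rw [indicator_of_notMem (by exact hξ), norm_zero]
      positivity
  have hN : 3 * (a⁻¹).toReal < N := hN.resolve_right htop
  have har : 0 < a.toReal := ENNReal.toReal_pos ha htop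
  have hlt : (Module.finrank ℝ E3 : ℝ) < N * a.toReal := by
    rw [ENNReal.toReal_inv, ← div_eq_mul_inv, div_lt_iff₀ har] at hN
    simpa using hN
  have hfin := finite_integral_one_add_norm (E := E3) (μ := volume) hlt
  have hmem : eLpNorm (fun ξ : E3 => (1 + ‖ξ‖) ^ (-(N : ℝ))) a volume < ∞ := by
    rw [eLpNorm_eq_lintegral_rpow_enorm_toReal ha htop]
    refine ENNReal.rpow_lt_top_of_nonneg (by positivity) ?_
    convert hfin.ne using 3 with ξ
    rw [← ofReal_norm, Real.norm_of_nonneg (by positivity),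
      ENNReal.ofReal_rpow_of_nonneg (by positivity) har.le, ← Real.rpow_mul (by positivity)]
    congr 2
    ring
  refine (eLpNorm_le_mul_eLpNorm_of_ae_le_mul (c := (1 / δ + 1) ^ N)
    (Filter.Eventually.of_forall fun ξ => ?_) a).trans_lt
    (ENNReal.mul_lt_top ENNReal.ofReal_lt_top hmem)
  have hpos : 0 < 1 + ‖ξ‖ := by positivity
  rw [Real.norm_of_nonneg (by positivity : 0 ≤ (1 + ‖ξ‖) ^ (-(N : ℝ))), Real.rpow_neg hpos.le,
    Real.rpow_natCast]
  by_cases hξ : δ < waveNumber ξ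
  · rw [indicator_of_mem (by exact hξ), Real.norm_of_nonneg
      (inv_nonneg.2 (pow_nonneg (waveNumber_nonneg ξ) _)), ← div_eq_mul_inv,
      le_div_iff₀ (by positivity), inv_mul_le_iff₀ (pow_pos (hδ.trans hξ) _), mul_comm,
      ← mul_pow]
    gcongr
    exact one_add_norm_le_waveNumber hδ hξ
  · rw [indicator_of_notMem (by exact hξ), norm_zero]
    positivity

/-- High-frequency estimate: `N` additional derivatives in `L^{r'}` control the `L^{q'}` norm away
from the origin. -/
theorem eLpNorm_highFreq_le {r q r' q' : ℝ≥0∞} [hr1 : Fact (1 ≤ r)] [hr : r.HolderConjugate r']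
    [hq : q'.HolderConjugate q] (hrq : r ≤ q) (m : ℕ) {N : ℕ}
    (hN : 3 * (recip r - recip q) < N ∨ r = q) {δ : ℝ} (hδ : 0 < δ) :
    ∃ C : ℝ, 0 < C ∧ ∀ X : E3 → ℝ, AEStronglyMeasurable X volume →
      eLpNorm ({ξ | δ < waveNumber ξ}.indicator fun ξ => waveNumber ξ ^ m * X ξ) q' volume ≤
        ENNReal.ofReal C * eLpNorm (fun ξ => waveNumber ξ ^ (m + N) * X ξ) r' volume := by
  have hT : (r⁻¹ - q⁻¹)⁻¹.HolderTriple r' q' := holderTriple_inv_sub_inv hrq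
  have ha0 : (r⁻¹ - q⁻¹)⁻¹ ≠ 0 := by
    simp only [ne_eq, ENNReal.inv_eq_zero]
    intro h
    have : r⁻¹ = ∞ := by
      by_contra hcon
      exact (ENNReal.sub_ne_top hcon) h
    rw [ENNReal.inv_eq_top] at this
    have := hr1.out
    simp_all
  have hfin := eLpNorm_inv_waveNumber_pow_lt_top ha0 (N := N) (hN.imp
    (fun h => by rw [inv_inv, ← recip_sub_eq hr1.out hrq]; exact h) (fun h => by simp [h])) hδ
  set w := {ξ : E3 | δ < waveNumber ξ}.indicator fun ξ => (waveNumber ξ ^ N)⁻¹ with hw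
  set D := (eLpNorm w (r⁻¹ - q⁻¹)⁻¹ volume).toReal
  -- The added one only makes the constant positive.
  refine ⟨D + 1, by positivity, fun X hX => ?_⟩
  have hset : MeasurableSet {ξ : E3 | δ < waveNumber ξ} :=
    measurableSet_lt measurable_const continuous_waveNumber.measurable
  have hwm : AEStronglyMeasurable w volume := by
    refine (Measurable.indicator ?_ hset).aestronglyMeasurable
    exact ((continuous_waveNumber.measurable).pow_const N).inv
  have hXm : AEStronglyMeasurable (fun ξ => waveNumber ξ ^ (m + N) * X ξ) volume :=
    ((continuous_waveNumber.pow _).aestronglyMeasurable).mul hX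
  have h_eq : ({ξ : E3 | δ < waveNumber ξ}.indicator fun ξ => waveNumber ξ ^ m * X ξ) =
      w • fun ξ => waveNumber ξ ^ (m + N) * X ξ := by
    funext ξ
    by_cases hξ : δ < waveNumber ξ
    · have : waveNumber ξ ≠ 0 := (hδ.trans hξ).ne'
      rw [hw, Pi.smul_apply', indicator_of_mem (by exact hξ), indicator_of_mem (by exact hξ),
        smul_eq_mul, pow_add]
      field_simp
    · rw [hw, Pi.smul_apply', indicator_of_notMem (by exact hξ), indicator_of_notMem (by exact hξ),
        zero_smul]
  rw [h_eq]
  refine (eLpNorm_smul_le_mul_eLpNorm (hpqr := hT) hXm hwm).trans (mul_le_mul_left ?_ _)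
  rw [← ENNReal.ofReal_toReal hfin.ne]
  exact ENNReal.ofReal_le_ofReal (by simp [D])

/-- Integrability of `|k|^(-N)` requires a strict inequality, hence the integer part plus one. The
other branch of the index has `r = q`, where the multiplier need only be bounded. -/
theorem lossIndex_spec {ℓ : ℝ} (hℓ : 0 ≤ ℓ) (r q : ℝ≥0∞) :
    3 * (recip r - recip q) < lossIndex ℓ r q ∨ r = q := by
  unfold lossIndex
  split_ifs with h
  · exact Or.inr (h.2.1.trans h.2.2.symm)
  · left
    push_cast
    have := Nat.lt_floor_add_one (ℓ + 3 * (recip r - recip q))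
    linarith

/-! ### Energy decay of a single mode. -/

/-- The function `e^{at} (y - b/(a-d) e^{-dt})` is nonincreasing. The condition `d ≤ a/2` bounds
`1/(a-d)` by `2/a`, so there is no resonance. -/
theorem le_exp_of_deriv_le {y y' : ℝ → ℝ} {a b d : ℝ} (ha : 0 < a) (hb : 0 ≤ b) (hd : d ≤ a / 2)
    (hy : ∀ t, HasDerivAt y (y' t) t)
    (h : ∀ t, 0 ≤ t → y' t ≤ -(a * y t) + b * Real.exp (-(d * t))) {t : ℝ} (ht : 0 ≤ t) :
    y t ≤ Real.exp (-(a * t)) * y 0 + 2 * b / a * Real.exp (-(d * t)) := by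
  have had : 0 < a - d := by linarith
  set z : ℝ → ℝ := fun t => Real.exp (a * t) * (y t - b / (a - d) * Real.exp (-(d * t))) with hz
  have hexp : ∀ k t : ℝ, HasDerivAt (fun t => Real.exp (k * t)) (k * Real.exp (k * t)) t := by
    intro k t
    have := ((hasDerivAt_id t).const_mul k).exp
    simpa [mul_comm] using this
  have hzd : ∀ t, HasDerivAt z (Real.exp (a * t) * (y' t + a * y t - b * Real.exp (-(d * t)))) t := by
    intro t
    have h1 := (hexp a t).mul ((hy t).sub ((hexp (-d) t).const_mul (b / (a - d))))
    simp only [neg_mul] at h1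
    refine h1.congr_deriv ?_
    simp only [Pi.sub_apply]
    field_simp
    ring
  have hanti : AntitoneOn z (Ici 0) := by
    refine antitoneOn_of_deriv_nonpos (convex_Ici 0)
      (fun t _ => (hzd t).continuousAt.continuousWithinAt)
      (fun t _ => (hzd t).differentiableAt.differentiableWithinAt) fun t ht => ?_
    rw [interior_Ici] at ht
    rw [(hzd t).deriv]
    have := h t (le_of_lt ht)
    exact mul_nonpos_of_nonneg_of_nonpos (Real.exp_pos _).le (by linarith)
  have h1 : z t ≤ z 0 := hanti (mem_Ici.2 le_rfl) ht ht
  have h2 : z 0 ≤ y 0 := by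
    simp only [hz, mul_zero, Real.exp_zero, neg_zero, one_mul, mul_one]
    have : 0 ≤ b / (a - d) := by positivity
    linarith
  have h3 : y t = Real.exp (-(a * t)) * z t + b / (a - d) * Real.exp (-(d * t)) := by
    simp only [hz]
    rw [← mul_assoc, ← Real.exp_add]
    simp
  have h4 : b / (a - d) ≤ 2 * b / a := by
    rw [div_le_div_iff₀ had ha]
    nlinarith
  rw [h3]
  gcongr
  exact h1.trans h2

/-- A real solution of the fluid system at wave number `s`, in terms of the densities `ρ`, the
longitudinal velocities `A` and the longitudinal electric field `β`. -/
structure IsMode (P : PlasmaParams) (s : ℝ) (ρ A : Species → ℝ → ℝ) (β : ℝ → ℝ) : Prop where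
  hasDerivAt_ρ : ∀ α t, HasDerivAt (ρ α) (-(s * A α t)) t
  hasDerivAt_A : ∀ α t, HasDerivAt (A α)
    ((P.q α * β t + P.T α * s * ρ α t - P.κ α * A α t) / P.m α) t
  hasDerivAt_β : ∀ t, HasDerivAt β
    (-(4 * Real.pi * P.e * (A .ion t - A .electron t))) t
  gauss : ∀ t, s * β t = 4 * Real.pi * P.e * (ρ .ion t - ρ .electron t)

namespace PlasmaParams

variable (P : PlasmaParams)

theorem κ_pos (α : Species) : 0 < P.κ α := mul_pos (P.m_pos α) (P.ν_pos α)

theorem μ₁_pos : 0 < P.μ₁ :=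
  div_pos (add_pos (P.T_pos _) (P.T_pos _)) (add_pos (P.κ_pos _) (P.κ_pos _))

/-- The physical energy of a mode. -/
noncomputable def energy (ρ A : Species → ℝ) (β : ℝ) : ℝ :=
  P.T .ion * ρ .ion ^ 2 + P.T .electron * ρ .electron ^ 2 +
    (P.m .ion * A .ion ^ 2 + P.m .electron * A .electron ^ 2) + β ^ 2 / (4 * Real.pi)

theorem energy_nonneg (ρ A : Species → ℝ) (β : ℝ) : 0 ≤ P.energy ρ A β := by
  have h1 := P.T_pos .ion
  have h2 := P.T_pos .electron
  have h3 := P.m_pos .ion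
  have h4 := P.m_pos .electron
  have h5 := Real.pi_pos
  unfold energy
  positivity

end PlasmaParams

theorem exists_pos_le_both {a b : ℝ} (ha : 0 < a) (hb : 0 < b) : ∃ x, 0 < x ∧ x ≤ a ∧ x ≤ b :=
  ⟨min a b, lt_min ha hb, min_le_left _ _, min_le_right _ _⟩

/-- The contribution of one species to the derivative of the modified energy. Young's inequality
splits the cross term: one half is covered by the new damping of `ρ`, thanks to `g² ≤ θ`, the other
by friction, thanks to the smallness of `η`. -/
theorem energy_dissipation_species {m T κ η g θ ρ A : ℝ} (hT : 0 < T)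
    (hm : 0 < m) (hη : 0 < η) (hηκ : η * (m + κ ^ 2 / (2 * T)) ≤ κ / 2)
    (hθ1 : θ ≤ 1) (hgθ : g ^ 2 ≤ θ) :
    -(κ * A ^ 2) + η * θ * (m * A ^ 2) - η * θ * (T * ρ ^ 2) + η * g * (κ * (ρ * A)) ≤
      -(η / 2 * θ * (T * ρ ^ 2 + m * A ^ 2)) := by
  have h1 : 2 * (g * (κ * (ρ * A))) ≤ g ^ 2 * (T * ρ ^ 2) + κ ^ 2 / T * A ^ 2 := by
    have h2 : 0 ≤ T * (g * ρ - κ / T * A) ^ 2 := by positivity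
    have h3 : T * (g * ρ - κ / T * A) ^ 2 =
        g ^ 2 * (T * ρ ^ 2) + κ ^ 2 / T * A ^ 2 - 2 * (g * (κ * (ρ * A))) := by
      field_simp
      ring
    linarith
  have h4 : g ^ 2 * (T * ρ ^ 2) ≤ θ * (T * ρ ^ 2) := by gcongr
  have h5 : η * (m + κ ^ 2 / (2 * T)) * A ^ 2 ≤ κ / 2 * A ^ 2 := by gcongr
  have h6 : η * θ * (m * A ^ 2) ≤ η * 1 * (m * A ^ 2) := by gcongr
  have h7 : κ ^ 2 / (2 * T) = κ ^ 2 / T / 2 := by field_simp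
  rw [h7] at h5
  have h8 : η * (2 * (g * (κ * (ρ * A)))) ≤ η * (θ * (T * ρ ^ 2) + κ ^ 2 / T * A ^ 2) := by
    gcongr
    linarith
  have h9 : 0 ≤ η * (κ ^ 2 / T) * A ^ 2 := by positivity
  have h10 : 0 ≤ η * (m * A ^ 2) := by positivity
  linarith

/-- Keeps the correction below a quarter of the energy, so that the modified energy remains
equivalent to it. -/
theorem abs_cross_term_le {m T η g ρ A : ℝ} (hm : 0 < m) (hg : 0 ≤ g)
    (hg2 : g ≤ 1 / 2) (hηT : η ^ 2 * m ≤ T) :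
    |η * g * (m * (ρ * A))| ≤ 1 / 4 * (T * ρ ^ 2 + m * A ^ 2) := by
  have h1 : |η * g * (m * (ρ * A))| = g * (m * |η * (ρ * A)|) := by
    rw [show η * g * (m * (ρ * A)) = g * (m * (η * (ρ * A))) by ring, abs_mul, abs_mul,
      abs_of_nonneg hg, abs_of_pos hm]
  have h2 : 2 * |η * (ρ * A)| ≤ η ^ 2 * ρ ^ 2 + A ^ 2 := by
    have e1 := sq_nonneg (η * ρ - A)
    have e2 := sq_nonneg (η * ρ + A)
    have : |η * (ρ * A)| ≤ (η ^ 2 * ρ ^ 2 + A ^ 2) / 2 := abs_le.2 ⟨by nlinarith, by nlinarith⟩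
    linarith
  rw [h1]
  have h3 : g * (m * |η * (ρ * A)|) ≤ 1 / 2 * (m * |η * (ρ * A)|) := by gcongr
  have h4 : m * (2 * |η * (ρ * A)|) ≤ m * (η ^ 2 * ρ ^ 2 + A ^ 2) := by gcongr
  have h5 : η ^ 2 * m * ρ ^ 2 ≤ T * ρ ^ 2 := by gcongr
  linarith

theorem exists_dissipation_rate (P : PlasmaParams) :
    ∃ η : ℝ, 0 < η ∧ ∀ α, η * (P.m α + P.κ α ^ 2 / (2 * P.T α)) ≤ P.κ α / 2 ∧
      η ^ 2 * P.m α ≤ P.T α := by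
  have key : ∀ α, ∃ η₀ : ℝ, 0 < η₀ ∧ ∀ η, 0 < η → η ≤ η₀ →
      η * (P.m α + P.κ α ^ 2 / (2 * P.T α)) ≤ P.κ α / 2 ∧ η ^ 2 * P.m α ≤ P.T α := by
    intro α
    have hm := P.m_pos α
    have hT := P.T_pos α
    have hκ := P.κ_pos α
    have hB : 0 < P.m α + P.κ α ^ 2 / (2 * P.T α) := by positivity
    obtain ⟨η₁, h1, h1a, h1b⟩ := exists_pos_le_both (div_pos (half_pos hκ) hB) (div_pos hT hm)
    obtain ⟨η₀, h0, h0a, h0b⟩ := exists_pos_le_both h1 one_pos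
    refine ⟨η₀, h0, fun η hη hle => ⟨?_, ?_⟩⟩
    · rw [← le_div_iff₀ hB]
      linarith
    · have e1 : η * P.m α ≤ P.T α := by
        rw [← le_div_iff₀ hm]
        linarith
      have e2 : η ≤ 1 := by linarith
      calc η ^ 2 * P.m α = η * (η * P.m α) := by ring
        _ ≤ 1 * (η * P.m α) := by gcongr
        _ ≤ P.T α := by linarith
  obtain ⟨η₁, h1, h1'⟩ := key .ion
  obtain ⟨η₂, h2, h2'⟩ := key .electron
  obtain ⟨η, hη, ha, hb⟩ := exists_pos_le_both h1 h2
  refine ⟨η, hη, fun α => ?_⟩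
  cases α
  · exact h1' η hη ha
  · exact h2' η hη hb

/-- Every mode decays at a rate comparable to `min(s², 1)`. -/
theorem energy_decay (P : PlasmaParams) :
    ∃ c : ℝ, 0 < c ∧ ∀ (s : ℝ) (ρ A : Species → ℝ → ℝ) (β : ℝ → ℝ), 0 < s → IsMode P s ρ A β →
      ∀ t, 0 ≤ t → P.energy (ρ · t) (A · t) (β t) ≤
        4 * P.energy (ρ · 0) (A · 0) (β 0) * Real.exp (-(c * (s ^ 2 / (1 + s ^ 2)) * t)) := by
  obtain ⟨η, hη, hηP⟩ := exists_dissipation_rate P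
  refine ⟨η / 2, by positivity, fun s ρ A β hs hM t ht => ?_⟩
  have hpi := Real.pi_pos
  set g := s / (1 + s ^ 2) with hg
  set θ := s ^ 2 / (1 + s ^ 2) with hθ
  have hg0 : 0 < g := by positivity
  have hθ0 : 0 < θ := by positivity
  have hgs : g * s = θ := by rw [hg, hθ]; ring
  have hg2 : g ≤ 1 / 2 := by
    rw [hg, div_le_div_iff₀ (by positivity) (by norm_num)]
    nlinarith [sq_nonneg (s - 1)]
  have hθ1 : θ ≤ 1 := by
    rw [hθ, div_le_one (by positivity)]
    linarith
  have hgθ : g ^ 2 ≤ θ := by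
    rw [hg, hθ, div_pow, div_le_div_iff₀ (by positivity) (by positivity)]
    nlinarith [sq_nonneg s, sq_nonneg (s ^ 2)]
  -- Friction damps only `A`. The derivative of the correction contains `-η θ T ρ²` and, because
  -- Gauss's law turns `e β (ρ_i - ρ_e)` into `s β² / (4π)`, also `-η θ β² / (4π)`. The weight `g =
  -- s / (1 + s²)` keeps the correction bounded for all `s`.
  set L : ℝ → ℝ := fun t => P.energy (ρ · t) (A · t) (β t) / 2 -
    η * g * (P.m .ion * (ρ .ion t * A .ion t)) -
    η * g * (P.m .electron * (ρ .electron t * A .electron t)) with hL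
  have hmi := P.m_pos .ion
  have hme := P.m_pos .electron
  have hdist : ∀ t, |L t - P.energy (ρ · t) (A · t) (β t) / 2| ≤
      P.energy (ρ · t) (A · t) (β t) / 4 := by
    intro t
    have e1 := abs_cross_term_le (ρ := ρ .ion t) (A := A .ion t) hmi hg0.le hg2 (hηP .ion).2
    have e2 := abs_cross_term_le (ρ := ρ .electron t) (A := A .electron t) hme hg0.le hg2
      (hηP .electron).2
    rw [abs_le] at e1 e2 ⊢
    have e3 : 0 ≤ β t ^ 2 / (4 * Real.pi) := by positivity
    simp only [hL, PlasmaParams.energy]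
    constructor <;> linarith [e1.1, e1.2, e2.1, e2.2]
  have hLd : ∀ t, HasDerivAt L
      (-(P.κ .ion * A .ion t ^ 2) + η * θ * (P.m .ion * A .ion t ^ 2)
        - η * θ * (P.T .ion * ρ .ion t ^ 2) + η * g * (P.κ .ion * (ρ .ion t * A .ion t))
      + (-(P.κ .electron * A .electron t ^ 2) + η * θ * (P.m .electron * A .electron t ^ 2)
        - η * θ * (P.T .electron * ρ .electron t ^ 2)
        + η * g * (P.κ .electron * (ρ .electron t * A .electron t)))
      - η * θ * (β t ^ 2 / (4 * Real.pi))) t := by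
    intro t
    have d1 := hM.hasDerivAt_ρ .ion t
    have d2 := hM.hasDerivAt_ρ .electron t
    have d3 := hM.hasDerivAt_A .ion t
    have d4 := hM.hasDerivAt_A .electron t
    have d5 := hM.hasDerivAt_β t
    have hE := ((((d1.pow 2).const_mul (P.T .ion)).add ((d2.pow 2).const_mul (P.T .electron))).add
      (((d3.pow 2).const_mul (P.m .ion)).add ((d4.pow 2).const_mul (P.m .electron)))).add
      ((d5.pow 2).div_const (4 * Real.pi))
    have hfull := ((hE.div_const 2).sub (((d1.mul d3).const_mul (P.m .ion)).const_mul (η * g))).sub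
      (((d2.mul d4).const_mul (P.m .electron)).const_mul (η * g))
    refine HasDerivAt.congr_deriv hfull ?_
    have hG := hM.gauss t
    simp only [PlasmaParams.q, Nat.add_one_sub_one, pow_one, Nat.cast_ofNat]
    have hρ : ρ .ion t = ρ .electron t + s * β t / (4 * Real.pi * P.e) := by
      have := P.e_pos
      rw [hG]
      field_simp
      ring
    rw [← hgs, hρ]
    have := P.e_pos
    field_simp
    ring
  have hL0 : ∀ t, L t ≤ P.energy (ρ · t) (A · t) (β t) := fun t => by
    have h1 := hdist t
    have h2 := P.energy_nonneg (ρ · t) (A · t) (β t)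
    rw [abs_le] at h1
    linarith [h1.2]
  have hdec := le_exp_of_deriv_le (y := L) (a := η / 2 * θ) (b := 0) (d := 0) (by positivity) le_rfl
    (by positivity) hLd (fun t _ => by
      have e1 := energy_dissipation_species (ρ := ρ .ion t) (A := A .ion t) (P.T_pos .ion) hmi hη
        (hηP .ion).1 hθ1 hgθ
      have e2 := energy_dissipation_species (ρ := ρ .electron t) (A := A .electron t)
        (P.T_pos .electron) hme hη (hηP .electron).1 hθ1 hgθ
      have e3 : 0 ≤ η / 2 * θ * (β t ^ 2 / (4 * Real.pi)) := by positivity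
      have e4 : η / 2 * θ * L t ≤ η / 2 * θ * P.energy (ρ · t) (A · t) (β t) := by
        gcongr
        exact hL0 t
      simp only [PlasmaParams.energy] at e4
      linarith) ht
  simp only [mul_zero, zero_div, zero_mul, add_zero] at hdec
  have h1 := (abs_le.1 (hdist t)).1
  have h2 : Real.exp (-(η / 2 * θ * t)) * L 0 ≤
      Real.exp (-(η / 2 * θ * t)) * P.energy (ρ · 0) (A · 0) (β 0) := by
    gcongr
    exact hL0 0
  linarith

theorem mul_le_sq_add_sq {ε : ℝ} (hε : 0 < ε) (x y : ℝ) : x * y ≤ ε * x ^ 2 + y ^ 2 / (4 * ε) := by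
  have h : 0 ≤ ε * (x - y / (2 * ε)) ^ 2 := by positivity
  have h2 : ε * (x - y / (2 * ε)) ^ 2 = ε * x ^ 2 + y ^ 2 / (4 * ε) - x * y := by
    field_simp
    ring
  linarith

theorem sq_sum_five_le {B c₁ c₂ c₃ c₄ c₅ : ℝ} (h₁ : |c₁| ≤ B) (h₂ : |c₂| ≤ B) (h₃ : |c₃| ≤ B)
    (h₄ : |c₄| ≤ B) (h₅ : |c₅| ≤ B) (x₁ x₂ x₃ x₄ x₅ : ℝ) :
    (c₁ * x₁ + c₂ * x₂ + c₃ * x₃ + c₄ * x₄ + c₅ * x₅) ^ 2 ≤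
      5 * B ^ 2 * (x₁ ^ 2 + x₂ ^ 2 + (x₃ ^ 2 + x₄ ^ 2) + x₅ ^ 2) := by
  have key : ∀ {c : ℝ}, |c| ≤ B → ∀ x : ℝ, (c * x) ^ 2 ≤ B ^ 2 * x ^ 2 := by
    intro c hc x
    rw [mul_pow]
    exact mul_le_mul_of_nonneg_right (sq_le_sq' (abs_le.1 hc).1 (abs_le.1 hc).2) (sq_nonneg x)
  have e1 := key h₁ x₁
  have e2 := key h₂ x₂
  have e3 := key h₃ x₃
  have e4 := key h₄ x₄
  have e5 := key h₅ x₅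
  have hc := sq_sum_le_card_mul_sum_sq (s := Finset.univ)
    (f := ![c₁ * x₁, c₂ * x₂, c₃ * x₃, c₄ * x₄, c₅ * x₅])
  simp only [Fin.sum_univ_five, Finset.card_univ, Fintype.card_fin] at hc
  simp only [Matrix.cons_val] at hc
  push_cast at hc
  linarith

/-- The squared Euclidean size of the state of a mode. -/
def stateSq (ρ A : Species → ℝ) (β : ℝ) : ℝ :=
  ρ .ion ^ 2 + ρ .electron ^ 2 + (A .ion ^ 2 + A .electron ^ 2) + β ^ 2

theorem stateSq_nonneg (ρ A : Species → ℝ) (β : ℝ) : 0 ≤ stateSq ρ A β := by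
  unfold stateSq; positivity

theorem energy_equiv_stateSq (P : PlasmaParams) :
    ∃ K : ℝ, 0 < K ∧ ∀ ρ A β, P.energy ρ A β ≤ K * stateSq ρ A β ∧
      stateSq ρ A β ≤ K * P.energy ρ A β := by
  have h1 := P.T_pos .ion
  have h2 := P.T_pos .electron
  have h3 := P.m_pos .ion
  have h4 := P.m_pos .electron
  have h5 : 0 < 1 / (4 * Real.pi) := by have := Real.pi_pos; positivity
  have key : ∀ x : ℝ, 0 < x → ∃ K : ℝ, 0 < K ∧ x ≤ K ∧ 1 ≤ K * x := by
    intro x hx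
    refine ⟨x + 1 / x, by positivity, by have : 0 < 1 / x := by positivity
                                         linarith, ?_⟩
    have : (x + 1 / x) * x = x ^ 2 + 1 := by field_simp
    rw [this]
    nlinarith [sq_nonneg x]
  obtain ⟨K1, p1, a1, b1⟩ := key _ h1
  obtain ⟨K2, p2, a2, b2⟩ := key _ h2
  obtain ⟨K3, p3, a3, b3⟩ := key _ h3
  obtain ⟨K4, p4, a4, b4⟩ := key _ h4
  obtain ⟨K5, p5, a5, b5⟩ := key _ h5
  set K := K1 + K2 + K3 + K4 + K5
  have hK1 : K1 ≤ K := by simp only [K]; linarith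
  have hK2 : K2 ≤ K := by simp only [K]; linarith
  have hK3 : K3 ≤ K := by simp only [K]; linarith
  have hK4 : K4 ≤ K := by simp only [K]; linarith
  have hK5 : K5 ≤ K := by simp only [K]; linarith
  have up : ∀ {x K' : ℝ}, x ≤ K' → K' ≤ K → ∀ y : ℝ, x * y ^ 2 ≤ K * y ^ 2 := by
    intro x K' h h' y
    exact mul_le_mul_of_nonneg_right (h.trans h') (sq_nonneg y)
  have down : ∀ {x K' : ℝ}, 0 < x → 1 ≤ K' * x → K' ≤ K → ∀ y : ℝ, y ^ 2 ≤ K * (x * y ^ 2) := by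
    intro x K' hx h h' y
    have e1 : K' * x ≤ K * x := by gcongr
    have e2 : 1 * y ^ 2 ≤ (K * x) * y ^ 2 :=
      mul_le_mul_of_nonneg_right (h.trans e1) (sq_nonneg y)
    linarith
  refine ⟨K, by positivity, fun ρ A β => ?_⟩
  have e0 : β ^ 2 / (4 * Real.pi) = 1 / (4 * Real.pi) * β ^ 2 := by ring
  unfold stateSq PlasmaParams.energy
  rw [e0]
  constructor
  · linarith [up a1 hK1 (ρ .ion), up a2 hK2 (ρ .electron), up a3 hK3 (A .ion),
      up a4 hK4 (A .electron), up a5 hK5 β]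
  · linarith [down h1 b1 hK1 (ρ .ion), down h2 b2 hK2 (ρ .electron), down h3 b3 hK3 (A .ion),
      down h4 b4 hK4 (A .electron), down h5 b5 hK5 β]

theorem stateSq_decay (P : PlasmaParams) :
    ∃ c K : ℝ, 0 < c ∧ 0 < K ∧ ∀ (s : ℝ) (ρ A : Species → ℝ → ℝ) (β : ℝ → ℝ), 0 < s →
      IsMode P s ρ A β → ∀ t, 0 ≤ t → stateSq (ρ · t) (A · t) (β t) ≤
        K * stateSq (ρ · 0) (A · 0) (β 0) * Real.exp (-(c * (s ^ 2 / (1 + s ^ 2)) * t)) := by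
  obtain ⟨c, hc, h⟩ := energy_decay P
  obtain ⟨K, hK, hE⟩ := energy_equiv_stateSq P
  refine ⟨c, K * (4 * K), hc, by positivity, fun s ρ A β hs hM t ht => ?_⟩
  calc stateSq (ρ · t) (A · t) (β t) ≤ K * P.energy (ρ · t) (A · t) (β t) := (hE _ _ _).2
    _ ≤ K * (4 * P.energy (ρ · 0) (A · 0) (β 0) * _) := by
        gcongr
        exact h s ρ A β hs hM t ht
    _ ≤ K * (4 * (K * stateSq (ρ · 0) (A · 0) (β 0)) * _) := by
        gcongr
        exact (hE _ _ _).1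
    _ = _ := by ring

/-! ### Damping of the velocity–field block. -/

/-- The velocity–field block is a Hurwitz system: a Lyapunov function and its rate. -/
theorem exists_lyapunov (P : PlasmaParams) :
    ∃ η c K : ℝ, 0 < η ∧ 0 < c ∧ 0 < K ∧ ∀ x y z : ℝ,
      (-(P.κ .ion * x ^ 2) - P.κ .electron * y ^ 2 - η * P.e * z ^ 2 +
        η * (P.κ .ion * (x * z) + 4 * Real.pi * P.e * P.m .ion * (x ^ 2 - x * y)) ≤
          -(c * (x ^ 2 + y ^ 2 + z ^ 2))) ∧
      ((P.m .ion * x ^ 2 + P.m .electron * y ^ 2 + z ^ 2 / (4 * Real.pi)) / 2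
        - η * (P.m .ion * (x * z)) ≤ K * (x ^ 2 + y ^ 2 + z ^ 2)) ∧
      (x ^ 2 + y ^ 2 + z ^ 2 ≤ K * ((P.m .ion * x ^ 2 + P.m .electron * y ^ 2
        + z ^ 2 / (4 * Real.pi)) / 2 - η * (P.m .ion * (x * z)))) := by
  have he := P.e_pos
  have hmi := P.m_pos .ion
  have hme := P.m_pos .electron
  have hκi := P.κ_pos .ion
  have hκe := P.κ_pos .electron
  have hpi := Real.pi_pos
  set mi := P.m .ion
  set me := P.m .electron
  set κi := P.κ .ion
  set κe := P.κ .electron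
  set e := P.e
  set k := 4 * Real.pi * e * mi with hk
  have hk0 : 0 < k := by positivity
  -- The correction `-η m_i x z` damps `z`, since the ion velocity is driven by `e z`. The bound
  -- `η₁` keeps its side effects below half of each friction term; `η₂` keeps it below a quarter of
  -- the energy.
  obtain ⟨η₁, hη₁, h1a, h1b⟩ := exists_pos_le_both
    (a := κi / 2 / (κi ^ 2 / (2 * e) + 2 * k)) (b := κe / 2 / k) (by positivity) (by positivity)
  obtain ⟨η₂, hη₂, h2a, h2b⟩ := exists_pos_le_both
    (a := 1 / (16 * Real.pi * mi)) (b := 1) (by positivity) one_pos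
  obtain ⟨η, hη, ha, hb⟩ := exists_pos_le_both hη₁ hη₂
  have c1 : η * (κi ^ 2 / (2 * e) + 2 * k) ≤ κi / 2 := by
    rw [← le_div_iff₀ (by positivity)]; linarith
  have c2 : η * k ≤ κe / 2 := by
    rw [← le_div_iff₀ (by positivity)]; linarith
  have c3 : η * (16 * Real.pi * mi) ≤ 1 := by
    rw [← le_div_iff₀ (by positivity)]; linarith
  have c4 : η ≤ 1 := by linarith
  obtain ⟨c', hc', d1, d2⟩ := exists_pos_le_both (half_pos hκi) (half_pos hκe)
  obtain ⟨c, hc, d3, d4⟩ := exists_pos_le_both hc' (b := η * e / 2) (by positivity)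
  have cross : ∀ x z : ℝ, |η * (mi * (x * z))| ≤ (mi * x ^ 2 + z ^ 2 / (4 * Real.pi)) / 4 := by
    intro x z
    have e1 : ∀ z : ℝ, η * (mi * (x * z)) ≤ (mi * x ^ 2 + z ^ 2 / (4 * Real.pi)) / 4 := by
      intro z
      have g1 := mul_le_sq_add_sq (ε := 1 / 4) (by norm_num) x (η * z)
      have g2 : mi * (x * (η * z)) ≤ mi * (1 / 4 * x ^ 2 + (η * z) ^ 2 / (4 * (1 / 4))) := by
        gcongr
      have g3 : mi * (η * z) ^ 2 ≤ z ^ 2 / (16 * Real.pi) := by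
        rw [le_div_iff₀ (by positivity)]
        have g4 : (η * (16 * Real.pi * mi)) * (η * z ^ 2) ≤ 1 * (1 * z ^ 2) := by gcongr
        linarith
      have g5 : z ^ 2 / (16 * Real.pi) = z ^ 2 / (4 * Real.pi) / 4 := by
        field_simp
        norm_num
      linarith
    rw [abs_le]
    have e2 := e1 z
    have e3 := e1 (-z)
    rw [neg_sq] at e3
    constructor <;> linarith
  set K := mi + me + 1 / (4 * Real.pi) + (4 / mi + 4 / me + 16 * Real.pi) with hK
  have hKpos : 0 < K := by positivity
  refine ⟨η, c, K, hη, hc, hKpos, fun x y z => ⟨?_, ?_, ?_⟩⟩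
  · have g1 := mul_le_sq_add_sq (ε := e / 2) (by positivity) z (κi * x)
    have g1' : z * (κi * x) ≤ e / 2 * z ^ 2 + κi ^ 2 / (2 * e) * x ^ 2 := by
      refine g1.trans (le_of_eq ?_)
      field_simp
      ring
    have g2 : -(x * y) ≤ x ^ 2 + y ^ 2 := by nlinarith [sq_nonneg (x + y), sq_nonneg x, sq_nonneg y]
    have g3 : η * (z * (κi * x)) ≤ η * (e / 2 * z ^ 2 + κi ^ 2 / (2 * e) * x ^ 2) := by gcongr
    have g4 : η * k * -(x * y) ≤ η * k * (x ^ 2 + y ^ 2) := by gcongr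
    have g5 : η * (κi ^ 2 / (2 * e) + 2 * k) * x ^ 2 ≤ κi / 2 * x ^ 2 := by gcongr
    have g6 : η * k * y ^ 2 ≤ κe / 2 * y ^ 2 := by gcongr
    have g7 : c * x ^ 2 ≤ κi / 2 * x ^ 2 := by gcongr; linarith
    have g8 : c * y ^ 2 ≤ κe / 2 * y ^ 2 := by gcongr; linarith
    have g9 : c * z ^ 2 ≤ η * e / 2 * z ^ 2 := by gcongr
    linarith
  · have g1 := (abs_le.1 (cross x z)).1
    have g2 : 0 < 4 / mi := by positivity
    have g3 : 0 < 4 / me := by positivity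
    have g4 : 0 < 1 / (4 * Real.pi) := by positivity
    have f1 : mi * x ^ 2 ≤ K * x ^ 2 := by gcongr; linarith
    have f2 : me * y ^ 2 ≤ K * y ^ 2 := by gcongr; linarith
    have f3 : 1 / (4 * Real.pi) * z ^ 2 ≤ K * z ^ 2 := by gcongr; linarith
    have f4 : z ^ 2 / (4 * Real.pi) = 1 / (4 * Real.pi) * z ^ 2 := by ring
    have f5 : 0 ≤ mi * x ^ 2 := by positivity
    have f6 : 0 ≤ me * y ^ 2 := by positivity
    have f7 : 0 ≤ 1 / (4 * Real.pi) * z ^ 2 := by positivity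
    rw [f4] at g1 ⊢
    linarith
  · have g1 := (abs_le.1 (cross x z)).2
    have g2 : 0 < 4 / mi := by positivity
    have g3 : 0 < 4 / me := by positivity
    have g4 : 0 < 1 / (4 * Real.pi) := by positivity
    have low : (mi * x ^ 2 + me * y ^ 2 + 1 / (4 * Real.pi) * z ^ 2) / 4 ≤
        (mi * x ^ 2 + me * y ^ 2 + z ^ 2 / (4 * Real.pi)) / 2 - η * (mi * (x * z)) := by
      have f4 : z ^ 2 / (4 * Real.pi) = 1 / (4 * Real.pi) * z ^ 2 := by ring
      rw [f4] at g1 ⊢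
      have : 0 ≤ me * y ^ 2 := by positivity
      linarith
    have f1 : x ^ 2 ≤ K * (mi * x ^ 2 / 4) := by
      calc x ^ 2 = 4 / mi * (mi * x ^ 2 / 4) := by field_simp
        _ ≤ _ := by gcongr; linarith
    have f2 : y ^ 2 ≤ K * (me * y ^ 2 / 4) := by
      calc y ^ 2 = 4 / me * (me * y ^ 2 / 4) := by field_simp
        _ ≤ _ := by gcongr; linarith
    have f3 : z ^ 2 ≤ K * (1 / (4 * Real.pi) * z ^ 2 / 4) := by
      calc z ^ 2 = 16 * Real.pi * (1 / (4 * Real.pi) * z ^ 2 / 4) := by field_simp; norm_num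
        _ ≤ _ := by gcongr; linarith
    calc x ^ 2 + y ^ 2 + z ^ 2
        ≤ K * ((mi * x ^ 2 + me * y ^ 2 + 1 / (4 * Real.pi) * z ^ 2) / 4) := by linarith
      _ ≤ _ := by gcongr

/-- Decay for the velocity–field block with exponentially decaying forcing. -/
theorem forced_block_decay (P : PlasmaParams) :
    ∃ a C : ℝ, 0 < a ∧ 0 < C ∧ ∀ (x y z f g h : ℝ → ℝ) (d D : ℝ), d ≤ a / 2 → 0 ≤ D →
      (∀ t, HasDerivAt x ((P.e * z t - P.κ .ion * x t + f t) / P.m .ion) t) →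
      (∀ t, HasDerivAt y ((-P.e * z t - P.κ .electron * y t + g t) / P.m .electron) t) →
      (∀ t, HasDerivAt z (-(4 * Real.pi * P.e * (x t - y t)) + h t) t) →
      (∀ t, 0 ≤ t → f t ^ 2 + g t ^ 2 + h t ^ 2 ≤ D * Real.exp (-(d * t))) →
      ∀ t, 0 ≤ t → x t ^ 2 + y t ^ 2 + z t ^ 2 ≤
        C * (Real.exp (-(a * t)) * (x 0 ^ 2 + y 0 ^ 2 + z 0 ^ 2) + D * Real.exp (-(d * t))) := by
  obtain ⟨η, c, K, hη, hc, hK, hlyap⟩ := exists_lyapunov P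
  have he := P.e_pos
  have hmi := P.m_pos .ion
  have hme := P.m_pos .electron
  have hpi := Real.pi_pos
  -- `M` bounds every coefficient with which the forcing enters the derivative of `L`.
  set M := 1 + 1 / (4 * Real.pi) + η + η * P.m .ion with hM
  have hM0 : 0 < M := by positivity
  -- Among the five forcing products each unknown occurs at most twice. Each product costs `M ε = c
  -- / 4`, so half of the dissipation remains.
  set ε := c / (4 * M) with hε
  have hε0 : 0 < ε := by positivity
  set B := M / (2 * ε) with hB
  have hB0 : 0 < B := by positivity
  set a := c / (2 * K) with ha
  have ha0 : 0 < a := by positivity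
  refine ⟨a, K * (K + 2 * B / a), ha0, by positivity, ?_⟩
  intro x y z f g h d D hd hD hx hy hz hF t ht
  set L : ℝ → ℝ := fun t => (P.m .ion * x t ^ 2 + P.m .electron * y t ^ 2
    + z t ^ 2 / (4 * Real.pi)) / 2 - η * (P.m .ion * (x t * z t)) with hL
  have hLd : ∀ t, HasDerivAt L (-(P.κ .ion * x t ^ 2) - P.κ .electron * y t ^ 2
      - η * P.e * z t ^ 2 + η * (P.κ .ion * (x t * z t) +
        4 * Real.pi * P.e * P.m .ion * (x t ^ 2 - x t * y t)) +
      (x t * f t + y t * g t + 1 / (4 * Real.pi) * (z t * h t) - η * (z t * f t)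
        - η * P.m .ion * (x t * h t))) t := by
    intro t
    have hfull := ((((((hx t).pow 2).const_mul (P.m .ion)).add
      (((hy t).pow 2).const_mul (P.m .electron))).add
      (((hz t).pow 2).div_const (4 * Real.pi))).div_const 2).sub
      ((((hx t).mul (hz t)).const_mul (P.m .ion)).const_mul η)
    refine HasDerivAt.congr_deriv hfull ?_
    simp only [Nat.add_one_sub_one, pow_one, Nat.cast_ofNat]
    field_simp
    ring
  have forcing : ∀ u v k : ℝ, |k| ≤ M → k * (u * v) ≤ M * (ε * u ^ 2 + v ^ 2 / (4 * ε)) := by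
    intro u v k hk
    have e1 := mul_le_sq_add_sq hε0 |u| |v|
    rw [sq_abs, sq_abs] at e1
    calc k * (u * v) ≤ |k * (u * v)| := le_abs_self _
      _ = |k| * (|u| * |v|) := by rw [abs_mul, abs_mul]
      _ ≤ _ := by gcongr
  have p1 : 0 < 1 / (4 * Real.pi) := by positivity
  have p2 : 0 < η * P.m .ion := by positivity
  have hdec := le_exp_of_deriv_le (y := L) (a := a) (b := B * D) (d := d) ha0 (by positivity) hd
    hLd (fun t ht => by
      have h1 := (hlyap (x t) (y t) (z t)).1
      have h2 := (hlyap (x t) (y t) (z t)).2.1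
      have f1 := forcing (x t) (f t) 1 (by rw [abs_one]; linarith)
      have f2 := forcing (y t) (g t) 1 (by rw [abs_one]; linarith)
      have f3 := forcing (z t) (h t) (1 / (4 * Real.pi)) (by rw [abs_of_pos p1]; linarith)
      have f4 := forcing (z t) (f t) (-η) (by rw [abs_neg, abs_of_pos hη]; linarith)
      have f5 := forcing (x t) (h t) (-(η * P.m .ion)) (by rw [abs_neg, abs_of_pos p2]; linarith)
      have g1 : M * ε = c / 4 := by rw [hε]; field_simp
      have g2 : M * (1 / (4 * ε)) = B / 2 := by rw [hB]; field_simp; norm_num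
      have hsum : (x t * f t + y t * g t + 1 / (4 * Real.pi) * (z t * h t) - η * (z t * f t)
          - η * P.m .ion * (x t * h t)) ≤ c / 2 * (x t ^ 2 + y t ^ 2 + z t ^ 2) +
          B * (f t ^ 2 + g t ^ 2 + h t ^ 2) := by
        have key : ∀ u v : ℝ, M * (ε * u ^ 2 + v ^ 2 / (4 * ε)) = c / 4 * u ^ 2 + B / 2 * v ^ 2 := by
          intro u v
          rw [← g1, ← g2]
          ring
        rw [key] at f1 f2 f3 f4 f5
        have q1 := mul_nonneg (by positivity : 0 ≤ c / 4) (sq_nonneg (y t))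
        have q2 := mul_nonneg (by positivity : 0 ≤ B / 2) (sq_nonneg (g t))
        linarith
      have hFt := hF t ht
      have hBF : B * (f t ^ 2 + g t ^ 2 + h t ^ 2) ≤ B * (D * Real.exp (-(d * t))) := by gcongr
      have haL : a * L t ≤ c / 2 * (x t ^ 2 + y t ^ 2 + z t ^ 2) := by
        calc a * L t ≤ a * (K * (x t ^ 2 + y t ^ 2 + z t ^ 2)) := by
              gcongr
          _ = _ := by rw [ha]; field_simp
      linarith) ht
  have hlow := (hlyap (x t) (y t) (z t)).2.2
  have hup := (hlyap (x 0) (y 0) (z 0)).2.1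
  have hpos : 0 ≤ x 0 ^ 2 + y 0 ^ 2 + z 0 ^ 2 := by positivity
  calc x t ^ 2 + y t ^ 2 + z t ^ 2 ≤ K * L t := hlow
    _ ≤ K * (Real.exp (-(a * t)) * L 0 + 2 * (B * D) / a * Real.exp (-(d * t))) := by gcongr
    _ ≤ K * (Real.exp (-(a * t)) * (K * (x 0 ^ 2 + y 0 ^ 2 + z 0 ^ 2)) +
          2 * (B * D) / a * Real.exp (-(d * t))) := by gcongr
    _ ≤ K * ((K + 2 * B / a) * (Real.exp (-(a * t)) * (x 0 ^ 2 + y 0 ^ 2 + z 0 ^ 2)) +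
          (K + 2 * B / a) * (D * Real.exp (-(d * t)))) := by
        have q1 : 0 ≤ 2 * B / a * (Real.exp (-(a * t)) * (x 0 ^ 2 + y 0 ^ 2 + z 0 ^ 2)) := by
          positivity
        have q2 : 0 ≤ K * (D * Real.exp (-(d * t))) := by positivity
        have q3 : 2 * (B * D) / a * Real.exp (-(d * t)) =
            2 * B / a * (D * Real.exp (-(d * t))) := by ring
        refine mul_le_mul_of_nonneg_left ?_ hK.le
        rw [q3]
        linarith
    _ = _ := by ring

/-! ### The slow variable and the comparison with diffusion. -/

namespace PlasmaParams

variable (P : PlasmaParams)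

/-- The total friction coefficient. -/
noncomputable def κtot : ℝ := P.κ .ion + P.κ .electron

theorem κtot_pos : 0 < P.κtot := add_pos (P.κ_pos _) (P.κ_pos _)

/-- The friction-weighted mean density. -/
noncomputable def meanDensity (ρ : Species → ℝ) : ℝ :=
  (P.κ .ion * ρ .ion + P.κ .electron * ρ .electron) / P.κtot

/-- The momentum divided by the total friction. -/
noncomputable def drift (A : Species → ℝ) : ℝ :=
  (P.m .ion * A .ion + P.m .electron * A .electron) / P.κtot

/-- The pressure divided by the total friction. -/
noncomputable def pressure (ρ : Species → ℝ) : ℝ :=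
  (P.T .ion * ρ .ion + P.T .electron * ρ .electron) / P.κtot

/-- The slow variable of a mode. -/
noncomputable def slow (s : ℝ) (ρ A : Species → ℝ) : ℝ := P.meanDensity ρ - s * P.drift A

/-- Together with its electron counterpart, this is the force balance `q_α β + T_α s Z - κ_α A = 0`
at `A = μ₁ s Z`, `β = -χ s Z`. It characterises the two profile coefficients. -/
theorem e_mul_χ_add : P.e * P.χ + P.κ .ion * P.μ₁ = P.T .ion := by
  have h := P.κtot_pos
  have he := P.e_pos
  unfold κtot at h
  unfold χ μ₁
  field_simp
  ring

theorem neg_e_mul_χ_add : -P.e * P.χ + P.κ .electron * P.μ₁ = P.T .electron := by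
  have h := P.κtot_pos
  have he := P.e_pos
  unfold κtot at h
  unfold χ μ₁
  field_simp
  ring

end PlasmaParams

namespace IsMode

variable {P : PlasmaParams} {s : ℝ} {ρ A : Species → ℝ → ℝ} {β : ℝ → ℝ}

theorem ion_sub_electron (h : IsMode P s ρ A β) (t : ℝ) :
    ρ .ion t - ρ .electron t = s * (β t / (4 * Real.pi * P.e)) := by
  have he := P.e_pos
  have hpi := Real.pi_pos
  have := h.gauss t
  rw [mul_div_assoc', this]
  field_simp

/-- Gauss's law makes the charge separation of order `s`, so each density agrees with the mean
density, and hence with the slow variable, up to a factor `s`. -/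
theorem ion_eq (h : IsMode P s ρ A β) (t : ℝ) :
    ρ .ion t = P.slow s (ρ · t) (A · t) + s * (P.κ .electron / P.κtot * (β t / (4 * Real.pi * P.e))
      + P.drift (A · t)) := by
  have hk := P.κtot_pos
  have h1 := h.ion_sub_electron t
  have h2 : ρ .ion t - P.meanDensity (ρ · t) =
      P.κ .electron / P.κtot * (ρ .ion t - ρ .electron t) := by
    unfold PlasmaParams.meanDensity
    field_simp
    unfold PlasmaParams.κtot
    ring
  rw [h1] at h2
  unfold PlasmaParams.slow
  linear_combination h2

theorem electron_eq (h : IsMode P s ρ A β) (t : ℝ) :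
    ρ .electron t = P.slow s (ρ · t) (A · t) +
      s * (-(P.κ .ion / P.κtot) * (β t / (4 * Real.pi * P.e)) + P.drift (A · t)) := by
  have hk := P.κtot_pos
  have h1 := h.ion_sub_electron t
  have h2 : ρ .electron t - P.meanDensity (ρ · t) =
      -(P.κ .ion / P.κtot) * (ρ .ion t - ρ .electron t) := by
    unfold PlasmaParams.meanDensity
    field_simp
    unfold PlasmaParams.κtot
    ring
  rw [h1] at h2
  unfold PlasmaParams.slow
  linear_combination h2

/-- Closes the equation of the slow variable: to leading order the pressure is `μ₁` times it. -/
theorem pressure_eq (h : IsMode P s ρ A β) (t : ℝ) :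
    P.pressure (ρ · t) = P.μ₁ * P.slow s (ρ · t) (A · t) +
      s * (P.μ₁ * P.drift (A · t) + P.χ / (4 * Real.pi * P.κtot) * β t) := by
  have hk := P.κtot_pos
  have he := P.e_pos
  have hpi := Real.pi_pos
  have h1 := h.ion_eq t
  have h2 := h.electron_eq t
  have h3 : P.pressure (ρ · t) * P.κtot = P.T .ion * ρ .ion t + P.T .electron * ρ .electron t := by
    unfold PlasmaParams.pressure
    field_simp
  have h4 : P.μ₁ * P.κtot = P.T .ion + P.T .electron := by
    unfold PlasmaParams.μ₁
    unfold PlasmaParams.κtot at hk ⊢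
    field_simp
  have h5 : P.χ * (P.e * P.κtot) = P.T .ion * P.κ .electron - P.T .electron * P.κ .ion := by
    unfold PlasmaParams.χ
    unfold PlasmaParams.κtot at hk ⊢
    field_simp
  rw [h1, h2] at h3
  have h6 : P.pressure (ρ · t) = (P.T .ion + P.T .electron) / P.κtot *
      (P.slow s (ρ · t) (A · t) + s * P.drift (A · t)) +
      s * ((P.T .ion * P.κ .electron - P.T .electron * P.κ .ion) / P.κtot ^ 2 *
        (β t / (4 * Real.pi * P.e))) := by
    rw [eq_div_of_mul_eq hk.ne' h3]
    field_simp
    ring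
  rw [h6, ← h4, ← h5]
  field_simp
  ring

/-- This is what the correction by the drift is for: it cancels the friction terms coming from the
mean density, and the electric forces cancel because the charges are opposite. Only the pressure is
left, with a factor `s²`. -/
theorem hasDerivAt_slow (h : IsMode P s ρ A β) (t : ℝ) :
    HasDerivAt (fun t => P.slow s (ρ · t) (A · t)) (-(s ^ 2 * P.pressure (ρ · t))) t := by
  have hk := P.κtot_pos
  have hmi := P.m_pos .ion
  have hme := P.m_pos .electron
  have d1 := h.hasDerivAt_ρ .ion t
  have d2 := h.hasDerivAt_ρ .electron t
  have d3 := h.hasDerivAt_A .ion t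
  have d4 := h.hasDerivAt_A .electron t
  have hfull := (((d1.const_mul (P.κ .ion)).add (d2.const_mul (P.κ .electron))).div_const
    P.κtot).sub ((((d3.const_mul (P.m .ion)).add (d4.const_mul (P.m .electron))).div_const
    P.κtot).const_mul s)
  refine HasDerivAt.congr_deriv hfull ?_
  simp only [PlasmaParams.q]
  unfold PlasmaParams.pressure
  field_simp
  ring

end IsMode

theorem sq_add_three_le (x y z : ℝ) : (x + y + z) ^ 2 ≤ 3 * (x ^ 2 + y ^ 2 + z ^ 2) := by
  nlinarith [sq_nonneg (x - y), sq_nonneg (x - z), sq_nonneg (y - z)]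

theorem sq_add_two_le (x y : ℝ) : (x + y) ^ 2 ≤ 2 * (x ^ 2 + y ^ 2) := by
  nlinarith [sq_nonneg (x - y)]

/-- The linear forms in the state of a mode that occur as coefficients of powers of `s` are bounded
uniformly for `0 ≤ s ≤ 1`. -/
theorem sq_forms_le (P : PlasmaParams) :
    ∃ B : ℝ, 0 < B ∧ ∀ (s : ℝ) (ρ A : Species → ℝ) (β : ℝ), 0 ≤ s → s ≤ 1 →
      (P.κ .electron / P.κtot * (β / (4 * Real.pi * P.e)) + P.drift A) ^ 2 ≤
        B * stateSq ρ A β ∧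
      (-(P.κ .ion / P.κtot) * (β / (4 * Real.pi * P.e)) + P.drift A) ^ 2 ≤
        B * stateSq ρ A β ∧
      (P.μ₁ * P.drift A + P.χ / (4 * Real.pi * P.κtot) * β) ^ 2 ≤ B * stateSq ρ A β ∧
      P.drift A ^ 2 ≤ B * stateSq ρ A β ∧
      P.pressure ρ ^ 2 ≤ B * stateSq ρ A β ∧
      P.slow s ρ A ^ 2 ≤ B * stateSq ρ A β := by
  set b : ℝ := |P.κ .electron / P.κtot / (4 * Real.pi * P.e)| +
    |P.κ .ion / P.κtot / (4 * Real.pi * P.e)| + |P.χ / (4 * Real.pi * P.κtot)| +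
    |P.m .ion / P.κtot| + |P.m .electron / P.κtot| + |P.T .ion / P.κtot| +
    |P.T .electron / P.κtot| + |P.κ .ion / P.κtot| + |P.κ .electron / P.κtot| +
    |P.μ₁ * (P.m .ion / P.κtot)| + |P.μ₁ * (P.m .electron / P.κtot)| + 1 with hb
  have a1 := abs_nonneg (P.κ .electron / P.κtot / (4 * Real.pi * P.e))
  have a2 := abs_nonneg (P.κ .ion / P.κtot / (4 * Real.pi * P.e))
  have a3 := abs_nonneg (P.χ / (4 * Real.pi * P.κtot))
  have a4 := abs_nonneg (P.m .ion / P.κtot)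
  have a5 := abs_nonneg (P.m .electron / P.κtot)
  have a6 := abs_nonneg (P.T .ion / P.κtot)
  have a7 := abs_nonneg (P.T .electron / P.κtot)
  have a8 := abs_nonneg (P.κ .ion / P.κtot)
  have a9 := abs_nonneg (P.κ .electron / P.κtot)
  have a10 := abs_nonneg (P.μ₁ * (P.m .ion / P.κtot))
  have a11 := abs_nonneg (P.μ₁ * (P.m .electron / P.κtot))
  have b0 : |(0 : ℝ)| ≤ b := by rw [abs_zero]; linarith
  have hbpos : 0 < b := by linarith
  have b1 : |P.κ .electron / P.κtot / (4 * Real.pi * P.e)| ≤ b := by linarith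
  have b2 : |-(P.κ .ion / P.κtot / (4 * Real.pi * P.e))| ≤ b := by rw [abs_neg]; linarith
  have b3 : |P.χ / (4 * Real.pi * P.κtot)| ≤ b := by linarith
  have b4 : |P.m .ion / P.κtot| ≤ b := by linarith
  have b5 : |P.m .electron / P.κtot| ≤ b := by linarith
  have b6 : |P.T .ion / P.κtot| ≤ b := by linarith
  have b7 : |P.T .electron / P.κtot| ≤ b := by linarith
  have b8 : |P.κ .ion / P.κtot| ≤ b := by linarith
  have b9 : |P.κ .electron / P.κtot| ≤ b := by linarith
  have b10 : |P.μ₁ * (P.m .ion / P.κtot)| ≤ b := by linarith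
  have b11 : |P.μ₁ * (P.m .electron / P.κtot)| ≤ b := by linarith
  clear_value b
  refine ⟨5 * b ^ 2, by positivity, fun s ρ A β hs0 hs1 => ?_⟩
  have scale : ∀ {x : ℝ}, |x| ≤ b → |-(s * x)| ≤ b := by
    intro x hx
    rw [abs_neg, abs_mul, abs_of_nonneg hs0]
    exact (mul_le_of_le_one_left (abs_nonneg x) hs1).trans hx
  have form : ∀ {y c₁ c₂ c₃ c₄ c₅ : ℝ}, |c₁| ≤ b → |c₂| ≤ b → |c₃| ≤ b → |c₄| ≤ b → |c₅| ≤ b →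
      y = c₁ * ρ .ion + c₂ * ρ .electron + c₃ * A .ion + c₄ * A .electron + c₅ * β →
      y ^ 2 ≤ 5 * b ^ 2 * stateSq ρ A β := by
    intro y c₁ c₂ c₃ c₄ c₅ h₁ h₂ h₃ h₄ h₅ hy
    rw [hy]
    exact sq_sum_five_le h₁ h₂ h₃ h₄ h₅ _ _ _ _ _
  refine ⟨form b0 b0 b4 b5 b1 ?_, form b0 b0 b4 b5 b2 ?_, form b0 b0 b10 b11 b3 ?_,
    form b0 b0 b4 b5 b0 ?_, form b6 b7 b0 b0 b0 ?_, form b8 b9 (scale b4) (scale b5) b0 ?_⟩ <;>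
  · simp only [PlasmaParams.drift, PlasmaParams.pressure, PlasmaParams.slow,
      PlasmaParams.meanDensity]
    ring

/-- At low frequency the slow variable follows the heat equation. -/
theorem slow_sub_heat_sq_le (P : PlasmaParams) {K : ℝ} (hK : 0 < K) :
    ∃ C : ℝ, 0 < C ∧ ∀ (s d D : ℝ) (ρ A : Species → ℝ → ℝ) (β : ℝ → ℝ), 0 < s → s ≤ 1 →
      IsMode P s ρ A β → 0 ≤ D → d ≤ P.μ₁ * s ^ 2 / 2 →
      (∀ t, 0 ≤ t → stateSq (ρ · t) (A · t) (β t) ≤ K * D * Real.exp (-(d * t))) →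
      ∀ t, 0 ≤ t → (P.slow s (ρ · t) (A · t) -
        Real.exp (-(P.μ₁ * s ^ 2 * t)) * P.slow s (ρ · 0) (A · 0)) ^ 2 ≤
          C * (s ^ 2 * (D * Real.exp (-(d * t)))) := by
  obtain ⟨B, hB, hforms⟩ := sq_forms_le P
  have hμ := P.μ₁_pos
  refine ⟨2 * (B * K / P.μ₁) / P.μ₁, by positivity, ?_⟩
  intro s d D ρ A β hs hs1 hM hD hd hS t ht
  set Z := fun t => P.slow s (ρ · t) (A · t) with hZ
  -- The deviation from the heat flow starts at zero and satisfies `ζ' = -μ₁ s² ζ - s³ h`.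
  set ζ := fun t => Z t - Real.exp (-(P.μ₁ * s ^ 2 * t)) * Z 0 with hζ
  set h := fun t => P.μ₁ * P.drift (A · t) + P.χ / (4 * Real.pi * P.κtot) * β t with hh
  have hζd : ∀ t, HasDerivAt ζ (-(P.μ₁ * s ^ 2 * ζ t) - s ^ 3 * h t) t := by
    intro t
    have d1 := hM.hasDerivAt_slow t
    have d2 : HasDerivAt (fun t => Real.exp (-(P.μ₁ * s ^ 2 * t)))
        (Real.exp (-(P.μ₁ * s ^ 2 * t)) * -(P.μ₁ * s ^ 2)) t := by
      have := (((hasDerivAt_id t).const_mul (P.μ₁ * s ^ 2)).neg).exp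
      simpa using this
    have d3 := d1.sub (d2.mul_const (Z 0))
    refine HasDerivAt.congr_deriv d3 ?_
    rw [hM.pressure_eq t]
    simp only [hζ, hZ, hh]
    ring
  have hyd : ∀ t, HasDerivAt (fun t => ζ t ^ 2)
      (2 * ζ t * (-(P.μ₁ * s ^ 2 * ζ t) - s ^ 3 * h t)) t := by
    intro t
    exact ((hζd t).pow 2).congr_deriv (by simp)
  have hdec := le_exp_of_deriv_le (y := fun t => ζ t ^ 2) (a := P.μ₁ * s ^ 2)
    (b := s ^ 4 * (B * K / P.μ₁) * D) (d := d) (by positivity) (by positivity) hd hyd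
    (fun t ht => by
      have h1 : h t ^ 2 ≤ B * stateSq (ρ · t) (A · t) (β t) :=
        (hforms s (ρ · t) (A · t) (β t) hs.le hs1).2.2.1
      have h2 : h t ^ 2 ≤ B * (K * D * Real.exp (-(d * t))) :=
        h1.trans (by gcongr; exact hS t ht)
      -- The forcing is split as `(s ζ)(s² h)`, so that half of the damping of `ζ²` absorbs the
      -- first factor. What is left is of order `s⁴` against a rate of order `s²`, hence the final
      -- `s²`.
      have h3 := mul_le_sq_add_sq (ε := P.μ₁ / 2) (by positivity) (s * ζ t) (-(s ^ 2 * h t))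
      have h4 : (-(s ^ 2 * h t)) ^ 2 / (4 * (P.μ₁ / 2)) ≤
          s ^ 4 * (B * (K * D * Real.exp (-(d * t)))) / (2 * P.μ₁) := by
        rw [show 4 * (P.μ₁ / 2) = 2 * P.μ₁ by ring, show (-(s ^ 2 * h t)) ^ 2 = s ^ 4 * h t ^ 2 by ring]
        gcongr
      have h5 : s ^ 4 * (B * (K * D * Real.exp (-(d * t)))) / (2 * P.μ₁) =
          s ^ 4 * (B * K / P.μ₁) * D * Real.exp (-(d * t)) / 2 := by
        field_simp
      rw [h5] at h4
      linarith) ht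
  have h0 : ζ 0 = 0 := by simp [hζ]
  simp only [h0] at hdec
  refine hdec.trans (le_of_eq ?_)
  field_simp
  ring

/-- Comparison of a mode with the diffusive profile at low frequency, in squared form. -/
theorem lowFreq_sq_le (P : PlasmaParams) :
    ∃ a c C : ℝ, 0 < a ∧ 0 < c ∧ 0 < C ∧ ∀ (s : ℝ) (ρ A : Species → ℝ → ℝ) (β : ℝ → ℝ), 0 < s →
      s ≤ 1 → IsMode P s ρ A β → ∀ t, 0 ≤ t →
      (∀ α, (ρ α t - Real.exp (-(P.μ₁ * s ^ 2 * t)) * P.meanDensity (ρ · 0)) ^ 2 ≤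
        C * (s ^ 2 * (stateSq (ρ · 0) (A · 0) (β 0) * Real.exp (-(c * s ^ 2 * t))))) ∧
      (∀ α, (A α t - P.μ₁ * s * (Real.exp (-(P.μ₁ * s ^ 2 * t)) * P.meanDensity (ρ · 0))) ^ 2 ≤
        C * (stateSq (ρ · 0) (A · 0) (β 0) *
          (Real.exp (-(a * t)) + s ^ 4 * Real.exp (-(c * s ^ 2 * t))))) ∧
      (β t + P.χ * s * (Real.exp (-(P.μ₁ * s ^ 2 * t)) * P.meanDensity (ρ · 0))) ^ 2 ≤
        C * (stateSq (ρ · 0) (A · 0) (β 0) *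
          (Real.exp (-(a * t)) + s ^ 4 * Real.exp (-(c * s ^ 2 * t)))) := by
  obtain ⟨c₀, K, hc₀, hK, hcrude⟩ := stateSq_decay P
  obtain ⟨B, hB, hforms⟩ := sq_forms_le P
  obtain ⟨a, C₁, ha, hC₁, hblock⟩ := forced_block_decay P
  obtain ⟨C₂, hC₂, hslow⟩ := slow_sub_heat_sq_le P hK
  have hμ := P.μ₁_pos
  -- For `s ≤ 1`, the rate `c s²` must stay below the general decay rate, which is at least `c₀ s² /
  -- 2`, and below half the rates of the block and of the heat flow, where it plays the role of `d`.
  obtain ⟨c₁, hc₁, hc1a, hc1b⟩ := exists_pos_le_both (half_pos hc₀) (half_pos ha)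
  obtain ⟨c, hc, hca, hcb⟩ := exists_pos_le_both hc₁ (half_pos hμ)
  set B₁ := 2 * (P.T .ion ^ 2 + P.T .electron ^ 2 + (P.m .ion * P.μ₁) ^ 2 +
    (P.m .electron * P.μ₁) ^ 2 + P.χ ^ 2) * B * K with hB₁
  have hTi := P.T_pos .ion
  have hB₁0 : 0 < B₁ := by positivity
  set W₀ := 6 + 2 * (2 * P.μ₁ ^ 2 + P.χ ^ 2) * B with hW₀
  have hW₀0 : 0 < W₀ := by positivity
  set C₃ := 2 * (C₂ + B) with hC₃
  have hC₃0 : 0 < C₃ := by positivity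
  set C₄ := C₁ * (W₀ + B₁) with hC₄
  have hC₄0 : 0 < C₄ := by positivity
  refine ⟨a, c, 3 * (B * K + C₂ + B) + 2 * (C₄ + (P.μ₁ ^ 2 + P.χ ^ 2) * C₃), ha, hc,
    by positivity, ?_⟩
  intro s ρ A β hs hs1 hM
  set S₀ := stateSq (ρ · 0) (A · 0) (β 0) with hS₀
  have hS₀0 : 0 ≤ S₀ := stateSq_nonneg _ _ _
  set d := c * s ^ 2 with hd
  have hs2 : s ^ 2 ≤ 1 := pow_le_one₀ hs.le hs1
  have hS : ∀ t, 0 ≤ t → stateSq (ρ · t) (A · t) (β t) ≤ K * S₀ * Real.exp (-(d * t)) := by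
    intro t ht
    refine (hcrude s ρ A β hs hM t ht).trans ?_
    gcongr
    rw [hd]
    have : s ^ 2 / 2 ≤ s ^ 2 / (1 + s ^ 2) := by gcongr; linarith
    calc c * s ^ 2 ≤ c₀ / 2 * s ^ 2 := by gcongr; linarith
      _ = c₀ * (s ^ 2 / 2) := by ring
      _ ≤ _ := by gcongr
  have hda : d ≤ a / 2 := by
    calc d ≤ (a / 2) * 1 := by rw [hd]; gcongr; linarith
      _ = a / 2 := mul_one _
  have hdμ : d ≤ P.μ₁ * s ^ 2 / 2 := by
    calc d ≤ P.μ₁ / 2 * s ^ 2 := by rw [hd]; gcongr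
      _ = _ := by ring
  -- The unknowns are the deviations from the force balance `A = μ₁ s Z`, `β = -χ s Z`. The terms of
  -- order `s` cancel by the balance identities, so the forcing is `s²` times a linear form in the
  -- state, and its square carries `s⁴`.
  have hW := hblock
    (fun t => A .ion t - P.μ₁ * s * P.slow s (ρ · t) (A · t))
    (fun t => A .electron t - P.μ₁ * s * P.slow s (ρ · t) (A · t))
    (fun t => β t + P.χ * s * P.slow s (ρ · t) (A · t))
    (fun t => s ^ 2 * (P.T .ion * (P.κ .electron / P.κtot * (β t / (4 * Real.pi * P.e))
      + P.drift (A · t)) + P.m .ion * P.μ₁ * s * P.pressure (ρ · t)))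
    (fun t => s ^ 2 * (P.T .electron * (-(P.κ .ion / P.κtot) * (β t / (4 * Real.pi * P.e))
      + P.drift (A · t)) + P.m .electron * P.μ₁ * s * P.pressure (ρ · t)))
    (fun t => s ^ 2 * (-(P.χ * s * P.pressure (ρ · t))))
    d (s ^ 4 * (B₁ * S₀)) hda (by positivity)
    (by
      intro t
      have hm := P.m_pos .ion
      refine ((hM.hasDerivAt_A .ion t).sub
        ((hM.hasDerivAt_slow t).const_mul (P.μ₁ * s))).congr_deriv ?_
      have e1 := hM.ion_eq t
      have e2 := P.e_mul_χ_add
      simp only [PlasmaParams.q]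
      rw [eq_div_iff hm.ne', sub_mul, div_mul_cancel₀ _ hm.ne']
      linear_combination P.T .ion * s * e1 - s * P.slow s (ρ · t) (A · t) * e2)
    (by
      intro t
      have hm := P.m_pos .electron
      refine ((hM.hasDerivAt_A .electron t).sub
        ((hM.hasDerivAt_slow t).const_mul (P.μ₁ * s))).congr_deriv ?_
      have e1 := hM.electron_eq t
      have e2 := P.neg_e_mul_χ_add
      simp only [PlasmaParams.q]
      rw [eq_div_iff hm.ne', sub_mul, div_mul_cancel₀ _ hm.ne']
      linear_combination P.T .electron * s * e1 - s * P.slow s (ρ · t) (A · t) * e2)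
    (by
      intro t
      refine ((hM.hasDerivAt_β t).add
        ((hM.hasDerivAt_slow t).const_mul (P.χ * s))).congr_deriv ?_
      ring)
    (by
      intro t ht
      obtain ⟨f1, f2, -, -, f5, -⟩ := hforms s (ρ · t) (A · t) (β t) hs.le hs1
      have hSt := hS t ht
      set p := P.pressure (ρ · t)
      set x := P.κ .electron / P.κtot * (β t / (4 * Real.pi * P.e)) + P.drift (A · t)
      set y := -(P.κ .ion / P.κtot) * (β t / (4 * Real.pi * P.e)) + P.drift (A · t)
      set S := stateSq (ρ · t) (A · t) (β t)
      have hS0 : 0 ≤ S := stateSq_nonneg _ _ _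
      have g1 := sq_add_two_le (P.T .ion * x) (P.m .ion * P.μ₁ * s * p)
      have g2 := sq_add_two_le (P.T .electron * y) (P.m .electron * P.μ₁ * s * p)
      have q1 : (P.T .ion * x) ^ 2 ≤ P.T .ion ^ 2 * (B * S) := by rw [mul_pow]; gcongr
      have q2 : (P.T .electron * y) ^ 2 ≤ P.T .electron ^ 2 * (B * S) := by rw [mul_pow]; gcongr
      have r0 : ∀ k : ℝ, (k * s * p) ^ 2 ≤ k ^ 2 * (B * S) := by
        intro k
        calc (k * s * p) ^ 2 = k ^ 2 * (s ^ 2 * p ^ 2) := by ring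
          _ ≤ k ^ 2 * (1 * (B * S)) := by gcongr
          _ = _ := by ring
      have q3 := r0 (P.m .ion * P.μ₁)
      have q4 := r0 (P.m .electron * P.μ₁)
      have q5 := r0 P.χ
      have q6 : 0 ≤ P.χ ^ 2 * (B * S) := by positivity
      have tot : (P.T .ion * x + P.m .ion * P.μ₁ * s * p) ^ 2 +
          (P.T .electron * y + P.m .electron * P.μ₁ * s * p) ^ 2 + (P.χ * s * p) ^ 2 ≤
          2 * (P.T .ion ^ 2 + P.T .electron ^ 2 + (P.m .ion * P.μ₁) ^ 2 +
            (P.m .electron * P.μ₁) ^ 2 + P.χ ^ 2) * (B * S) := by linarith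
      calc _ = s ^ 4 * ((P.T .ion * x + P.m .ion * P.μ₁ * s * p) ^ 2 +
          (P.T .electron * y + P.m .electron * P.μ₁ * s * p) ^ 2 + (P.χ * s * p) ^ 2) := by ring
        _ ≤ s ^ 4 * (2 * (P.T .ion ^ 2 + P.T .electron ^ 2 + (P.m .ion * P.μ₁) ^ 2 +
            (P.m .electron * P.μ₁) ^ 2 + P.χ ^ 2) * (B * (K * S₀ * Real.exp (-(d * t))))) := by
            refine mul_le_mul_of_nonneg_left (tot.trans ?_) (by positivity)
            gcongr
        _ = _ := by rw [hB₁]; ring)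
  intro t ht
  have hWt := hW t ht
  have hζ := hslow s d S₀ ρ A β hs hs1 hM hS₀0 hdμ hS t ht
  set Z := P.slow s (ρ · t) (A · t) with hZ
  set Z₀ := P.slow s (ρ · 0) (A · 0) with hZ₀
  set N₀ := P.meanDensity (ρ · 0) with hN₀
  set E := Real.exp (-(P.μ₁ * s ^ 2 * t)) with hE
  set G := Real.exp (-(d * t)) with hG
  have hG0 : 0 < G := Real.exp_pos _
  obtain ⟨-, -, -, k4, -, k6⟩ := hforms s (ρ · 0) (A · 0) (β 0) hs.le hs1
  obtain ⟨f1, f2, -, -, -, -⟩ := hforms s (ρ · t) (A · t) (β t) hs.le hs1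
  have hEG : E ^ 2 ≤ G := by
    rw [hE, hG, ← Real.exp_nat_mul]
    apply Real.exp_le_exp.2
    have : d * t ≤ P.μ₁ * s ^ 2 / 2 * t := by gcongr
    have h0 : 0 ≤ P.μ₁ * s ^ 2 * t := by positivity
    push_cast
    linarith
  -- The profile starts from the mean density and not from the slow variable; the two differ by `s`
  -- times the initial drift.
  have hdiff0 : (E * (Z₀ - N₀)) ^ 2 ≤ B * (s ^ 2 * (S₀ * G)) := by
    have : Z₀ - N₀ = -(s * P.drift (A · 0)) := by
      rw [hZ₀, hN₀, PlasmaParams.slow]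
      ring
    rw [this]
    calc (E * -(s * P.drift (A · 0))) ^ 2 = E ^ 2 * (s ^ 2 * P.drift (A · 0) ^ 2) := by ring
      _ ≤ G * (s ^ 2 * (B * S₀)) := by gcongr
      _ = _ := by ring
  have hheat : (Z - E * N₀) ^ 2 ≤ C₃ * (s ^ 2 * (S₀ * G)) := by
    have h1 := sq_add_two_le (Z - E * Z₀) (E * (Z₀ - N₀))
    have h2 : Z - E * Z₀ + E * (Z₀ - N₀) = Z - E * N₀ := by ring
    rw [h2] at h1
    rw [hC₃]
    linarith
  have hdens : ∀ {x v : ℝ}, x = Z + s * v → v ^ 2 ≤ B * stateSq (ρ · t) (A · t) (β t) →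
      (x - E * N₀) ^ 2 ≤ 3 * (B * K + C₂ + B) * (s ^ 2 * (S₀ * G)) := by
    intro x v hx hv
    have h1 := sq_add_three_le (s * v) (Z - E * Z₀) (E * (Z₀ - N₀))
    have h2 : s * v + (Z - E * Z₀) + E * (Z₀ - N₀) = x - E * N₀ := by rw [hx]; ring
    rw [h2] at h1
    have h3 : (s * v) ^ 2 ≤ B * K * (s ^ 2 * (S₀ * G)) := by
      calc (s * v) ^ 2 = s ^ 2 * v ^ 2 := by ring
        _ ≤ s ^ 2 * (B * (K * S₀ * G)) := by
            gcongr
            exact hv.trans (by gcongr; exact hS t ht)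
        _ = _ := by ring
    linarith
  have hW0 : (A .ion 0 - P.μ₁ * s * Z₀) ^ 2 + (A .electron 0 - P.μ₁ * s * Z₀) ^ 2 +
      (β 0 + P.χ * s * Z₀) ^ 2 ≤ W₀ * S₀ := by
    have r : ∀ x k : ℝ, (x + k * s * Z₀) ^ 2 ≤ 2 * (x ^ 2 + k ^ 2 * (B * S₀)) := by
      intro x k
      refine (sq_add_two_le _ _).trans ?_
      have : (k * s * Z₀) ^ 2 ≤ k ^ 2 * (B * S₀) := by
        calc (k * s * Z₀) ^ 2 = k ^ 2 * (s ^ 2 * Z₀ ^ 2) := by ring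
          _ ≤ k ^ 2 * (1 * (B * S₀)) := by gcongr
          _ = _ := by ring
      linarith
    have r1 := r (A .ion 0) (-P.μ₁)
    have r2 := r (A .electron 0) (-P.μ₁)
    have r3 := r (β 0) P.χ
    have hx : A .ion 0 ^ 2 + A .electron 0 ^ 2 + β 0 ^ 2 ≤ S₀ := by
      rw [hS₀, stateSq]
      have := sq_nonneg (ρ .ion 0)
      have := sq_nonneg (ρ .electron 0)
      linarith
    have e1 : A .ion 0 - P.μ₁ * s * Z₀ = A .ion 0 + -P.μ₁ * s * Z₀ := by ring
    have e2 : A .electron 0 - P.μ₁ * s * Z₀ = A .electron 0 + -P.μ₁ * s * Z₀ := by ring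
    rw [e1, e2, hW₀]
    linarith
  set F := Real.exp (-(a * t)) with hF
  have hF0 : 0 < F := Real.exp_pos _
  have hblk : (A .ion t - P.μ₁ * s * Z) ^ 2 + (A .electron t - P.μ₁ * s * Z) ^ 2 +
      (β t + P.χ * s * Z) ^ 2 ≤ C₄ * (S₀ * (F + s ^ 4 * G)) := by
    refine hWt.trans ?_
    calc _ ≤ C₁ * (F * (W₀ * S₀) + s ^ 4 * (B₁ * S₀) * G) := by gcongr
      _ ≤ _ := by
          rw [hC₄, mul_assoc C₁]
          refine mul_le_mul_of_nonneg_left ?_ hC₁.le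
          have p1 : 0 ≤ B₁ * (S₀ * F) := by positivity
          have p2 : 0 ≤ W₀ * (S₀ * (s ^ 4 * G)) := by positivity
          linarith
  -- Replacing `Z` by the heat profile inside `k s Z` costs `s · O(s)`, the same order as the
  -- deviation itself.
  have hfast : ∀ {x k : ℝ}, (x + k * s * Z) ^ 2 ≤ C₄ * (S₀ * (F + s ^ 4 * G)) →
      k ^ 2 ≤ P.μ₁ ^ 2 + P.χ ^ 2 →
      (x + k * s * (E * N₀)) ^ 2 ≤
        2 * (C₄ + (P.μ₁ ^ 2 + P.χ ^ 2) * C₃) * (S₀ * (F + s ^ 4 * G)) := by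
    intro x k hx hk
    have h1 := sq_add_two_le (x + k * s * Z) (-(k * s * (Z - E * N₀)))
    have h2 : x + k * s * Z + -(k * s * (Z - E * N₀)) = x + k * s * (E * N₀) := by ring
    rw [h2] at h1
    have h3 : (-(k * s * (Z - E * N₀))) ^ 2 ≤
        (P.μ₁ ^ 2 + P.χ ^ 2) * C₃ * (S₀ * (F + s ^ 4 * G)) := by
      calc (-(k * s * (Z - E * N₀))) ^ 2 = k ^ 2 * (s ^ 2 * (Z - E * N₀) ^ 2) := by ring
        _ ≤ (P.μ₁ ^ 2 + P.χ ^ 2) * (s ^ 2 * (C₃ * (s ^ 2 * (S₀ * G)))) := by gcongr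
        _ = (P.μ₁ ^ 2 + P.χ ^ 2) * C₃ * (S₀ * (s ^ 4 * G)) := by ring
        _ ≤ _ := by gcongr; linarith
    linarith
  set Q := 2 * (C₄ + (P.μ₁ ^ 2 + P.χ ^ 2) * C₃) with hQ
  have hQ0 : 0 < Q := by positivity
  set R := 3 * (B * K + C₂ + B) with hR
  have hR0 : 0 < R := by positivity
  have w1 : ∀ y : ℝ, 0 ≤ y → R * y ≤ (R + Q) * y := fun y hy => by gcongr; linarith
  have w2 : ∀ y : ℝ, 0 ≤ y → Q * y ≤ (R + Q) * y := fun y hy => by gcongr; linarith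
  have n1 : 0 ≤ s ^ 2 * (S₀ * G) := by positivity
  have n2 : 0 ≤ S₀ * (F + s ^ 4 * G) := by positivity
  have sq1 := sq_nonneg (A .ion t - P.μ₁ * s * Z)
  have sq2 := sq_nonneg (A .electron t - P.μ₁ * s * Z)
  have sq3 := sq_nonneg (β t + P.χ * s * Z)
  have conv : ∀ x y : ℝ, x - P.μ₁ * s * y = x + -P.μ₁ * s * y := fun x y => by ring
  have kμ : (-P.μ₁) ^ 2 ≤ P.μ₁ ^ 2 + P.χ ^ 2 := by
    rw [neg_sq]; linarith [sq_nonneg P.χ]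
  refine ⟨fun α => ?_, fun α => ?_, ?_⟩
  · refine le_trans ?_ (w1 _ n1)
    cases α
    · exact hdens (hM.ion_eq t) f1
    · exact hdens (hM.electron_eq t) f2
  · refine le_trans ?_ (w2 _ n2)
    rw [conv]
    cases α
    · exact hfast (by rw [← conv]; linarith) kμ
    · exact hfast (by rw [← conv]; linarith) kμ
  · refine le_trans ?_ (w2 _ n2)
    exact hfast (by linarith) (by linarith [sq_nonneg P.μ₁])

/-! ### Complex modes. -/

/-- A complex solution of the fluid system at wave number `s`. -/
structure IsComplexMode (P : PlasmaParams) (s : ℝ) (ρ A : Species → ℝ → ℂ) (β : ℝ → ℂ) : Prop where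
  hasDerivAt_ρ : ∀ α t, HasDerivAt (ρ α) (-(s * A α t)) t
  hasDerivAt_A : ∀ α t, HasDerivAt (A α)
    ((P.q α * β t + P.T α * s * ρ α t - P.κ α * A α t) / P.m α) t
  hasDerivAt_β : ∀ t, HasDerivAt β
    (-(4 * Real.pi * P.e * (A .ion t - A .electron t))) t
  gauss : ∀ t, s * β t = 4 * Real.pi * P.e * (ρ .ion t - ρ .electron t)

namespace IsComplexMode

variable {P : PlasmaParams} {s : ℝ} {ρ A : Species → ℝ → ℂ} {β : ℝ → ℂ}

/-- The coefficients are real, so the real and imaginary parts solve the system separately. -/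
theorem re (h : IsComplexMode P s ρ A β) :
    IsMode P s (fun α t => (ρ α t).re) (fun α t => (A α t).re) (fun t => (β t).re) where
  hasDerivAt_ρ α t := by
    refine (Complex.reCLM.hasFDerivAt.comp_hasDerivAt t (h.hasDerivAt_ρ α t)).congr_deriv ?_
    simp
  hasDerivAt_A α t := by
    refine (Complex.reCLM.hasFDerivAt.comp_hasDerivAt t (h.hasDerivAt_A α t)).congr_deriv ?_
    rw [Complex.reCLM_apply, Complex.div_ofReal_re]
    simp
  hasDerivAt_β t := by
    refine (Complex.reCLM.hasFDerivAt.comp_hasDerivAt t (h.hasDerivAt_β t)).congr_deriv ?_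
    simp
  gauss t := by
    have := congrArg Complex.re (h.gauss t)
    simpa using this

theorem im (h : IsComplexMode P s ρ A β) :
    IsMode P s (fun α t => (ρ α t).im) (fun α t => (A α t).im) (fun t => (β t).im) where
  hasDerivAt_ρ α t := by
    refine (Complex.imCLM.hasFDerivAt.comp_hasDerivAt t (h.hasDerivAt_ρ α t)).congr_deriv ?_
    simp
  hasDerivAt_A α t := by
    refine (Complex.imCLM.hasFDerivAt.comp_hasDerivAt t (h.hasDerivAt_A α t)).congr_deriv ?_
    rw [Complex.imCLM_apply, Complex.div_ofReal_im]
    simp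
  hasDerivAt_β t := by
    refine (Complex.imCLM.hasFDerivAt.comp_hasDerivAt t (h.hasDerivAt_β t)).congr_deriv ?_
    simp
  gauss t := by
    have := congrArg Complex.im (h.gauss t)
    simpa using this

end IsComplexMode

/-- The size of the complex state of a mode. -/
noncomputable def stateNorm (ρ A : Species → ℂ) (β : ℂ) : ℝ :=
  ∑ α, ‖ρ α‖ + ∑ α, ‖A α‖ + ‖β‖

theorem sum_species {M : Type*} [AddCommMonoid M] (f : Species → M) :
    ∑ α, f α = f .ion + f .electron := by
  have : (Finset.univ : Finset Species) = {.ion, .electron} := rfl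
  rw [this, Finset.sum_pair (by simp)]

theorem stateSq_le_sq_of_abs_le {ρ A : Species → ℝ} {β : ℝ} {ρ' A' : Species → ℂ} {β' : ℂ}
    (hρ : ∀ α, |ρ α| ≤ ‖ρ' α‖) (hA : ∀ α, |A α| ≤ ‖A' α‖) (hβ : |β| ≤ ‖β'‖) :
    stateSq ρ A β ≤ stateNorm ρ' A' β' ^ 2 := by
  have key : ∀ {x : ℝ} {z : ℂ}, |x| ≤ ‖z‖ → x ^ 2 ≤ ‖z‖ ^ 2 := by
    intro x z h
    rw [← sq_abs]
    gcongr
  have h1 := key (hρ .ion)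
  have h2 := key (hρ .electron)
  have h3 := key (hA .ion)
  have h4 := key (hA .electron)
  have h5 := key hβ
  unfold stateSq stateNorm
  rw [sum_species, sum_species]
  set a := ‖ρ' .ion‖
  set b := ‖ρ' .electron‖
  set c := ‖A' .ion‖
  set d := ‖A' .electron‖
  set e := ‖β'‖
  have ha : 0 ≤ a := norm_nonneg _
  have hb : 0 ≤ b := norm_nonneg _
  have hc : 0 ≤ c := norm_nonneg _
  have hd : 0 ≤ d := norm_nonneg _
  have he : 0 ≤ e := norm_nonneg _
  have : 0 ≤ (a + b + (c + d) + e) ^ 2 - (a ^ 2 + b ^ 2 + (c ^ 2 + d ^ 2) + e ^ 2) := by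
    have e1 : (a + b + (c + d) + e) ^ 2 - (a ^ 2 + b ^ 2 + (c ^ 2 + d ^ 2) + e ^ 2) =
        2 * (a * b + a * c + a * d + a * e + b * c + b * d + b * e + c * d + c * e + d * e) := by
      ring
    rw [e1]
    positivity
  linarith

theorem exp_half_sq (x : ℝ) : Real.exp (-(x / 2)) ^ 2 = Real.exp (-x) := by
  rw [← Real.exp_nat_mul]
  congr 1
  push_cast
  ring

/-- The friction-weighted mean of a pair of complex densities. -/
noncomputable def PlasmaParams.cMeanDensity (P : PlasmaParams) (ρ : Species → ℂ) : ℂ :=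
  ∑ α, ((P.κ α / (P.κ .ion + P.κ .electron) : ℝ) : ℂ) * ρ α

theorem PlasmaParams.cMeanDensity_re (P : PlasmaParams) (ρ : Species → ℂ) :
    (P.cMeanDensity ρ).re = P.meanDensity fun α => (ρ α).re := by
  simp only [cMeanDensity, meanDensity, κtot, sum_species, Complex.add_re, Complex.re_ofReal_mul]
  ring

theorem PlasmaParams.cMeanDensity_im (P : PlasmaParams) (ρ : Species → ℂ) :
    (P.cMeanDensity ρ).im = P.meanDensity fun α => (ρ α).im := by
  simp only [cMeanDensity, meanDensity, κtot, sum_species, Complex.add_im, Complex.im_ofReal_mul]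
  ring

/-- Comparison of a complex mode with the diffusive profile at low frequency. -/
theorem lowFreq_norm_le (P : PlasmaParams) :
    ∃ a c C : ℝ, 0 < a ∧ 0 < c ∧ 0 < C ∧ ∀ (s : ℝ) (ρ A : Species → ℝ → ℂ) (β : ℝ → ℂ), 0 < s →
      s ≤ 1 → IsComplexMode P s ρ A β → ∀ t, 0 ≤ t →
      (∀ α, ‖ρ α t - (Real.exp (-(P.μ₁ * s ^ 2 * t)) : ℝ) * P.cMeanDensity (ρ · 0)‖ ≤
        C * (s * Real.exp (-(c * s ^ 2 * t)) * stateNorm (ρ · 0) (A · 0) (β 0))) ∧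
      (∀ α, ‖A α t - (P.μ₁ * s : ℝ) *
          ((Real.exp (-(P.μ₁ * s ^ 2 * t)) : ℝ) * P.cMeanDensity (ρ · 0))‖ ≤
        C * ((Real.exp (-(a * t)) + s ^ 2 * Real.exp (-(c * s ^ 2 * t))) *
          stateNorm (ρ · 0) (A · 0) (β 0))) ∧
      ‖β t + (P.χ * s : ℝ) *
          ((Real.exp (-(P.μ₁ * s ^ 2 * t)) : ℝ) * P.cMeanDensity (ρ · 0))‖ ≤
        C * ((Real.exp (-(a * t)) + s ^ 2 * Real.exp (-(c * s ^ 2 * t))) *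
          stateNorm (ρ · 0) (A · 0) (β 0)) := by
  obtain ⟨a, c, C, ha, hc, hC, h⟩ := lowFreq_sq_le P
  -- The square root halves the rates; the factor two adds the real and imaginary parts.
  refine ⟨a / 2, c / 2, 2 * Real.sqrt C, by positivity, by positivity, by positivity, ?_⟩
  intro s ρ A β hs hs1 hM t ht
  set X := stateNorm (ρ · 0) (A · 0) (β 0) with hX
  have hX0 : 0 ≤ X := by rw [hX, stateNorm]; positivity
  obtain ⟨r1, r2, r3⟩ := h s _ _ _ hs hs1 hM.re t ht
  obtain ⟨i1, i2, i3⟩ := h s _ _ _ hs hs1 hM.im t ht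
  have sr : stateSq (fun α => (ρ α 0).re) (fun α => (A α 0).re) (β 0).re ≤ X ^ 2 :=
    stateSq_le_sq_of_abs_le (fun _ => Complex.abs_re_le_norm _) (fun _ => Complex.abs_re_le_norm _)
      (Complex.abs_re_le_norm _)
  have si : stateSq (fun α => (ρ α 0).im) (fun α => (A α 0).im) (β 0).im ≤ X ^ 2 :=
    stateSq_le_sq_of_abs_le (fun _ => Complex.abs_im_le_norm _) (fun _ => Complex.abs_im_le_norm _)
      (Complex.abs_im_le_norm _)
  have combine : ∀ (z : ℂ) (b : ℝ), |z.re| ≤ b → |z.im| ≤ b → ‖z‖ ≤ 2 * b := by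
    intro z b h1 h2
    have := Complex.norm_le_abs_re_add_abs_im z
    linarith
  have g1 : Real.exp (-(c / 2 * s ^ 2 * t)) ^ 2 = Real.exp (-(c * s ^ 2 * t)) := by
    rw [← exp_half_sq (c * s ^ 2 * t)]
    congr 3
    ring
  have g2 : Real.exp (-(a / 2 * t)) ^ 2 = Real.exp (-(a * t)) := by
    rw [← exp_half_sq (a * t)]
    congr 3
    ring
  set G := Real.exp (-(c / 2 * s ^ 2 * t))
  set F := Real.exp (-(a / 2 * t))
  have hG : 0 < G := Real.exp_pos _
  have hF : 0 < F := Real.exp_pos _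
  rw [← g1] at r1 r2 r3 i1 i2 i3
  rw [← g2] at r2 r3 i2 i3
  have dens : ∀ x S : ℝ, x ^ 2 ≤ C * (s ^ 2 * (S * G ^ 2)) → S ≤ X ^ 2 →
      |x| ≤ Real.sqrt C * (s * G * X) := by
    intro x S hx hS
    refine abs_le_of_sq_le_sq (hx.trans ?_) (by positivity)
    rw [mul_pow, Real.sq_sqrt hC.le]
    calc C * (s ^ 2 * (S * G ^ 2)) ≤ C * (s ^ 2 * (X ^ 2 * G ^ 2)) := by gcongr
      _ = _ := by ring
  have fast : ∀ x S : ℝ, x ^ 2 ≤ C * (S * (F ^ 2 + s ^ 4 * G ^ 2)) → S ≤ X ^ 2 →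
      |x| ≤ Real.sqrt C * ((F + s ^ 2 * G) * X) := by
    intro x S hx hS
    refine abs_le_of_sq_le_sq (hx.trans ?_) (by positivity)
    rw [mul_pow, Real.sq_sqrt hC.le]
    have h0 : 0 ≤ 2 * (F * (s ^ 2 * G)) := by positivity
    calc C * (S * (F ^ 2 + s ^ 4 * G ^ 2)) ≤ C * (X ^ 2 * ((F + s ^ 2 * G) ^ 2)) := by
          gcongr
          linarith
      _ = _ := by ring
  refine ⟨fun α => ?_, fun α => ?_, ?_⟩
  · refine (combine _ _ (dens _ _ ?_ sr) (dens _ _ ?_ si)).trans (le_of_eq (by ring))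
    · simpa only [Complex.sub_re, Complex.re_ofReal_mul, P.cMeanDensity_re] using r1 α
    · simpa only [Complex.sub_im, Complex.im_ofReal_mul, P.cMeanDensity_im] using i1 α
  · refine (combine _ _ (fast _ _ ?_ sr) (fast _ _ ?_ si)).trans (le_of_eq (by ring))
    · simpa only [Complex.sub_re, Complex.re_ofReal_mul, P.cMeanDensity_re] using r2 α
    · simpa only [Complex.sub_im, Complex.im_ofReal_mul, P.cMeanDensity_im] using i2 α
  · refine (combine _ _ (fast _ _ ?_ sr) (fast _ _ ?_ si)).trans (le_of_eq (by ring))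
    · simpa only [Complex.add_re, Complex.re_ofReal_mul, P.cMeanDensity_re] using r3
    · simpa only [Complex.add_im, Complex.im_ofReal_mul, P.cMeanDensity_im] using i3

/-- Exponential decay of complex modes at high frequency. -/
theorem highFreq_norm_le (P : PlasmaParams) :
    ∃ a C : ℝ, 0 < a ∧ 0 < C ∧ ∀ (s : ℝ) (ρ A : Species → ℝ → ℂ) (β : ℝ → ℂ), 1 ≤ s →
      IsComplexMode P s ρ A β → ∀ t, 0 ≤ t →
      (∀ α, ‖ρ α t‖ ≤ C * (Real.exp (-(a * t)) * stateNorm (ρ · 0) (A · 0) (β 0))) ∧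
      (∀ α, ‖A α t‖ ≤ C * (Real.exp (-(a * t)) * stateNorm (ρ · 0) (A · 0) (β 0))) ∧
      ‖β t‖ ≤ C * (Real.exp (-(a * t)) * stateNorm (ρ · 0) (A · 0) (β 0)) := by
  obtain ⟨c, K, hc, hK, h⟩ := stateSq_decay P
  -- For `s ≥ 1` the fraction `s² / (1 + s²)` is at least one half, and the square root halves the
  -- rate again.
  refine ⟨c / 4, 2 * Real.sqrt K, by positivity, by positivity, ?_⟩
  intro s ρ A β hs hM t ht
  have hs0 : 0 < s := by linarith
  set X := stateNorm (ρ · 0) (A · 0) (β 0) with hX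
  have hX0 : 0 ≤ X := by rw [hX, stateNorm]; positivity
  have hr := h s _ _ _ hs0 hM.re t ht
  have hi := h s _ _ _ hs0 hM.im t ht
  have sr : stateSq (fun α => (ρ α 0).re) (fun α => (A α 0).re) (β 0).re ≤ X ^ 2 :=
    stateSq_le_sq_of_abs_le (fun _ => Complex.abs_re_le_norm _) (fun _ => Complex.abs_re_le_norm _)
      (Complex.abs_re_le_norm _)
  have si : stateSq (fun α => (ρ α 0).im) (fun α => (A α 0).im) (β 0).im ≤ X ^ 2 :=
    stateSq_le_sq_of_abs_le (fun _ => Complex.abs_im_le_norm _) (fun _ => Complex.abs_im_le_norm _)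
      (Complex.abs_im_le_norm _)
  have hexp : Real.exp (-(c * (s ^ 2 / (1 + s ^ 2)) * t)) ≤ Real.exp (-(c / 4 * t)) ^ 2 := by
    have : Real.exp (-(c / 4 * t)) ^ 2 = Real.exp (-(c * (1 / 2) * t)) := by
      rw [← exp_half_sq (c * (1 / 2) * t)]
      congr 3
      ring
    rw [this]
    have h1 : 1 / 2 ≤ s ^ 2 / (1 + s ^ 2) := by
      rw [div_le_div_iff₀ (by norm_num) (by positivity)]
      nlinarith
    gcongr
  set F := Real.exp (-(c / 4 * t))
  have hF : 0 < F := Real.exp_pos _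
  have bd : ∀ x S S₀ : ℝ, x ^ 2 ≤ S → S ≤ K * S₀ * Real.exp (-(c * (s ^ 2 / (1 + s ^ 2)) * t)) →
      S₀ ≤ X ^ 2 → |x| ≤ Real.sqrt K * (F * X) := by
    intro x S S₀ hx hS hS₀
    refine abs_le_of_sq_le_sq ?_ (by positivity)
    rw [mul_pow, Real.sq_sqrt hK.le]
    calc x ^ 2 ≤ K * S₀ * Real.exp (-(c * (s ^ 2 / (1 + s ^ 2)) * t)) := hx.trans hS
      _ ≤ K * X ^ 2 * F ^ 2 := by gcongr
      _ = _ := by ring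
  have combine : ∀ (z : ℂ) (b : ℝ), |z.re| ≤ b → |z.im| ≤ b → ‖z‖ ≤ 2 * b := by
    intro z b h1 h2
    have := Complex.norm_le_abs_re_add_abs_im z
    linarith
  have comp : ∀ (ρ A : Species → ℝ) (β : ℝ), (∀ α, ρ α ^ 2 ≤ stateSq ρ A β) ∧
      (∀ α, A α ^ 2 ≤ stateSq ρ A β) ∧ β ^ 2 ≤ stateSq ρ A β := by
    intro ρ A β
    have h1 := sq_nonneg (ρ .ion)
    have h2 := sq_nonneg (ρ .electron)
    have h3 := sq_nonneg (A .ion)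
    have h4 := sq_nonneg (A .electron)
    have h5 := sq_nonneg β
    unfold stateSq
    refine ⟨fun α => ?_, fun α => ?_, by linarith⟩ <;> cases α <;> linarith
  obtain ⟨cr1, cr2, cr3⟩ := comp (fun α => (ρ α t).re) (fun α => (A α t).re) (β t).re
  obtain ⟨ci1, ci2, ci3⟩ := comp (fun α => (ρ α t).im) (fun α => (A α t).im) (β t).im
  refine ⟨fun α => ?_, fun α => ?_, ?_⟩
  · exact (combine _ _ (bd _ _ _ (cr1 α) hr sr) (bd _ _ _ (ci1 α) hi si)).trans
      (le_of_eq (by ring))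
  · exact (combine _ _ (bd _ _ _ (cr2 α) hr sr) (bd _ _ _ (ci2 α) hi si)).trans
      (le_of_eq (by ring))
  · exact (combine _ _ (bd _ _ _ cr3 hr sr) (bd _ _ _ ci3 hi si)).trans
      (le_of_eq (by ring))

/-! ### Weak solutions of linear systems and the matrix exponential. -/

/-- A derivative on `(0, ∞)` that is continuous up to `0` is a right derivative on `[0, ∞)`. -/
theorem hasDerivWithinAt_Ici_of_continuousOn {f f' : ℝ → ℂ} (hf : ContinuousOn f (Ici 0))
    (hf' : ContinuousOn f' (Ici 0)) (h : ∀ t > 0, HasDerivAt f (f' t) t) {t : ℝ} (ht : 0 ≤ t) :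
    HasDerivWithinAt f (f' t) (Ici t) t := by
  rcases ht.eq_or_lt with rfl | ht
  · refine hasDerivWithinAt_Ici_of_tendsto_deriv (s := Ioi 0)
      (fun x hx => (h x hx).differentiableAt.differentiableWithinAt) ?_ self_mem_nhdsWithin ?_
    · exact (hf 0 self_mem_Ici).mono Ioi_subset_Ici_self
    · refine Filter.Tendsto.congr' ?_ ((hf' 0 self_mem_Ici).mono Ioi_subset_Ici_self)
      filter_upwards [self_mem_nhdsWithin] with x hx
      exact (h x hx).deriv.symm
  · exact (h t ht).hasDerivWithinAt

theorem hasDerivAt_taylorTerms (c : ℕ → ℂ) (j : ℕ) (t : ℝ) :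
    HasDerivAt (fun s : ℝ => ∑ k ∈ Finset.range (j + 1), ((s ^ k / k.factorial : ℝ) : ℂ) * c k)
      (∑ k ∈ Finset.range j, ((t ^ k / k.factorial : ℝ) : ℂ) * c (k + 1)) t := by
  have h : ∀ k ∈ Finset.range (j + 1), HasDerivAt
      (fun s : ℝ => ((s ^ k / k.factorial : ℝ) : ℂ) * c k)
      (((k * t ^ (k - 1) / k.factorial : ℝ) : ℂ) * c k) t := fun k _ =>
    (((hasDerivAt_pow k t).div_const (k.factorial : ℝ)).ofReal_comp).mul_const _
  refine (HasDerivAt.fun_sum h).congr_deriv ?_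
  rw [Finset.sum_range_succ']
  simp only [Nat.cast_zero, zero_mul, zero_div, Complex.ofReal_zero, add_zero]
  refine Finset.sum_congr rfl fun k _ => ?_
  congr 2
  rw [Nat.factorial_succ, Nat.add_sub_cancel]
  push_cast
  have : (k.factorial : ℝ) ≠ 0 := by positivity
  field_simp

/-- A function all of whose derivatives are bounded geometrically is the sum of its Taylor
series. -/
theorem hasSum_taylor_of_bounded {F : ℕ → ℝ → ℂ} (hc : ∀ n, ContinuousOn (F n) (Ici 0))
    (hd : ∀ n, ∀ t > 0, HasDerivAt (F n) (F (n + 1) t) t) {b K A : ℝ} (hb : 0 ≤ b)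
    (hbd : ∀ n, ∀ t ∈ Icc 0 b, ‖F n t‖ ≤ K * A ^ n) :
    HasSum (fun k => ((b ^ k / k.factorial : ℝ) : ℂ) * F k 0) (F 0 b) := by
  -- The induction runs over all `n` at once: the remainder of order `j + 1` of `F n` vanishes at
  -- zero and has as derivative the remainder of order `j` of `F (n + 1)`.
  have key : ∀ j n, ∀ t ∈ Icc 0 b,
      ‖F n t - ∑ k ∈ Finset.range j, ((t ^ k / k.factorial : ℝ) : ℂ) * F (n + k) 0‖ ≤
        K * A ^ (n + j) * (t ^ j / j.factorial) := by
    intro j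
    induction j with
    | zero => intro n t ht; simpa using hbd n t ht
    | succ j ih =>
      intro n
      have hT := hasDerivAt_taylorTerms (fun k => F (n + k) 0) j
      refine image_norm_le_of_norm_deriv_right_le_deriv_boundary' (a := 0) (b := b)
        (f' := fun t => F (n + 1) t -
          ∑ k ∈ Finset.range j, ((t ^ k / k.factorial : ℝ) : ℂ) * F (n + 1 + k) 0)
        (B' := fun t => K * A ^ (n + 1 + j) * (t ^ j / j.factorial)) ?_ ?_ ?_ ?_ ?_ ?_
      · refine ((hc n).mono Icc_subset_Ici_self).sub ?_
        exact fun t _ => (hT t).continuousAt.continuousWithinAt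
      · intro t ht
        refine ((hasDerivWithinAt_Ici_of_continuousOn (hc n) (hc (n + 1)) (hd n) ht.1).sub
          (hT t).hasDerivWithinAt).congr_deriv ?_
        simp only [add_assoc, add_comm 1]
      · simp [Finset.sum_range_succ']
      · fun_prop
      · intro t _
        have h : HasDerivAt (fun t : ℝ => K * A ^ (n + (j + 1)) * (t ^ (j + 1) / (j + 1).factorial))
            (K * A ^ (n + (j + 1)) * (((j + 1 : ℕ) : ℝ) * t ^ j / (j + 1).factorial)) t := by
          have := ((hasDerivAt_pow (j + 1) t).div_const ((j + 1).factorial : ℝ)).const_mul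
            (K * A ^ (n + (j + 1)))
          rwa [Nat.add_sub_cancel] at this
        refine (h.congr_deriv ?_).hasDerivWithinAt
        rw [Nat.factorial_succ, show n + (j + 1) = n + 1 + j by ring]
        push_cast
        have : (j.factorial : ℝ) ≠ 0 := by positivity
        field_simp
      · exact fun t ht => ih (n + 1) t (Ico_subset_Icc_self ht)
  have hsum : Summable fun k => ((b ^ k / k.factorial : ℝ) : ℂ) * F k 0 := by
    refine Summable.of_norm_bounded (g := fun k => K * ((A * b) ^ k / k.factorial))
      ((Real.summable_pow_div_factorial _).mul_left K) fun k => ?_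
    have h := hbd k 0 ⟨le_rfl, hb⟩
    rw [norm_mul, Complex.norm_real, Real.norm_of_nonneg (by positivity), mul_pow]
    calc b ^ k / k.factorial * ‖F k 0‖ ≤ b ^ k / k.factorial * (K * A ^ k) := by gcongr
      _ = _ := by ring
  refine (hsum.hasSum_iff_tendsto_nat).2 ?_
  rw [tendsto_iff_norm_sub_tendsto_zero]
  have h0 : Filter.Tendsto (fun j : ℕ => K * ((A * b) ^ j / j.factorial)) Filter.atTop (nhds 0) := by
    simpa using (FloorSemiring.tendsto_pow_div_factorial_atTop (A * b)).const_mul K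
  refine squeeze_zero (fun _ => norm_nonneg _) (fun j => ?_) h0
  have h := key j 0 b ⟨hb, le_rfl⟩
  simp only [zero_add] at h
  rw [norm_sub_rev]
  refine h.trans (le_of_eq ?_)
  rw [mul_pow]
  ring

section WeakSystem

open scoped Matrix.Norms.Operator Matrix

variable {ι : Type*} [Fintype ι] [DecidableEq ι]

theorem norm_entry_le (M : Matrix ι ι ℂ) (i k : ι) : ‖M i k‖ ≤ ‖M‖ := by
  rw [Matrix.linfty_opNorm_def, ← coe_nnnorm, NNReal.coe_le_coe]
  exact (Finset.single_le_sum (f := fun k => ‖M i k‖₊) (fun _ _ => zero_le) (Finset.mem_univ k)).trans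
    (Finset.le_sup (f := fun i => ∑ k, ‖M i k‖₊) (Finset.mem_univ i))

theorem norm_pow_entry_le [Nonempty ι] {M : Matrix ι ι ℂ} {A : ℝ} (hA : ‖M‖ ≤ A) (n : ℕ) (i k : ι) :
    ‖(M ^ n) i k‖ ≤ A ^ n := by
  have : NormOneClass (Matrix ι ι ℂ) := Matrix.linfty_opNormOneClass
  exact (norm_entry_le _ i k).trans ((norm_pow_le _ n).trans (pow_le_pow_left₀ (norm_nonneg _) hA n))

/-- The test functions `φ (Mⁿ)_{i k}`. -/
noncomputable def iterTest (M : E3 → Matrix ι ι ℂ) (φ : 𝓢(E3, ℂ)) (i : ι) : ℕ → ι → 𝓢(E3, ℂ)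
  | 0, k => if i = k then φ else 0
  | n + 1, k => ∑ l, SchwartzMap.smulLeftCLM ℂ (fun ξ => M ξ l k) (iterTest M φ i n l)

theorem iterTest_apply {M : E3 → Matrix ι ι ℂ}
    (hM : ∀ i k, (fun ξ => M ξ i k).HasTemperateGrowth) (φ : 𝓢(E3, ℂ)) (i : ι) (n : ℕ) (k : ι)
    (ξ : E3) : iterTest M φ i n k ξ = φ ξ * (M ξ ^ n) i k := by
  induction n generalizing k with
  | zero => by_cases h : i = k <;> simp [iterTest, h]
  | succ n ih =>
    rw [iterTest, sum_apply, pow_succ, Matrix.mul_apply, Finset.mul_sum]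
    refine Finset.sum_congr rfl fun l _ => ?_
    rw [SchwartzMap.smulLeftCLM_apply_apply (hM l k), ih, smul_eq_mul]
    ring

/-- A weak solution of the linear system `∂_t V = M V` with a smooth matrix symbol `M` is given by
the matrix exponential. -/
theorem weakSystem_eq_exp [Nonempty ι] {M : E3 → Matrix ι ι ℂ}
    (hM : ∀ i k, (fun ξ => M ξ i k).HasTemperateGrowth)
    {T : ι → ℝ → 𝓢'(E3, ℂ)} {V : ι → ℝ → E3 → ℂ}
    (hT : ∀ i, ∀ t ≥ 0, Represents (T i t) (V i t))
    (hcont : ∀ i (φ : 𝓢(E3, ℂ)), ContinuousOn (fun t => T i t φ) (Ici 0))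
    (hderiv : ∀ i (φ : 𝓢(E3, ℂ)), ∀ t > 0, HasDerivAt (fun s => T i s φ)
      (∑ k, T k t (SchwartzMap.smulLeftCLM ℂ (fun ξ => M ξ i k) φ)) t)
    (hbd : ∀ R b : ℝ, ∃ K, ∀ i, ∀ t ∈ Icc 0 b, ∫ ξ in Metric.closedBall 0 R, ‖V i t ξ‖ ≤ K)
    {t : ℝ} (ht : 0 ≤ t) (i : ι) :
    V i t =ᵐ[volume] fun ξ => (NormedSpace.exp (t • M ξ) *ᵥ fun k => V k 0 ξ) i := by
  have hMc : Continuous M := continuous_matrix fun i k => (hM i k).1.continuous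
  have hexpc : Continuous fun ξ => NormedSpace.exp (t • M ξ) :=
    (NormedSpace.exp_continuous (𝔸 := Matrix ι ι ℂ)).comp (hMc.const_smul t)
  have hexpk : ∀ k, Continuous fun ξ => NormedSpace.exp (t • M ξ) i k := fun k =>
    hexpc.matrix_elem i k
  have hloc0 : ∀ k, LocallyIntegrable (V k 0) := fun k => (hT k 0 le_rfl).locallyIntegrable
  have hloc : LocallyIntegrable fun ξ => (NormedSpace.exp (t • M ξ) *ᵥ fun k => V k 0 ξ) i := by
    simp only [Matrix.mulVec, dotProduct]
    refine locallyIntegrable_finsetSum _ fun k _ => ?_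
    have := (hloc0 k).locallyIntegrableOn univ
    rw [← locallyIntegrableOn_univ]
    exact this.continuousOn_mul (hexpk k).continuousOn isOpen_univ.isLocallyClosed
  refine ae_eq_of_integral_contDiff_smul_eq (hT i t ht).locallyIntegrable hloc ?_
  intro g hg hgc
  have h1 : HasCompactSupport (Complex.ofRealCLM ∘ g) := hgc.comp_left rfl
  have h2 : ContDiff ℝ (⊤ : ℕ∞) (Complex.ofRealCLM ∘ g) := Complex.ofRealCLM.contDiff.comp hg
  let φ : 𝓢(E3, ℂ) := h1.toSchwartzMap h2
  have hφ : ∀ ξ, φ ξ = g ξ := fun ξ => by simp [φ]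
  obtain ⟨R, hR0, hR⟩ := hgc.isCompact.isBounded.subset_closedBall_lt 0 (0 : E3)
  have hφ0 : ∀ ξ, ξ ∉ Metric.closedBall 0 R → φ ξ = 0 := fun ξ hξ => by
    rw [hφ, image_eq_zero_of_notMem_tsupport (fun h => hξ (hR h))]; simp
  obtain ⟨S, hS⟩ : ∃ S, ∀ ξ, ‖φ ξ‖ ≤ S := by
    obtain ⟨S, hS⟩ := hgc.exists_bound_of_continuous hg.continuous
    exact ⟨S, fun ξ => by rw [hφ, Complex.norm_real]; exact hS ξ⟩
  have hS0 : 0 ≤ S := (norm_nonneg _).trans (hS 0)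
  -- The symbol is unbounded on the whole space; compact support of the test function is what makes
  -- the powers of `M` grow only geometrically.
  obtain ⟨A, hA⟩ : ∃ A, ∀ ξ ∈ Metric.closedBall (0 : E3) R, ‖M ξ‖ ≤ A :=
    (isCompact_closedBall _ _).exists_bound_of_continuousOn hMc.continuousOn
  have hA0 : 0 ≤ A := (norm_nonneg _).trans (hA 0 (by simp [hR0.le]))
  obtain ⟨K, hK⟩ := hbd R t
  have hint : ∀ n k, ∀ s ≥ 0, Integrable fun ξ => φ ξ * (M ξ ^ n) i k * V k s ξ := fun n k s hs => by
    simpa only [iterTest_apply hM] using (hT k s hs (iterTest M φ i n k)).1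
  have hnorm : ∀ n k, ∀ s ∈ Icc 0 t, ∫ ξ, ‖φ ξ * (M ξ ^ n) i k * V k s ξ‖ ≤ S * A ^ n * K := by
    intro n k s hs
    have hVi : IntegrableOn (V k s) (Metric.closedBall 0 R) :=
      (hT k s hs.1).locallyIntegrable.integrableOn_isCompact (isCompact_closedBall _ _)
    rw [← setIntegral_eq_integral_of_forall_compl_eq_zero (s := Metric.closedBall 0 R)
      (fun ξ hξ => by rw [hφ0 ξ hξ]; simp)]
    calc ∫ ξ in Metric.closedBall 0 R, ‖φ ξ * (M ξ ^ n) i k * V k s ξ‖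
        ≤ ∫ ξ in Metric.closedBall 0 R, S * A ^ n * ‖V k s ξ‖ := by
          refine setIntegral_mono_on (hint n k s hs.1).norm.integrableOn
            (hVi.norm.const_mul _) Metric.isClosed_closedBall.measurableSet fun ξ hξ => ?_
          rw [norm_mul, norm_mul]
          gcongr
          · exact hS ξ
          · exact norm_pow_entry_le (hA ξ hξ) n i k
      _ = S * A ^ n * ∫ ξ in Metric.closedBall 0 R, ‖V k s ξ‖ := integral_const_mul _ _
      _ ≤ S * A ^ n * K := by
          gcongr
          exact hK k s hs
  -- The `n`-th time derivative of the pairing with `φ`, every derivative being moved onto the test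
  -- function as a factor `M`.
  let F : ℕ → ℝ → ℂ := fun n s => ∑ k, T k s (iterTest M φ i n k)
  have hFint : ∀ n, ∀ s ≥ 0, F n s = ∑ k, ∫ ξ, φ ξ * (M ξ ^ n) i k * V k s ξ := fun n s hs => by
    refine Finset.sum_congr rfl fun k _ => ?_
    rw [(hT k s hs _).2]
    simp only [iterTest_apply hM]
  have hFc : ∀ n, ContinuousOn (F n) (Ici 0) := fun n =>
    continuousOn_finsetSum _ fun k _ => hcont k _
  have hFd : ∀ n, ∀ s > 0, HasDerivAt (F n) (F (n + 1) s) s := fun n s hs => by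
    refine (HasDerivAt.fun_sum fun k _ => hderiv k (iterTest M φ i n k) s hs).congr_deriv ?_
    rw [Finset.sum_comm]
    refine Finset.sum_congr rfl fun l _ => ?_
    rw [iterTest, map_sum]
  have hFb : ∀ n, ∀ s ∈ Icc 0 t, ‖F n s‖ ≤ (Fintype.card ι * S * K) * A ^ n := fun n s hs => by
    rw [hFint n s hs.1]
    refine (norm_sum_le _ _).trans ((Finset.sum_le_sum fun k _ =>
      (norm_integral_le_integral_norm _).trans (hnorm n k s hs)).trans (le_of_eq ?_))
    simp only [Finset.sum_const, Finset.card_univ, nsmul_eq_mul]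
    ring
  have hsumL := hasSum_taylor_of_bounded hFc hFd ht hFb
  have hF0 : F 0 t = ∫ ξ, φ ξ * V i t ξ := by
    rw [hFint 0 t ht, Finset.sum_eq_single i]
    · simp
    · intro k _ hk
      simp [Matrix.one_apply_ne' hk]
    · simp
  -- The terms of the exponential series applied to the initial value and multiplied by `φ`; their
  -- integrals are the Taylor terms of the pairing.
  let H : ℕ → E3 → ℂ := fun n ξ =>
    ((t ^ n / n.factorial : ℝ) : ℂ) * ∑ k, φ ξ * (M ξ ^ n) i k * V k 0 ξ
  have hHi : ∀ n, Integrable (H n) := fun n =>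
    (integrable_finsetSum _ fun k _ => hint n k 0 le_rfl).const_mul _
  have hHn : ∀ n, ∫ ξ, ‖H n ξ‖ ≤ Fintype.card ι * S * K * ((A * t) ^ n / n.factorial) := by
    intro n
    have h3 : ∀ ξ, ‖H n ξ‖ ≤ t ^ n / n.factorial * ∑ k, ‖φ ξ * (M ξ ^ n) i k * V k 0 ξ‖ := fun ξ => by
      rw [norm_mul, Complex.norm_real, Real.norm_of_nonneg (by positivity)]
      gcongr
      exact norm_sum_le _ _
    have h4 : ∀ k ∈ Finset.univ, Integrable fun ξ => ‖φ ξ * (M ξ ^ n) i k * V k 0 ξ‖ := fun k _ =>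
      (hint n k 0 le_rfl).norm
    refine (integral_mono (hHi n).norm ((integrable_finsetSum _ h4).const_mul _) h3).trans ?_
    rw [integral_const_mul, integral_finsetSum _ h4]
    calc t ^ n / n.factorial * ∑ k, ∫ ξ, ‖φ ξ * (M ξ ^ n) i k * V k 0 ξ‖
        ≤ t ^ n / n.factorial * ∑ _k : ι, S * A ^ n * K := by
          gcongr with k
          exact hnorm n k 0 ⟨le_rfl, ht⟩
      _ = _ := by
          simp only [Finset.sum_const, Finset.card_univ, nsmul_eq_mul, mul_pow]
          ring
  have hHs : Summable fun n => ∫ ξ, ‖H n ξ‖ :=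
    Summable.of_nonneg_of_le (fun n => integral_nonneg fun _ => norm_nonneg _) hHn
      ((Real.summable_pow_div_factorial _).mul_left _)
  have hsumR := hasSum_integral_of_summable_integral_norm hHi hHs
  have hHF : ∀ n, ∫ ξ, H n ξ = ((t ^ n / n.factorial : ℝ) : ℂ) * F n 0 := fun n => by
    rw [integral_const_mul, integral_finsetSum _ fun k _ => hint n k 0 le_rfl, hFint n 0 le_rfl]
  simp only [hHF] at hsumR
  have hpt : ∀ ξ, ∑' n, H n ξ = φ ξ * (NormedSpace.exp (t • M ξ) *ᵥ fun k => V k 0 ξ) i := by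
    intro ξ
    have he := NormedSpace.exp_series_hasSum_exp' (𝕂 := ℝ) (t • M ξ)
    have hk : ∀ k, HasSum (fun n => ((t ^ n / n.factorial : ℝ) : ℂ) * (M ξ ^ n) i k)
        (NormedSpace.exp (t • M ξ) i k) := fun k => by
      have := (Pi.hasSum.1 (Pi.hasSum.1 he i) k)
      refine this.congr_fun ?_
      intro n
      simp [smul_pow, div_eq_inv_mul, mul_assoc]
    have hs : HasSum (fun n => H n ξ)
        (∑ k, φ ξ * V k 0 ξ * NormedSpace.exp (t • M ξ) i k) := by
      have h5 := hasSum_sum (s := Finset.univ) fun k _ => (hk k).mul_left (φ ξ * V k 0 ξ)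
      refine h5.congr_fun fun n => ?_
      simp only [H, Finset.mul_sum]
      exact Finset.sum_congr rfl fun k _ => by ring
    rw [hs.tsum_eq, Matrix.mulVec, dotProduct, Finset.mul_sum]
    exact Finset.sum_congr rfl fun k _ => by ring
  have hfin := hsumL.unique hsumR
  rw [hF0] at hfin
  simp only [hpt, hφ] at hfin
  simpa using hfin

end WeakSystem

/-! ### The fluid system on the Fourier side. -/

/-- The Fourier transform of the tempered distribution `T` is the function `G`. -/
def HasFourier (T : 𝓢'(E3, ℂ)) (G : E3 → ℂ) : Prop := Represents (𝓕 T) G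

namespace HasFourier

variable {T S : 𝓢'(E3, ℂ)} {G H : E3 → ℂ}

theorem sub (hT : HasFourier T G) (hS : HasFourier S H) :
    HasFourier (T - S) (fun ξ => G ξ - H ξ) := by
  have h : 𝓕 (T - S) = 𝓕 T - 𝓕 S := rfl
  rw [HasFourier, h]
  exact Represents.sub hT hS

theorem neg (hT : HasFourier T G) : HasFourier (-T) (fun ξ => -G ξ) := by
  have h : 𝓕 (-T) = -𝓕 T := rfl
  rw [HasFourier, h]
  exact Represents.neg hT

theorem real_smul (c : ℝ) (hT : HasFourier T G) : HasFourier (c • T) (fun ξ => (c : ℂ) * G ξ) := by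
  have h : 𝓕 (c • T) = c • 𝓕 T := rfl
  rw [HasFourier, h]
  exact Represents.real_smul c hT

theorem sum {ι : Type*} (s : Finset ι) {T : ι → 𝓢'(E3, ℂ)} {G : ι → E3 → ℂ}
    (h : ∀ i ∈ s, HasFourier (T i) (G i)) :
    HasFourier (∑ i ∈ s, T i) (fun ξ => ∑ i ∈ s, G i ξ) := by
  rw [HasFourier, fourier_sum]
  exact Represents.sum s h

theorem pd (hT : HasFourier T G) (j : Fin 3) :
    HasFourier (pd j T) (fun ξ => derivSymbol j ξ * G ξ) :=
  Represents.pd hT j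

theorem divergence {v : Fin 3 → 𝓢'(E3, ℂ)} {G : Fin 3 → E3 → ℂ} (h : ∀ j, HasFourier (v j) (G j)) :
    HasFourier (divergence v) (fun ξ => ∑ j, derivSymbol j ξ * G j ξ) :=
  sum _ fun j _ => (h j).pd j

theorem ae_eq (hG : HasFourier T G) (hH : HasFourier T H) : G =ᵐ[volume] H :=
  Represents.ae_eq hG hH

theorem congr_ae (hT : HasFourier T G) (h : G =ᵐ[volume] H) : HasFourier T H :=
  Represents.congr_ae hT h

end HasFourier

/-- The curve `T` of distributions is differentiable at `t` with derivative `S`. -/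
def HasDistDerivAt (T : ℝ → 𝓢'(E3, ℂ)) (S : 𝓢'(E3, ℂ)) (t : ℝ) : Prop :=
  ∀ φ : 𝓢(E3, ℂ), HasDerivAt (fun s => T s φ) (S φ) t

namespace HasDistDerivAt

variable {T : ℝ → 𝓢'(E3, ℂ)} {S : 𝓢'(E3, ℂ)} {t : ℝ}

theorem fourier (h : HasDistDerivAt T S t) : HasDistDerivAt (fun s => 𝓕 (T s)) (𝓕 S) t :=
  fun φ => h (𝓕 φ)

theorem pd (h : HasDistDerivAt T S t) (j : Fin 3) :
    HasDistDerivAt (fun s => pd j (T s)) (pd j S) t := fun φ => by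
  simp only [_root_.pd, TemperedDistribution.lineDerivOp_apply_apply]
  exact h _

theorem sub {T' : ℝ → 𝓢'(E3, ℂ)} {S' : 𝓢'(E3, ℂ)} (h : HasDistDerivAt T S t)
    (h' : HasDistDerivAt T' S' t) : HasDistDerivAt (fun s => T s - T' s) (S - S') t := fun φ =>
  (h φ).sub (h' φ)

theorem divergence {v : ℝ → Fin 3 → 𝓢'(E3, ℂ)} {w : Fin 3 → 𝓢'(E3, ℂ)}
    (h : ∀ j, HasDistDerivAt (fun s => v s j) (w j) t) :
    HasDistDerivAt (fun s => divergence (v s)) (divergence w) t := fun φ => by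
  simp only [_root_.divergence, sum_apply]
  exact HasDerivAt.fun_sum fun j _ => (h j).pd j φ

end HasDistDerivAt

/-- The Fourier transform of a real `L²` function. -/
noncomputable def hatL2 (f : L2) : E3 → ℂ :=
  (𝓕 (Complex.ofRealCLM.compLp f) : Lp ℂ 2 (volume : Measure E3))

theorem hasFourier_hatL2 (f : L2) : HasFourier (toDist f) (hatL2 f) := represents_fourier_toDist_L2 f

theorem continuous_toDist_apply (φ : 𝓢(E3, ℂ)) : Continuous fun f : L2 => toDist f φ := by
  have h1 : Continuous fun f : L2 => Complex.ofRealCLM.compLp f :=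
    (Complex.ofRealCLM.compLpL 2 (volume : Measure E3)).continuous
  have h2 : Continuous fun f : Lp ℂ 2 (volume : Measure E3) => Lp.toTemperedDistribution f := by
    simpa only [← Lp.toTemperedDistributionCLM_apply] using
      (Lp.toTemperedDistributionCLM ℂ (volume : Measure E3) 2).continuous
  exact (PointwiseConvergenceCLM.evalCLM (RingHom.id ℂ) ℂ φ).continuous.comp (h2.comp h1)

theorem setIntegral_norm_Lp_two_le (g : Lp ℂ 2 (volume : Measure E3)) (R : ℝ) :
    ∫ ξ in Metric.closedBall 0 R, ‖g ξ‖ ≤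
      ‖g‖ * ((volume (Metric.closedBall (0 : E3) R)) ^ (1 / 2 : ℝ)).toReal := by
  set B := Metric.closedBall (0 : E3) R
  have hm : AEStronglyMeasurable g (volume.restrict B) :=
    (Lp.aestronglyMeasurable g).mono_measure Measure.restrict_le_self
  have h := eLpNorm_le_eLpNorm_mul_rpow_measure_univ (μ := volume.restrict B)
    (p := 1) (q := 2) (by norm_num) hm
  have h2 : eLpNorm g 2 (volume.restrict B) ≤ eLpNorm g 2 volume :=
    eLpNorm_mono_measure _ Measure.restrict_le_self
  rw [integral_norm_eq_lintegral_enorm hm, ← eLpNorm_one_eq_lintegral_enorm, Lp.norm_def,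
    ← ENNReal.toReal_mul]
  refine ENNReal.toReal_mono (ENNReal.mul_ne_top (Lp.eLpNorm_ne_top g)
    (ENNReal.rpow_ne_top_of_nonneg (by norm_num) (isCompact_closedBall _ _).measure_lt_top.ne)) ?_
  refine h.trans ?_
  rw [Measure.restrict_apply_univ]
  norm_num at h2 ⊢
  gcongr

/-- Continuity in time with values in `L²`, Plancherel and Cauchy–Schwarz on the ball give the
locally uniform bound that `weakSystem_eq_exp` asks for. -/
theorem exists_setIntegral_norm_hatL2_le {f : ℝ → L2} (hf : ContinuousOn f (Ici 0)) (R b : ℝ) :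
    ∃ K, ∀ t ∈ Icc 0 b, ∫ ξ in Metric.closedBall 0 R, ‖hatL2 (f t) ξ‖ ≤ K := by
  have hcont : ContinuousOn (fun t => ‖(𝓕 (Complex.ofRealCLM.compLp (f t)) :
      Lp ℂ 2 (volume : Measure E3))‖) (Icc 0 b) := by
    simp only [Lp.norm_fourier_eq]
    have h1 : Continuous fun f : L2 => Complex.ofRealCLM.compLp f :=
      (Complex.ofRealCLM.compLpL 2 (volume : Measure E3)).continuous
    exact (h1.comp_continuousOn (hf.mono Icc_subset_Ici_self)).norm
  obtain ⟨K, hK⟩ := isCompact_Icc.exists_bound_of_continuousOn hcont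
  refine ⟨K * ((volume (Metric.closedBall (0 : E3) R)) ^ (1 / 2 : ℝ)).toReal, fun t ht => ?_⟩
  refine (setIntegral_norm_Lp_two_le _ R).trans ?_
  gcongr
  simpa using hK t ht

/-- A continuous function on `[0, ∞)` with `g' = -ν g` on `(0, ∞)` and `g 0 = 0` vanishes. -/
theorem eq_zero_of_hasDerivAt_neg_mul {g : ℝ → ℂ} {ν : ℂ} (hc : ContinuousOn g (Ici 0))
    (hd : ∀ t > 0, HasDerivAt g (-ν * g t) t) (h0 : g 0 = 0) {t : ℝ} (ht : 0 ≤ t) : g t = 0 := by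
  have he : ∀ s : ℝ, HasDerivAt (fun s : ℝ => Complex.exp (ν * s)) (Complex.exp (ν * s) * ν) s := by
    intro s
    have h1 : HasDerivAt (fun s : ℝ => ν * (s : ℂ)) ν s := by
      simpa using (Complex.ofRealCLM.hasDerivAt (x := s)).const_mul ν
    exact h1.cexp
  have h := constant_of_has_deriv_right_zero (a := 0) (b := t)
    (f := fun s => Complex.exp (ν * s) * g s) ?_ ?_ t ⟨ht, le_rfl⟩
  · rw [h0, mul_zero] at h
    exact (mul_eq_zero.1 h).resolve_left (Complex.exp_ne_zero _)
  · exact ContinuousOn.mul (fun s _ => (he s).continuousAt.continuousWithinAt)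
      (hc.mono Icc_subset_Ici_self)
  · intro s hs
    have hg := hasDerivWithinAt_Ici_of_continuousOn hc (hc.const_mul (-ν)) hd hs.1
    refine ((he s).hasDerivWithinAt.mul hg).congr_deriv ?_
    ring

section FluidSolution

variable {p : ℝ≥0∞} [Fact (1 ≤ p)] {P : PlasmaParams} {U₀ : InitialData p}
  {ρ : Species → ℝ → L2} {u : Species → ℝ → Fin 3 → L2} {E : ℝ → Fin 3 → L2}

namespace IsFluidSolution

theorem continuousOn_u_apply (h : IsFluidSolution P U₀ ρ u E) (α : Species) (j : Fin 3) :
    ContinuousOn (fun t => u α t j) (Ici 0) :=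
  (continuous_apply j).comp_continuousOn (h.continuousOn_u α)

theorem continuousOn_pd_u (h : IsFluidSolution P U₀ ρ u E) (α : Species) (l j : Fin 3)
    (φ : 𝓢(E3, ℂ)) : ContinuousOn (fun t => pd l (toDist (u α t j)) φ) (Ici 0) := by
  simp only [pd, TemperedDistribution.lineDerivOp_apply_apply]
  exact (continuous_toDist_apply _).comp_continuousOn (h.continuousOn_u_apply α j)

theorem hasDistDerivAt_u (h : IsFluidSolution P U₀ ρ u E) (α : Species) (j : Fin 3) {t : ℝ}
    (ht : 0 < t) : HasDistDerivAt (fun s => toDist (u α s j))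
      ((P.m α)⁻¹ • (P.q α • toDist (E t j) - P.T α • pd j (toDist (ρ α t))
        - (P.m α * P.ν α) • toDist (u α t j))) t := fun φ => by
  have h1 := (h.momentum α j t ht φ).const_smul (P.m α)⁻¹
  have h2 : ∀ S : 𝓢'(E3, ℂ), ∀ c : ℝ, (c • S) φ = c • S φ := fun S c => rfl
  refine (h1.congr_deriv (h2 _ _).symm).congr_of_eventuallyEq (Filter.Eventually.of_forall fun s => ?_)
  change _ = (P.m α)⁻¹ • (P.m α • toDist (u α s j)) φ
  rw [h2, smul_smul, inv_mul_cancel₀ (P.m_pos α).ne', one_smul]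

theorem hasFourier_deriv_u (_ : IsFluidSolution P U₀ ρ u E) (α : Species) (j : Fin 3) (t : ℝ) :
    HasFourier ((P.m α)⁻¹ • (P.q α • toDist (E t j) - P.T α • pd j (toDist (ρ α t))
        - (P.m α * P.ν α) • toDist (u α t j)))
      (fun ξ => ((P.m α)⁻¹ : ℝ) * ((P.q α : ℂ) * hatL2 (E t j) ξ
        - (P.T α : ℂ) * (derivSymbol j ξ * hatL2 (ρ α t) ξ)
        - (P.m α * P.ν α : ℝ) * hatL2 (u α t j) ξ)) :=
  ((((hasFourier_hatL2 _).real_smul _).sub (((hasFourier_hatL2 _).pd j).real_smul _)).sub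
    ((hasFourier_hatL2 _).real_smul _)).real_smul _

theorem curl_E_hat (h : IsFluidSolution P U₀ ρ u E) {t : ℝ} (ht : 0 ≤ t) (j l : Fin 3) :
    (fun ξ => derivSymbol j ξ * hatL2 (E t l) ξ) =ᵐ[volume]
      fun ξ => derivSymbol l ξ * hatL2 (E t j) ξ := by
  have h1 := (hasFourier_hatL2 (E t l)).pd j
  rw [h.curl_E t ht j l] at h1
  exact h1.ae_eq ((hasFourier_hatL2 (E t j)).pd l)

/-- The velocities stay curl free. -/
theorem curl_u (h : IsFluidSolution P U₀ ρ u E) (α : Species) {t : ℝ} (ht : 0 ≤ t) :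
    IsCurlFree (fun j => toDist (u α t j)) := by
  intro j l
  -- The pressure force is a gradient and the electric field is curl free, so the curl satisfies `g'
  -- = -ν g` with zero initial value. Test functions of the form `𝓕 φ` allow the cancellation to be
  -- checked on the symbols.
  have key : ∀ φ : 𝓢(E3, ℂ), (pd j (toDist (u α t l)) - pd l (toDist (u α t j))) (𝓕 φ) = 0 := by
    intro φ
    refine eq_zero_of_hasDerivAt_neg_mul (ν := P.ν α)
      (g := fun s => (pd j (toDist (u α s l)) - pd l (toDist (u α s j))) (𝓕 φ)) ?_ ?_ ?_ ht
    · exact (h.continuousOn_pd_u α j l _).sub (h.continuousOn_pd_u α l j _)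
    · intro s hs
      refine ((((h.hasDistDerivAt_u α l hs).pd j).sub
        ((h.hasDistDerivAt_u α j hs).pd l)) (𝓕 φ)).congr_deriv ?_
      have h1 := ((h.hasFourier_deriv_u α l s).pd j).sub ((h.hasFourier_deriv_u α j s).pd l)
      have h2 := (((hasFourier_hatL2 (u α s l)).pd j).sub
        ((hasFourier_hatL2 (u α s j)).pd l)).real_smul (-P.ν α)
      have h3 := h1.congr_ae (H := fun ξ => ((-P.ν α : ℝ) : ℂ) *
          (derivSymbol j ξ * hatL2 (u α s l) ξ - derivSymbol l ξ * hatL2 (u α s j) ξ)) (by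
        filter_upwards [h.curl_E_hat hs.le j l] with ξ hξ
        have hm : (P.m α : ℂ) ≠ 0 := by exact_mod_cast (P.m_pos α).ne'
        push_cast
        field_simp
        linear_combination (P.q α : ℂ) * hξ)
      refine (h3 φ).2.trans ((h2 φ).2.symm.trans ?_)
      have h4 : ∀ S : 𝓢'(E3, ℂ), (𝓕 ((-P.ν α) • S)) φ = -(P.ν α : ℂ) * S (𝓕 φ) := fun S => by
        change (-P.ν α) • (S (𝓕 φ)) = _
        simp
      exact h4 _
    · rw [h.curl_initial_u α j l]
      simp
  have h1 : ∀ φ, (pd j (toDist (u α t l)) - pd l (toDist (u α t j))) φ = 0 := fun φ => by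
    have := key (𝓕⁻ φ)
    rwa [fourier_fourierInv_eq] at this
  ext φ
  exact sub_eq_zero.1 (h1 φ)

end IsFluidSolution

end FluidSolution

/-- The matrix symbol of the system for the densities and the divergences of the velocities. -/
noncomputable def fluidMatrix (P : PlasmaParams) (ξ : E3) :
    Matrix (Species ⊕ Species) (Species ⊕ Species) ℂ :=
  Matrix.of fun i k => match i, k with
    | .inl _, .inl _ => 0
    | .inl α, .inr γ => if α = γ then -1 else 0
    -- The field is eliminated by Gauss's law: its divergence is `4π ∑ q_γ ρ_γ`. With divergences as
    -- unknowns, instead of longitudinal velocities, the entries are polynomials in `ξ` without a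
    -- singularity at the origin.
    | .inr α, .inl γ => (P.m α : ℂ)⁻¹ * ((P.q α : ℂ) * (4 * Real.pi * P.q γ)
        - if α = γ then (P.T α : ℂ) * ∑ j, derivSymbol j ξ ^ 2 else 0)
    | .inr α, .inr γ => if α = γ then -(P.ν α : ℂ) else 0

theorem hasTemperateGrowth_fluidMatrix (P : PlasmaParams) (i k : Species ⊕ Species) :
    (fun ξ => fluidMatrix P ξ i k).HasTemperateGrowth := by
  rcases i with α | α <;> rcases k with γ | γ
  · exact Function.HasTemperateGrowth.const _
  · exact Function.HasTemperateGrowth.const _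
  · refine (Function.HasTemperateGrowth.const _).mul ((Function.HasTemperateGrowth.const _).sub ?_)
    by_cases h : α = γ
    · simp only [h, if_true]
      exact (Function.HasTemperateGrowth.const _).mul
        (Function.HasTemperateGrowth.sum fun j _ => (hasTemperateGrowth_derivSymbol j).pow 2)
    · simp only [h, if_false]
      exact Function.HasTemperateGrowth.const _
  · exact Function.HasTemperateGrowth.const _

theorem sum_fluidMatrix_inl (P : PlasmaParams) (ξ : E3) (α : Species) (x y : Species → ℂ) :
    ∑ k, fluidMatrix P ξ (.inl α) k * Sum.elim x y k = -y α := by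
  simp [fluidMatrix, Fintype.sum_sum_type]

theorem sum_fluidMatrix_inr (P : PlasmaParams) (ξ : E3) (α : Species) (x y : Species → ℂ) :
    ∑ k, fluidMatrix P ξ (.inr α) k * Sum.elim x y k =
      (P.m α : ℂ)⁻¹ * (P.q α * (4 * Real.pi * P.e * (x .ion - x .electron))
        - P.T α * (∑ j, derivSymbol j ξ ^ 2) * x α) - P.ν α * y α := by
  cases α <;>
  simp only [fluidMatrix, Fintype.sum_sum_type, Matrix.of_apply, Sum.elim_inl, Sum.elim_inr,
    sum_species, PlasmaParams.q, if_true, reduceCtorEq, if_false] <;> push_cast <;> ring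

section FluidSolution

open scoped Matrix.Norms.Operator Matrix

variable {p : ℝ≥0∞} [Fact (1 ≤ p)] {P : PlasmaParams} {U₀ : InitialData p}
  {ρ : Species → ℝ → L2} {u : Species → ℝ → Fin 3 → L2} {E : ℝ → Fin 3 → L2}

namespace IsFluidSolution

theorem div_E_hat (h : IsFluidSolution P U₀ ρ u E) {t : ℝ} (ht : 0 ≤ t) :
    (fun ξ => ∑ j, derivSymbol j ξ * hatL2 (E t j) ξ) =ᵐ[volume]
      fun ξ => 4 * Real.pi * P.e * (hatL2 (ρ .ion t) ξ - hatL2 (ρ .electron t) ξ) := by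
  have h1 := HasFourier.divergence fun j => hasFourier_hatL2 (E t j)
  rw [h.div_E t ht] at h1
  have h2 := h1.ae_eq (((hasFourier_hatL2 _).sub (hasFourier_hatL2 _)).real_smul _)
  filter_upwards [h2] with ξ hξ
  rw [hξ]
  push_cast
  ring

/-- The Fourier transform of `∇·u_α`. -/
noncomputable def _root_.hatDiv (v : Fin 3 → L2) (ξ : E3) : ℂ :=
  ∑ j, derivSymbol j ξ * hatL2 (v j) ξ

theorem _root_.hasFourier_hatDiv (v : Fin 3 → L2) :
    HasFourier (divergence fun j => toDist (v j)) (hatDiv v) :=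
  HasFourier.divergence fun j => hasFourier_hatL2 (v j)

theorem _root_.exists_setIntegral_norm_hatDiv_le {v : ℝ → Fin 3 → L2}
    (hv : ∀ j, ContinuousOn (fun t => v t j) (Ici 0)) (R b : ℝ) :
    ∃ K, ∀ t ∈ Icc 0 b, ∫ ξ in Metric.closedBall 0 R, ‖hatDiv (v t) ξ‖ ≤ K := by
  choose K hK using fun j => exists_setIntegral_norm_hatL2_le (hv j) R b
  refine ⟨2 * Real.pi * |R| * ∑ j, K j, fun t ht => ?_⟩
  have hi : ∀ j, IntegrableOn (hatL2 (v t j)) (Metric.closedBall 0 R) := fun j =>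
    (hasFourier_hatL2 (v t j)).locallyIntegrable.integrableOn_isCompact (isCompact_closedBall _ _)
  calc ∫ ξ in Metric.closedBall 0 R, ‖hatDiv (v t) ξ‖
      ≤ ∫ ξ in Metric.closedBall 0 R, 2 * Real.pi * |R| * ∑ j, ‖hatL2 (v t j) ξ‖ := by
        refine integral_mono_of_nonneg (Filter.Eventually.of_forall fun _ => norm_nonneg _)
          ((integrable_finsetSum _ fun j _ => (hi j).norm).const_mul _) ?_
        filter_upwards [ae_restrict_mem Metric.isClosed_closedBall.measurableSet] with ξ hξ
        refine (norm_sum_le _ _).trans ?_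
        rw [Finset.mul_sum]
        refine Finset.sum_le_sum fun j _ => ?_
        rw [norm_mul]
        gcongr
        refine (norm_derivSymbol_le j ξ).trans ?_
        rw [waveNumber]
        have := Real.pi_pos
        gcongr
        exact (mem_closedBall_zero_iff.1 hξ).trans (le_abs_self R)
    _ = 2 * Real.pi * |R| * ∑ j, ∫ ξ in Metric.closedBall 0 R, ‖hatL2 (v t j) ξ‖ := by
        rw [integral_const_mul, integral_finsetSum _ fun j _ => (hi j).norm]
    _ ≤ 2 * Real.pi * |R| * ∑ j, K j := by
        have := Real.pi_pos
        gcongr with j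
        exact hK j t ht

/-- The Fourier coefficients of the densities and of the divergences evolve by the matrix
exponential. -/
theorem hat_eq_exp (h : IsFluidSolution P U₀ ρ u E) {t : ℝ} (ht : 0 ≤ t)
    (i : Species ⊕ Species) :
    (fun ξ => Sum.elim (fun α => hatL2 (ρ α t) ξ) (fun α => hatDiv (u α t) ξ) i) =ᵐ[volume]
      fun ξ => (NormedSpace.exp (t • fluidMatrix P ξ) *ᵥ
        Sum.elim (fun α => hatL2 (ρ α 0) ξ) (fun α => hatDiv (u α 0) ξ)) i := by
  let T : Species ⊕ Species → ℝ → 𝓢'(E3, ℂ) := fun i t => 𝓕 (Sum.elim (fun α => toDist (ρ α t))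
    (fun α => divergence fun j => toDist (u α t j)) i)
  let V : Species ⊕ Species → ℝ → E3 → ℂ := fun i t ξ =>
    Sum.elim (fun α => hatL2 (ρ α t) ξ) (fun α => hatDiv (u α t) ξ) i
  have : Nonempty (Species ⊕ Species) := ⟨.inl .ion⟩
  have hT : ∀ i t, Represents (T i t) (V i t) := by
    rintro (α | α) t
    · exact hasFourier_hatL2 _
    · exact hasFourier_hatDiv (u α t)
  have hVt : ∀ t ξ, (fun k => V k t ξ) =
      Sum.elim (fun α => hatL2 (ρ α t) ξ) (fun α => hatDiv (u α t) ξ) := fun t ξ => rfl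
  -- A distribution represented by `M V` acts by moving the entries of `M` onto the test function.
  have hSφ : ∀ i t (S : 𝓢'(E3, ℂ)), Represents S (fun ξ => ∑ k, fluidMatrix P ξ i k * V k t ξ) →
      ∀ φ, S φ = ∑ k, T k t (SchwartzMap.smulLeftCLM ℂ (fun ξ => fluidMatrix P ξ i k) φ) := by
    intro i t S hS φ
    have h1 := Represents.sum Finset.univ fun k _ =>
      (hT k t).smulLeft (hasTemperateGrowth_fluidMatrix P i k)
    rw [(hS φ).2, ← (h1 φ).2]
    simp only [sum_apply, TemperedDistribution.smulLeftCLM_apply_apply]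
  have key := weakSystem_eq_exp (hasTemperateGrowth_fluidMatrix P) (T := T) (V := V)
    (fun i t _ => hT i t) ?_ ?_ ?_ ht i
  · exact key
  · rintro (α | α) φ
    · exact (continuous_toDist_apply _).comp_continuousOn (h.continuousOn_ρ α)
    · have : (fun t => T (.inr α) t φ) = fun t => ∑ j, pd j (toDist (u α t j)) (𝓕 φ) := by
        funext t
        simp only [T, Sum.elim_inr, divergence, TemperedDistribution.fourier_apply, sum_apply]
      rw [this]
      exact continuousOn_finsetSum _ fun j _ => h.continuousOn_pd_u α j j _
  · rintro (α | α) φ t ht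
    · have h1 : HasDistDerivAt (fun s => toDist (ρ α s))
        (-divergence (fun j => toDist (u α t j))) t := h.mass α t ht
      refine (h1.fourier φ).congr_deriv (hSφ (.inl α) t _ ?_ φ)
      have h2 := (hasFourier_hatDiv (u α t)).neg
      refine h2.congr_ae (Filter.Eventually.of_forall fun ξ => ?_)
      exact (sum_fluidMatrix_inl P ξ α (fun α => hatL2 (ρ α t) ξ)
        (fun α => hatDiv (u α t) ξ)).symm
    · have h1 := HasDistDerivAt.divergence fun j => h.hasDistDerivAt_u α j ht
      refine (h1.fourier φ).congr_deriv (hSφ (.inr α) t _ ?_ φ)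
      have h2 := HasFourier.divergence fun j => h.hasFourier_deriv_u α j t
      refine h2.congr_ae ?_
      filter_upwards [h.div_E_hat ht.le] with ξ hξ
      refine Eq.trans ?_ (sum_fluidMatrix_inr P ξ α (fun α => hatL2 (ρ α t) ξ)
        (fun α => hatDiv (u α t) ξ)).symm
      rw [← hξ, hatDiv]
      have hm : (P.m α : ℂ) ≠ 0 := by exact_mod_cast (P.m_pos α).ne'
      simp only [Fin.sum_univ_three]
      push_cast
      field_simp
      ring
  · intro R b
    choose K hK using fun α => exists_setIntegral_norm_hatL2_le (h.continuousOn_ρ α) R b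
    choose K' hK' using fun α => exists_setIntegral_norm_hatDiv_le (h.continuousOn_u_apply α) R b
    refine ⟨∑ α, (|K α| + |K' α|), ?_⟩
    rintro (α | α) t ht
    · refine (hK α t ht).trans ?_
      refine le_trans ?_ (Finset.single_le_sum (f := fun α => |K α| + |K' α|)
        (fun _ _ => by positivity) (Finset.mem_univ α))
      linarith [le_abs_self (K α), abs_nonneg (K' α)]
    · refine (hK' α t ht).trans ?_
      refine le_trans ?_ (Finset.single_le_sum (f := fun α => |K α| + |K' α|)
        (fun _ _ => by positivity) (Finset.mem_univ α))
      linarith [le_abs_self (K' α), abs_nonneg (K α)]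

end IsFluidSolution

/-- The matrix exponential yields complex modes. -/
theorem isComplexMode_exp (P : PlasmaParams) {ξ : E3} (hξ : 0 < waveNumber ξ)
    (v : Species ⊕ Species → ℂ) :
    let X : ℝ → Species ⊕ Species → ℂ := fun τ => NormedSpace.exp (τ • fluidMatrix P ξ) *ᵥ v
    IsComplexMode P (waveNumber ξ) (fun α τ => X τ (.inl α))
      (fun α τ => X τ (.inr α) / waveNumber ξ)
      (fun τ => 4 * Real.pi * P.e * (X τ (.inl .ion) - X τ (.inl .electron)) / waveNumber ξ) := by
  intro X
  have hs : (waveNumber ξ : ℂ) ≠ 0 := by exact_mod_cast hξ.ne'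
  have hX : ∀ i τ, HasDerivAt (fun τ => X τ i) (∑ k, fluidMatrix P ξ i k * X τ k) τ := by
    intro i τ
    have h1 := hasDerivAt_exp_smul_const' (𝕂 := ℝ) (fluidMatrix P ξ) τ
    have h2 : ∀ k, HasDerivAt (fun τ : ℝ => NormedSpace.exp (τ • fluidMatrix P ξ) i k)
        ((fluidMatrix P ξ * NormedSpace.exp (τ • fluidMatrix P ξ)) i k) τ := fun k =>
      hasDerivAt_pi.1 (hasDerivAt_pi.1 h1 i) k
    have h3 := HasDerivAt.fun_sum (u := Finset.univ) fun k _ => (h2 k).mul_const (v k)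
    refine h3.congr_deriv ?_
    have h4 : ((fluidMatrix P ξ * NormedSpace.exp (τ • fluidMatrix P ξ)) *ᵥ v) i =
        (fluidMatrix P ξ *ᵥ X τ) i := by rw [← Matrix.mulVec_mulVec]
    exact h4
  have hXe : ∀ τ, X τ = Sum.elim (fun α => X τ (.inl α)) (fun α => X τ (.inr α)) := fun τ => by
    funext i
    rcases i with α | α <;> rfl
  have hρ : ∀ α τ, HasDerivAt (fun τ => X τ (.inl α)) (-X τ (.inr α)) τ := fun α τ => by
    refine (hX (.inl α) τ).congr_deriv ?_
    rw [hXe]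
    exact sum_fluidMatrix_inl P ξ α _ _
  refine ⟨fun α τ => (hρ α τ).congr_deriv ?_, fun α τ => ?_, fun τ => ?_, fun τ => ?_⟩
  · field_simp
  · refine ((hX (.inr α) τ).div_const _).congr_deriv ?_
    have h1 := sum_fluidMatrix_inr P ξ α (fun α => X τ (.inl α)) (fun α => X τ (.inr α))
    rw [← hXe] at h1
    rw [h1, sum_normSq_derivSymbol, PlasmaParams.κ]
    have hm : (P.m α : ℂ) ≠ 0 := by exact_mod_cast (P.m_pos α).ne'
    push_cast
    field_simp
    ring
  · refine ((((hρ .ion τ).sub (hρ .electron τ)).const_mul _).div_const _).congr_deriv ?_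
    field_simp
    ring
  · field_simp

/-- Multiplying the curl relation by the symbol of `∂_j` and summing over `j` recovers a curl-free
vector from its divergence; the minus sign is that of `∑ (i k_j)² = -|k|²`. -/
theorem eq_neg_symbol_mul_of_curl_eq_zero {ξ : E3} (hξ : 0 < waveNumber ξ) {w : Fin 3 → ℂ}
    (hw : ∀ j l, derivSymbol j ξ * w l = derivSymbol l ξ * w j) (l : Fin 3) :
    w l = -(derivSymbol l ξ / waveNumber ξ) *
      ((∑ j, derivSymbol j ξ * w j) / waveNumber ξ) := by
  have hs : (waveNumber ξ : ℂ) ≠ 0 := by exact_mod_cast hξ.ne'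
  have h1 : (∑ j, derivSymbol j ξ ^ 2) * w l = derivSymbol l ξ * ∑ j, derivSymbol j ξ * w j := by
    rw [Finset.sum_mul, Finset.mul_sum]
    refine Finset.sum_congr rfl fun j _ => ?_
    linear_combination derivSymbol j ξ * hw j l
  rw [sum_normSq_derivSymbol] at h1
  field_simp
  linear_combination -h1

/-- The longitudinal projection is bounded pointwise in frequency. The full initial data therefore
control the mode, and no bound for Riesz transforms on `L^p` enters. -/
theorem norm_sum_derivSymbol_div_le {ξ : E3} (hξ : 0 < waveNumber ξ) (w : Fin 3 → ℂ) :
    ‖(∑ j, derivSymbol j ξ * w j) / (waveNumber ξ : ℂ)‖ ≤ ∑ j, ‖w j‖ := by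
  rw [norm_div, Complex.norm_real, Real.norm_of_nonneg hξ.le, div_le_iff₀ hξ, Finset.sum_mul]
  refine (norm_sum_le _ _).trans (Finset.sum_le_sum fun j _ => ?_)
  rw [norm_mul, mul_comm]
  gcongr
  exact norm_derivSymbol_le j ξ

/-- At almost every frequency, a fluid solution at time `t` is a mode with controlled initial
state. -/
theorem IsFluidSolution.exists_mode (h : IsFluidSolution P U₀ ρ u E) (hU : U₀.Compatible P)
    {Gρ : Species → E3 → ℂ} {Gu : Species → Fin 3 → E3 → ℂ} {GE : Fin 3 → E3 → ℂ}
    (hρ : ∀ α, HasFourier (toDist (U₀.ρ α)) (Gρ α))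
    (hu : ∀ α j, HasFourier (toDist (U₀.u α j)) (Gu α j))
    (hE : ∀ j, HasFourier (toDist (U₀.E j)) (GE j)) {t : ℝ} (ht : 0 ≤ t) :
    ∀ᵐ ξ, ∃ (R A : Species → ℝ → ℂ) (β : ℝ → ℂ), 0 < waveNumber ξ ∧
      IsComplexMode P (waveNumber ξ) R A β ∧ (∀ α, hatL2 (ρ α t) ξ = R α t) ∧
      (∀ α j, hatL2 (u α t j) ξ = -(derivSymbol j ξ / waveNumber ξ) * A α t) ∧
      (∀ j, hatL2 (E t j) ξ = -(derivSymbol j ξ / waveNumber ξ) * β t) ∧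
      (∀ α, R α 0 = Gρ α ξ) ∧ (∀ α, ‖A α 0‖ ≤ ∑ j, ‖Gu α j ξ‖) ∧ ‖β 0‖ ≤ ∑ j, ‖GE j ξ‖ := by
  have e1 : ∀ᵐ ξ, ∀ i, Sum.elim (fun α => hatL2 (ρ α t) ξ) (fun α => hatDiv (u α t) ξ) i =
      (NormedSpace.exp (t • fluidMatrix P ξ) *ᵥ
        Sum.elim (fun α => hatL2 (ρ α 0) ξ) (fun α => hatDiv (u α 0) ξ)) i :=
    ae_all_iff.2 fun i => h.hat_eq_exp ht i
  have e2 : ∀ᵐ ξ, ∀ α j l, derivSymbol j ξ * hatL2 (u α t l) ξ =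
      derivSymbol l ξ * hatL2 (u α t j) ξ := by
    have hc : Countable Species := Finite.to_countable
    refine ae_all_iff.2 fun α => ae_all_iff.2 fun j => ae_all_iff.2 fun l => ?_
    have h1 := (hasFourier_hatL2 (u α t l)).pd j
    rw [h.curl_u α ht j l] at h1
    exact h1.ae_eq ((hasFourier_hatL2 (u α t j)).pd l)
  have e3 : ∀ᵐ ξ, ∀ j l, derivSymbol j ξ * hatL2 (E t l) ξ =
      derivSymbol l ξ * hatL2 (E t j) ξ :=
    ae_all_iff.2 fun j => ae_all_iff.2 fun l => h.curl_E_hat ht j l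
  have e4 : ∀ᵐ ξ, ∀ α, hatL2 (ρ α 0) ξ = Gρ α ξ := by
    have hc : Countable Species := Finite.to_countable
    refine ae_all_iff.2 fun α => ?_
    have h1 := hasFourier_hatL2 (ρ α 0)
    rw [h.initial_ρ α] at h1
    exact h1.ae_eq (hρ α)
  have e5 : ∀ᵐ ξ, ∀ α, hatDiv (u α 0) ξ = ∑ j, derivSymbol j ξ * Gu α j ξ := by
    have hc : Countable Species := Finite.to_countable
    refine ae_all_iff.2 fun α => ?_
    have h1 := HasFourier.divergence fun j => hasFourier_hatL2 (u α 0 j)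
    rw [h.div_initial_u α] at h1
    exact h1.ae_eq (HasFourier.divergence (hu α))
  -- Compatibility identifies the initial `β`, which is a density difference divided by `s`, with
  -- the longitudinal part of `E₀`; this bounds it without the singular factor `1/s`.
  have e6 : ∀ᵐ ξ, ∑ j, derivSymbol j ξ * GE j ξ =
      4 * Real.pi * P.e * (Gρ .ion ξ - Gρ .electron ξ) := by
    have h1 := HasFourier.divergence hE
    rw [hU.1] at h1
    filter_upwards [h1.ae_eq ((HasFourier.sum _ fun α _ => (hρ α).real_smul (P.q α)).real_smul _)]
      with ξ hξ
    rw [hξ]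
    simp only [sum_species, PlasmaParams.q]
    push_cast
    ring
  have e7 : ∀ᵐ ξ : E3, ξ ≠ 0 := by simp [ae_iff]
  filter_upwards [e1, e2, e3, e4, e5, e6, e7, h.div_E_hat ht] with ξ h1 h2 h3 h4 h5 h6 h7 h8
  have hs : 0 < waveNumber ξ := by
    rw [waveNumber]
    have := norm_pos_iff.2 h7
    have := Real.pi_pos
    positivity
  have hv0 : ∀ i, (NormedSpace.exp ((0 : ℝ) • fluidMatrix P ξ) *ᵥ
      Sum.elim (fun α => hatL2 (ρ α 0) ξ) (fun α => hatDiv (u α 0) ξ)) i =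
      Sum.elim (fun α => hatL2 (ρ α 0) ξ) (fun α => hatDiv (u α 0) ξ) i := fun i => by
    rw [zero_smul, NormedSpace.exp_zero, Matrix.one_mulVec]
  refine ⟨_, _, _, hs, isComplexMode_exp P hs
    (Sum.elim (fun α => hatL2 (ρ α 0) ξ) (fun α => hatDiv (u α 0) ξ)), fun α => h1 (.inl α),
    fun α j => ?_, fun j => ?_, fun α => ?_, fun α => ?_, ?_⟩
  · dsimp only
    rw [← h1 (.inr α)]
    exact eq_neg_symbol_mul_of_curl_eq_zero hs (h2 α) j
  · dsimp only
    rw [← h1 (.inl .ion), ← h1 (.inl .electron)]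
    simp only [Sum.elim_inl]
    rw [← h8]
    exact eq_neg_symbol_mul_of_curl_eq_zero hs h3 j
  · dsimp only
    rw [hv0]
    exact h4 α
  · dsimp only
    rw [hv0]
    simp only [Sum.elim_inr]
    rw [h5 α]
    exact norm_sum_derivSymbol_div_le hs _
  · dsimp only
    rw [hv0, hv0]
    simp only [Sum.elim_inl]
    rw [h4, h4, ← h6]
    exact norm_sum_derivSymbol_div_le hs _

end FluidSolution

/-! ### From pointwise bounds in frequency to decay estimates. -/

theorem HasFourier.aestronglyMeasurable {T : 𝓢'(E3, ℂ)} {G : E3 → ℂ} (h : HasFourier T G) :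
    AEStronglyMeasurable G volume :=
  Represents.aestronglyMeasurable h

/-- Fourier transforms of the densities, velocities and electric field of initial data. -/
structure InitialData.HasFourier {p : ℝ≥0∞} [Fact (1 ≤ p)] (U : InitialData p)
    (Gρ : Species → E3 → ℂ) (Gu : Species → Fin 3 → E3 → ℂ) (GE : Fin 3 → E3 → ℂ) : Prop where
  ρ : ∀ α, _root_.HasFourier (toDist (U.ρ α)) (Gρ α)
  u : ∀ α j, _root_.HasFourier (toDist (U.u α j)) (Gu α j)
  E : ∀ j, _root_.HasFourier (toDist (U.E j)) (GE j)

/-- The size of the initial densities at a frequency. -/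
noncomputable def densitySize (Gρ : Species → E3 → ℂ) (ξ : E3) : ℝ := ∑ α, ‖Gρ α ξ‖

/-- The size of the initial data at a frequency. -/
noncomputable def dataSize (Gρ : Species → E3 → ℂ) (Gu : Species → Fin 3 → E3 → ℂ)
    (GE : Fin 3 → E3 → ℂ) (ξ : E3) : ℝ :=
  densitySize Gρ ξ + ∑ α, ∑ j, ‖Gu α j ξ‖ + ∑ j, ‖GE j ξ‖

theorem eLpNorm_waveNumber_pow_mul_sum_le {ι : Type*} (s : Finset ι) {r' : ℝ≥0∞} (hr' : 1 ≤ r')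
    (n : ℕ) {f : ι → E3 → ℝ} (hf : ∀ i ∈ s, AEStronglyMeasurable (f i) volume) {C : ℝ}
    {b : ι → ℝ≥0∞}
    (h : ∀ i ∈ s, eLpNorm (fun ξ => waveNumber ξ ^ n * f i ξ) r' volume ≤ ENNReal.ofReal C * b i) :
    eLpNorm (fun ξ => waveNumber ξ ^ n * ∑ i ∈ s, f i ξ) r' volume ≤
      ENNReal.ofReal C * ∑ i ∈ s, b i := by
  have hw : AEStronglyMeasurable (fun ξ => waveNumber ξ ^ n) volume :=
    (continuous_waveNumber.pow n).aestronglyMeasurable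
  have e : (fun ξ => waveNumber ξ ^ n * ∑ i ∈ s, f i ξ) =
      ∑ i ∈ s, fun ξ => waveNumber ξ ^ n * f i ξ := by
    funext ξ
    simp only [Finset.mul_sum, Finset.sum_apply]
  rw [e, Finset.mul_sum]
  exact (eLpNorm_sum_le (fun i hi => hw.mul (hf i hi)) hr').trans (Finset.sum_le_sum h)

namespace InitialData.HasFourier

variable {p : ℝ≥0∞} [Fact (1 ≤ p)] {U : InitialData p} {Gρ : Species → E3 → ℂ}
  {Gu : Species → Fin 3 → E3 → ℂ} {GE : Fin 3 → E3 → ℂ}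

theorem aestronglyMeasurable_densitySize (h : U.HasFourier Gρ Gu GE) :
    AEStronglyMeasurable (densitySize Gρ) volume := by
  have e : densitySize Gρ = ∑ α, fun ξ => ‖Gρ α ξ‖ := by
    funext ξ
    simp [densitySize]
  rw [e]
  exact Finset.aestronglyMeasurable_sum _ fun α _ => (h.ρ α).aestronglyMeasurable.norm

theorem aestronglyMeasurable_velocitySize (h : U.HasFourier Gρ Gu GE) :
    AEStronglyMeasurable (fun ξ => ∑ α, ∑ j, ‖Gu α j ξ‖) volume := by
  have e : (fun ξ => ∑ α, ∑ j, ‖Gu α j ξ‖) = ∑ α, ∑ j, fun ξ => ‖Gu α j ξ‖ := by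
    funext ξ
    simp
  rw [e]
  exact Finset.aestronglyMeasurable_sum _ fun α _ => Finset.aestronglyMeasurable_sum _ fun j _ =>
    (h.u α j).aestronglyMeasurable.norm

theorem aestronglyMeasurable_fieldSize (h : U.HasFourier Gρ Gu GE) :
    AEStronglyMeasurable (fun ξ => ∑ j, ‖GE j ξ‖) volume := by
  have e : (fun ξ => ∑ j, ‖GE j ξ‖) = ∑ j, fun ξ => ‖GE j ξ‖ := by
    funext ξ
    simp
  rw [e]
  exact Finset.aestronglyMeasurable_sum _ fun j _ => (h.E j).aestronglyMeasurable.norm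

theorem aestronglyMeasurable_dataSize (h : U.HasFourier Gρ Gu GE) :
    AEStronglyMeasurable (dataSize Gρ Gu GE) volume :=
  (h.aestronglyMeasurable_densitySize.add h.aestronglyMeasurable_velocitySize).add
    h.aestronglyMeasurable_fieldSize

end InitialData.HasFourier

/-- Hausdorff–Young bounds for the initial data. -/
theorem eLpNorm_waveNumber_pow_dataSize_le (p r r' : ℝ≥0∞) [Fact (1 ≤ p)] [Fact (1 ≤ r)]
    [hr' : Fact (1 ≤ r')] [r.HolderConjugate r'] (hr : r ≤ 2) :
    ∃ C : ℝ, 0 < C ∧ ∀ (n : ℕ) (U : InitialData p) (Gρ : Species → E3 → ℂ)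
      (Gu : Species → Fin 3 → E3 → ℂ) (GE : Fin 3 → E3 → ℂ), U.HasFourier Gρ Gu GE →
      eLpNorm (fun ξ => waveNumber ξ ^ n * densitySize Gρ ξ) r' volume ≤
        ENNReal.ofReal C * U.densGradNorm n r ∧
      eLpNorm (fun ξ => waveNumber ξ ^ n * dataSize Gρ Gu GE ξ) r' volume ≤
        ENNReal.ofReal C * U.gradNorm n r := by
  obtain ⟨C, hC, h⟩ := eLpNorm_waveNumber_pow_le_gradNorm r r' hr
  refine ⟨C, hC, fun n U Gρ Gu GE hU => ?_⟩
  have hw : AEStronglyMeasurable (fun ξ => waveNumber ξ ^ n) volume :=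
    (continuous_waveNumber.pow n).aestronglyMeasurable
  have h1 : eLpNorm (fun ξ => waveNumber ξ ^ n * densitySize Gρ ξ) r' volume ≤
      ENNReal.ofReal C * U.densGradNorm n r :=
    eLpNorm_waveNumber_pow_mul_sum_le _ hr'.out n
      (fun α _ => (hU.ρ α).aestronglyMeasurable.norm) fun α _ => h n _ _ (hU.ρ α)
  have h2 : eLpNorm (fun ξ => waveNumber ξ ^ n * ∑ α, ∑ j, ‖Gu α j ξ‖) r' volume ≤
      ENNReal.ofReal C * ∑ α, ∑ j, gradNorm n r (toDist (U.u α j)) := by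
    simp only [← Finset.univ_product_univ, ← Fintype.sum_prod_type']
    exact eLpNorm_waveNumber_pow_mul_sum_le _ hr'.out n
      (fun i _ => (hU.u i.1 i.2).aestronglyMeasurable.norm) fun i _ => h n _ _ (hU.u i.1 i.2)
  have h3 : eLpNorm (fun ξ => waveNumber ξ ^ n * ∑ j, ‖GE j ξ‖) r' volume ≤
      ENNReal.ofReal C * ∑ j, gradNorm n r (toDist (U.E j)) :=
    eLpNorm_waveNumber_pow_mul_sum_le _ hr'.out n
      (fun j _ => (hU.E j).aestronglyMeasurable.norm) fun j _ => h n _ _ (hU.E j)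
  refine ⟨h1, ?_⟩
  have m1 := hw.mul hU.aestronglyMeasurable_densitySize
  have m2 := hw.mul hU.aestronglyMeasurable_velocitySize
  have m3 := hw.mul hU.aestronglyMeasurable_fieldSize
  have e : (fun ξ => waveNumber ξ ^ n * dataSize Gρ Gu GE ξ) =
      ((fun ξ => waveNumber ξ ^ n) * densitySize Gρ +
        (fun ξ => waveNumber ξ ^ n) * fun ξ => ∑ α, ∑ j, ‖Gu α j ξ‖) +
        (fun ξ => waveNumber ξ ^ n) * fun ξ => ∑ j, ‖GE j ξ‖ := by
    funext ξ
    simp only [dataSize, Pi.add_apply, Pi.mul_apply]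
    ring
  rw [e]
  refine (eLpNorm_add_le (m1.add m2) m3 hr'.out).trans
    ((add_le_add_left (eLpNorm_add_le m1 m2 hr'.out) _).trans ?_)
  refine (add_le_add (add_le_add h1 h2) h3).trans ?_
  rw [← mul_add, ← mul_add]
  exact mul_le_mul_right le_self_add _

theorem exp_neg_le_one_add_rpow {a : ℝ} (ha : 0 < a) (ℓ : ℝ) :
    ∃ C : ℝ, 0 < C ∧ ∀ t : ℝ, 0 ≤ t → Real.exp (-(a * t)) ≤ C * (1 + t) ^ (-ℓ / 2) := by
  obtain ⟨n, hn⟩ := exists_nat_ge (ℓ / 2)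
  refine ⟨n.factorial * (1 / a) ^ n * Real.exp a, by positivity, fun t ht => ?_⟩
  have h1 : (a * (1 + t)) ^ n / n.factorial ≤ Real.exp (a * (1 + t)) :=
    Real.pow_div_factorial_le_exp _ (by positivity) n
  have h2 : (1 + t) ^ (ℓ / 2) ≤ (1 + t) ^ n := by
    rw [← Real.rpow_natCast]
    exact Real.rpow_le_rpow_of_exponent_le (by linarith) hn
  have h3 : (1 + t) ^ n ≤ n.factorial * (1 / a) ^ n * Real.exp (a * (1 + t)) := by
    rw [div_le_iff₀ (by positivity), mul_pow] at h1
    have han : 0 < a ^ n := by positivity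
    rw [one_div, inv_pow, mul_right_comm, ← div_eq_mul_inv, le_div_iff₀ han]
    linarith
  have hpos : 0 < (1 + t) ^ (ℓ / 2) := by positivity
  rw [neg_div, Real.rpow_neg (by linarith), ← div_eq_mul_inv, le_div_iff₀ hpos, mul_comm]
  calc (1 + t) ^ (ℓ / 2) * Real.exp (-(a * t))
      ≤ (n.factorial * (1 / a) ^ n * Real.exp (a * (1 + t))) * Real.exp (-(a * t)) := by
        gcongr
        exact h2.trans h3
    _ = n.factorial * (1 / a) ^ n * Real.exp a := by
        rw [mul_assoc, ← Real.exp_add]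
        congr 2
        ring

section DecayBound

variable {p : ℝ≥0∞} [Fact (1 ≤ p)]

theorem decayBound_mono (U₀ : InitialData p) {C C' lam : ℝ} (hC : C ≤ C') (m k n : ℕ)
    (r q : ℝ≥0∞) [Fact (1 ≤ r)] (ℓ : ℝ) {t : ℝ} (ht : 0 ≤ t) :
    decayBound U₀ C lam m k n r q ℓ t ≤ decayBound U₀ C' lam m k n r q ℓ t := by
  unfold decayBound
  gcongr

theorem mul_decayBound (U₀ : InitialData p) {c : ℝ} (hc : 0 ≤ c) (C lam : ℝ) (m k n : ℕ)
    (r q : ℝ≥0∞) [Fact (1 ≤ r)] (ℓ t : ℝ) :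
    ENNReal.ofReal c * decayBound U₀ C lam m k n r q ℓ t =
      decayBound U₀ (c * C) lam m k n r q ℓ t := by
  unfold decayBound
  simp only [mul_add, ← mul_assoc, ← ENNReal.ofReal_mul hc]

end DecayBound

/-- The four functions will yield the four terms of `decayBound`: diffusive and fast parts at low
frequency, full data and densities at high frequency. -/
theorem eLpNorm_four_terms_le {q' : ℝ≥0∞} (hq' : 1 ≤ q') {f : E3 → ℝ} {f₁ f₂ f₃ f₄ : E3 → ℝ}
    (h₁ : AEStronglyMeasurable f₁ volume) (h₂ : AEStronglyMeasurable f₂ volume)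
    (h₃ : AEStronglyMeasurable f₃ volume) (h₄ : AEStronglyMeasurable f₄ volume)
    {a b K : ℝ} (ha : 0 ≤ a) (hb : 0 ≤ b) (hK : 0 ≤ K)
    (hf : ∀ᵐ ξ, ‖f ξ‖ ≤ K * (f₁ ξ + a * f₂ ξ + b * f₃ ξ + b * f₄ ξ)) :
    eLpNorm f q' volume ≤ ENNReal.ofReal K * (eLpNorm f₁ q' volume +
      ENNReal.ofReal a * eLpNorm f₂ q' volume + ENNReal.ofReal b * eLpNorm f₃ q' volume +
      ENNReal.ofReal b * eLpNorm f₄ q' volume) := by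
  have hs : ∀ (c : ℝ) (g : E3 → ℝ), 0 ≤ c →
      eLpNorm (c • g) q' volume = ENNReal.ofReal c * eLpNorm g q' volume := fun c g hc => by
    rw [eLpNorm_const_smul, Real.enorm_of_nonneg hc]
  have h : eLpNorm f q' volume ≤ eLpNorm (K • (f₁ + a • f₂ + b • f₃ + b • f₄)) q' volume := by
    refine eLpNorm_mono_ae_real ?_
    filter_upwards [hf] with ξ hξ
    simpa using hξ
  refine h.trans ?_
  rw [hs K _ hK]
  refine mul_le_mul_right ?_ _
  have m2 := h₂.const_smul a
  have m3 := h₃.const_smul b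
  have m4 := h₄.const_smul b
  rw [← hs a f₂ ha, ← hs b f₃ hb, ← hs b f₄ hb]
  refine (eLpNorm_add_le ((h₁.add m2).add m3) m4 hq').trans (add_le_add_left ?_ _)
  refine (eLpNorm_add_le (h₁.add m2) m3 hq').trans (add_le_add_left ?_ _)
  exact eLpNorm_add_le h₁ m2 hq'

/-- A pointwise bound of the Fourier transform by diffusive decay at low frequency and exponential
decay at high frequency yields the decay estimate. -/
theorem gradNorm_le_decayBound (m k d : ℕ) (p r q p' r' q' : ℝ≥0∞) [Fact (1 ≤ p)] [Fact (1 ≤ r)]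
    [Fact (1 ≤ q)] [Fact (1 ≤ p')] [Fact (1 ≤ r')] [hq1 : Fact (1 ≤ q')] [p.HolderConjugate p']
    [r.HolderConjugate r'] [q'.HolderConjugate q] (hp : p ≤ 2) (hr : r ≤ 2) (hq : 2 ≤ q)
    (hq' : q' ≤ 2) {ℓ : ℝ} (hℓ : 0 ≤ ℓ) {a c K : ℝ} (ha : 0 < a) (hc : 0 < c) (hK : 0 < K) :
    ∃ C : ℝ, 0 < C ∧ ∀ (U : InitialData p) (Gρ : Species → E3 → ℂ)
      (Gu : Species → Fin 3 → E3 → ℂ) (GE : Fin 3 → E3 → ℂ), U.HasFourier Gρ Gu GE →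
      ∀ (T : 𝓢'(E3, ℂ)) (G : E3 → ℂ), HasFourier T G → ∀ t : ℝ, 0 ≤ t →
      (∀ᵐ ξ, waveNumber ξ ≤ 1 → ‖G ξ‖ ≤ K * ((Real.exp (-(a * t)) +
        waveNumber ξ ^ k * Real.exp (-(c * waveNumber ξ ^ 2 * t))) * dataSize Gρ Gu GE ξ)) →
      (∀ᵐ ξ, 1 < waveNumber ξ → ‖G ξ‖ ≤ K * (Real.exp (-(a * t)) *
        (dataSize Gρ Gu GE ξ + waveNumber ξ ^ d * densitySize Gρ ξ))) →
      gradNorm m q T ≤ decayBound U C a m k (m + d) r q ℓ t := by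
  obtain ⟨C₁, hC₁, h₁⟩ := gradNorm_le_eLpNorm_waveNumber_pow q q' hq' m
  obtain ⟨C₂, hC₂, h₂⟩ := eLpNorm_lowFreq_le (p := p) (q := q) (p' := p') (q' := q')
    (hp.trans hq) m (δ := 1) hc
  obtain ⟨C₃, hC₃, h₃⟩ := eLpNorm_lowFreq_le (p := p) (q := q) (p' := p') (q' := q')
    (hp.trans hq) (m + k) (δ := 1) hc
  obtain ⟨C₄, hC₄, h₄⟩ := eLpNorm_highFreq_le (r := r) (q := q) (r' := r') (q' := q')
    (hr.trans hq) m (lossIndex_spec hℓ r q) one_pos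
  obtain ⟨C₅, hC₅, h₅⟩ := eLpNorm_highFreq_le (r := r) (q := q) (r' := r') (q' := q')
    (hr.trans hq) (m + d) (lossIndex_spec le_rfl r q) one_pos
  obtain ⟨D₁, hD₁, hp0⟩ := eLpNorm_waveNumber_pow_dataSize_le p p p' hp
  obtain ⟨D₂, hD₂, hr0⟩ := eLpNorm_waveNumber_pow_dataSize_le p r r' hr
  obtain ⟨D₃, hD₃, hexp⟩ := exp_neg_le_one_add_rpow ha ℓ
  obtain ⟨S, hS0, hS1, hS2, hS3, hS4⟩ : ∃ S : ℝ, 0 < S ∧ C₃ * D₁ ≤ S ∧ C₂ * D₁ ≤ S ∧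
      D₃ * C₄ * D₂ ≤ S ∧ C₅ * D₂ ≤ S := by
    refine ⟨C₃ * D₁ + C₂ * D₁ + D₃ * C₄ * D₂ + C₅ * D₂, by positivity, ?_, ?_, ?_, ?_⟩ <;>
    · have := mul_pos hC₃ hD₁
      have := mul_pos hC₂ hD₁
      have := mul_pos (mul_pos hD₃ hC₄) hD₂
      have := mul_pos hC₅ hD₂
      linarith
  refine ⟨C₁ * K * S, by positivity, fun U Gρ Gu GE hU T G hT t ht hlow hhigh => ?_⟩
  have hX := hU.aestronglyMeasurable_dataSize
  have hY := hU.aestronglyMeasurable_densitySize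
  set X := dataSize Gρ Gu GE
  set Y := densitySize Gρ
  have hw := continuous_waveNumber
  have hlm : MeasurableSet {ξ : E3 | waveNumber ξ ≤ 1} := (isClosed_le hw continuous_const).measurableSet
  have hhm : MeasurableSet {ξ : E3 | 1 < waveNumber ξ} := (isOpen_lt continuous_const hw).measurableSet
  let f₁ : E3 → ℝ := {ξ | waveNumber ξ ≤ 1}.indicator fun ξ =>
    waveNumber ξ ^ (m + k) * Real.exp (-(c * waveNumber ξ ^ 2 * t)) * X ξ
  -- The Gaussian at time zero equals one; it is kept so that the low-frequency estimate applies
  -- with `t = 0`.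
  let f₂ : E3 → ℝ := {ξ | waveNumber ξ ≤ 1}.indicator fun ξ =>
    waveNumber ξ ^ m * Real.exp (-(c * waveNumber ξ ^ 2 * 0)) * X ξ
  let f₃ : E3 → ℝ := {ξ | 1 < waveNumber ξ}.indicator fun ξ => waveNumber ξ ^ m * X ξ
  let f₄ : E3 → ℝ := {ξ | 1 < waveNumber ξ}.indicator fun ξ => waveNumber ξ ^ (m + d) * Y ξ
  have m₁ : AEStronglyMeasurable f₁ volume := by
    refine AEStronglyMeasurable.indicator (AEStronglyMeasurable.mul ?_ hX) hlm
    exact Continuous.aestronglyMeasurable (by fun_prop)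
  have m₂ : AEStronglyMeasurable f₂ volume := by
    refine AEStronglyMeasurable.indicator (AEStronglyMeasurable.mul ?_ hX) hlm
    exact Continuous.aestronglyMeasurable (by fun_prop)
  have m₃ : AEStronglyMeasurable f₃ volume :=
    AEStronglyMeasurable.indicator ((hw.pow m).aestronglyMeasurable.mul hX) hhm
  have m₄ : AEStronglyMeasurable f₄ volume :=
    AEStronglyMeasurable.indicator ((hw.pow (m + d)).aestronglyMeasurable.mul hY) hhm
  have hf : ∀ᵐ ξ, ‖waveNumber ξ ^ m * ‖G ξ‖‖ ≤ K * (f₁ ξ + Real.exp (-(a * t)) * f₂ ξ +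
      Real.exp (-(a * t)) * f₃ ξ + Real.exp (-(a * t)) * f₄ ξ) := by
    filter_upwards [hlow, hhigh] with ξ hl hh
    have hs := waveNumber_nonneg ξ
    rw [Real.norm_of_nonneg (by positivity)]
    by_cases h : waveNumber ξ ≤ 1
    · have h' : ¬ 1 < waveNumber ξ := not_lt.2 h
      simp only [f₁, f₂, f₃, f₄, indicator, mem_ofPred_eq, h, h', if_true, if_false, mul_zero,
        add_zero, neg_zero, Real.exp_zero, mul_one]
      calc _ ≤ waveNumber ξ ^ m * _ := mul_le_mul_of_nonneg_left (hl h) (by positivity)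
        _ = _ := by ring
    · have h' : 1 < waveNumber ξ := not_le.1 h
      simp only [f₁, f₂, f₃, f₄, indicator, mem_ofPred_eq, h, h', if_true, if_false, mul_zero,
        add_zero, zero_add]
      calc _ ≤ waveNumber ξ ^ m * _ := mul_le_mul_of_nonneg_left (hh h') (by positivity)
        _ = _ := by ring
  have hmain := (h₁ T G hT).trans (mul_le_mul_right
    (eLpNorm_four_terms_le hq1.out m₁ m₂ m₃ m₄ (Real.exp_pos _).le (Real.exp_pos _).le hK.le hf) _)
  have hXp : eLpNorm X p' volume ≤ ENNReal.ofReal D₁ * U.gradNorm 0 p := by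
    simpa using (hp0 0 U Gρ Gu GE hU).2
  have b₁ : eLpNorm f₁ q' volume ≤ ENNReal.ofReal
      (S * (1 + t) ^ (-(3 / 2) * (recip p - recip q) - ((m : ℝ) + k) / 2)) * U.gradNorm 0 p := by
    refine (h₃ t ht X hX).trans ((mul_le_mul_right hXp _).trans ?_)
    rw [← mul_assoc, ← ENNReal.ofReal_mul (by positivity)]
    refine mul_le_mul_left (ENNReal.ofReal_le_ofReal ?_) _
    rw [mul_right_comm]
    push_cast
    gcongr
  have b₂ : ENNReal.ofReal (Real.exp (-(a * t))) * eLpNorm f₂ q' volume ≤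
      ENNReal.ofReal (S * Real.exp (-a * t)) * U.gradNorm 0 p := by
    refine (mul_le_mul_right ((h₂ 0 le_rfl X hX).trans (mul_le_mul_right hXp _)) _).trans ?_
    rw [← mul_assoc, ← mul_assoc, ← ENNReal.ofReal_mul (by positivity),
      ← ENNReal.ofReal_mul (by positivity)]
    refine mul_le_mul_left (ENNReal.ofReal_le_ofReal ?_) _
    rw [add_zero, Real.one_rpow, mul_one, mul_assoc, mul_comm, neg_mul]
    gcongr
  have b₃ : ENNReal.ofReal (Real.exp (-(a * t))) * eLpNorm f₃ q' volume ≤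
      ENNReal.ofReal (S * (1 + t) ^ (-ℓ / 2)) * U.gradNorm (m + lossIndex ℓ r q) r := by
    refine (mul_le_mul_right ((h₄ X hX).trans (mul_le_mul_right (hr0 _ U Gρ Gu GE hU).2 _)) _).trans ?_
    rw [← mul_assoc, ← mul_assoc, ← ENNReal.ofReal_mul (by positivity),
      ← ENNReal.ofReal_mul (by positivity)]
    refine mul_le_mul_left (ENNReal.ofReal_le_ofReal ?_) _
    calc Real.exp (-(a * t)) * C₄ * D₂ ≤ D₃ * (1 + t) ^ (-ℓ / 2) * C₄ * D₂ := by
          gcongr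
          exact hexp t ht
      _ = D₃ * C₄ * D₂ * (1 + t) ^ (-ℓ / 2) := by ring
      _ ≤ S * (1 + t) ^ (-ℓ / 2) := by gcongr
  have b₄ : ENNReal.ofReal (Real.exp (-(a * t))) * eLpNorm f₄ q' volume ≤
      ENNReal.ofReal (S * Real.exp (-a * t)) * U.densGradNorm (m + d + lossIndex 0 r q) r := by
    refine (mul_le_mul_right ((h₅ Y hY).trans (mul_le_mul_right (hr0 _ U Gρ Gu GE hU).1 _)) _).trans ?_
    rw [← mul_assoc, ← mul_assoc, ← ENNReal.ofReal_mul (by positivity),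
      ← ENNReal.ofReal_mul (by positivity)]
    refine mul_le_mul_left (ENNReal.ofReal_le_ofReal ?_) _
    rw [mul_assoc, mul_comm, neg_mul]
    gcongr
  refine hmain.trans ?_
  rw [← mul_decayBound U (by positivity), ENNReal.ofReal_mul hC₁.le, mul_assoc]
  refine mul_le_mul_right (mul_le_mul_right ?_ _) _
  exact add_le_add (add_le_add (add_le_add b₁ b₂) b₃) b₄

/-! ### Comparison with the profiles and conclusion. -/

theorem PlasmaParams.norm_cMeanDensity_le (P : PlasmaParams) (ρ : Species → ℂ) :
    ‖P.cMeanDensity ρ‖ ≤ ∑ α, ‖ρ α‖ := by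
  refine (norm_sum_le _ _).trans (Finset.sum_le_sum fun α _ => ?_)
  have h1 := P.κ_pos .ion
  have h2 := P.κ_pos .electron
  have h3 : P.κ α / (P.κ .ion + P.κ .electron) ≤ 1 := by
    rw [div_le_one (by linarith)]
    cases α <;> linarith
  have h4 : 0 ≤ P.κ α / (P.κ .ion + P.κ .electron) := by
    have := P.κ_pos α
    positivity
  rw [norm_mul, Complex.norm_real, Real.norm_of_nonneg h4]
  exact mul_le_of_le_one_left (norm_nonneg _) h3

/-- Bounds of the difference between a mode and the diffusive profile, at low and at high
frequency. -/
theorem mode_sub_profile_le (P : PlasmaParams) :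
    ∃ a c K : ℝ, 0 < a ∧ 0 < c ∧ 0 < K ∧ ∀ (s : ℝ) (R A : Species → ℝ → ℂ) (β : ℝ → ℂ) (X : ℝ),
      0 < s → IsComplexMode P s R A β → stateNorm (R · 0) (A · 0) (β 0) ≤ X → ∀ t, 0 ≤ t →
      ∀ z : ℂ, z = (Real.exp (-(P.μ₁ * s ^ 2 * t)) : ℝ) * P.cMeanDensity (R · 0) →
      (s ≤ 1 →
        (∀ α, ‖R α t - z‖ ≤ K * ((Real.exp (-(a * t)) + s ^ 1 * Real.exp (-(c * s ^ 2 * t))) * X)) ∧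
        (∀ α, ‖A α t - (P.μ₁ * s : ℝ) * z‖ ≤
          K * ((Real.exp (-(a * t)) + s ^ 2 * Real.exp (-(c * s ^ 2 * t))) * X)) ∧
        ‖β t + (P.χ * s : ℝ) * z‖ ≤
          K * ((Real.exp (-(a * t)) + s ^ 2 * Real.exp (-(c * s ^ 2 * t))) * X)) ∧
      (1 < s →
        (∀ α, ‖R α t - z‖ ≤ K * (Real.exp (-(a * t)) * (X + s ^ 0 * ∑ α, ‖R α 0‖))) ∧
        (∀ α, ‖A α t - (P.μ₁ * s : ℝ) * z‖ ≤
          K * (Real.exp (-(a * t)) * (X + s ^ 1 * ∑ α, ‖R α 0‖))) ∧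
        ‖β t + (P.χ * s : ℝ) * z‖ ≤
          K * (Real.exp (-(a * t)) * (X + s ^ 1 * ∑ α, ‖R α 0‖))) := by
  obtain ⟨a₁, c, C₁, ha₁, hc, hC₁, hlow⟩ := lowFreq_norm_le P
  obtain ⟨a₂, C₂, ha₂, hC₂, hhigh⟩ := highFreq_norm_le P
  have hμ := P.μ₁_pos
  -- The bound by `μ₁` makes the heat profile itself decay like `e^{-at}` for `s > 1`.
  obtain ⟨a, ha, haa₁, haa₂, haμ⟩ : ∃ a, 0 < a ∧ a ≤ a₁ ∧ a ≤ a₂ ∧ a ≤ P.μ₁ :=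
    ⟨min a₁ (min a₂ P.μ₁), by positivity, by simp, by simp, by simp⟩
  obtain ⟨K, hK, hK₁, hK₂, hK₃, hK₄, hK₅⟩ : ∃ K, 0 < K ∧ C₁ ≤ K ∧ C₂ ≤ K ∧ 1 ≤ K ∧ P.μ₁ ≤ K ∧
      |P.χ| ≤ K := by
    have := abs_nonneg P.χ
    exact ⟨C₁ + C₂ + 1 + P.μ₁ + |P.χ|, by positivity, by linarith, by linarith, by linarith,
      by linarith, by linarith⟩
  refine ⟨a, c, K, ha, hc, hK, fun s R A β X hs hM hX t ht z hz => ⟨fun hs1 => ?_, fun hs1 => ?_⟩⟩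
  · obtain ⟨l1, l2, l3⟩ := hlow s R A β hs hs1 hM t ht
    have hN : 0 ≤ stateNorm (R · 0) (A · 0) (β 0) := by rw [stateNorm]; positivity
    have hX0 := hN.trans hX
    rw [← hz] at l2 l3
    refine ⟨fun α => ?_, fun α => (l2 α).trans ?_, l3.trans ?_⟩
    · have := l1 α
      rw [← hz] at this
      refine this.trans ?_
      rw [pow_one]
      gcongr
      exact le_add_of_nonneg_left (Real.exp_pos _).le
    · gcongr
    · gcongr
  · obtain ⟨h1, h2, h3⟩ := hhigh s R A β hs1.le hM t ht
    have hN : 0 ≤ stateNorm (R · 0) (A · 0) (β 0) := by rw [stateNorm]; positivity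
    have hX0 := hN.trans hX
    have hY0 : 0 ≤ ∑ α, ‖R α 0‖ := by positivity
    have hzn : ‖z‖ ≤ Real.exp (-(a * t)) * ∑ α, ‖R α 0‖ := by
      rw [hz, norm_mul, Complex.norm_real, Real.norm_of_nonneg (Real.exp_pos _).le]
      have h5 : a * t ≤ P.μ₁ * s ^ 2 * t := by
        gcongr
        exact haμ.trans (le_mul_of_one_le_right hμ.le (one_le_pow₀ hs1.le))
      gcongr
      exact P.norm_cMeanDensity_le _
    have hB : C₂ * (Real.exp (-(a₂ * t)) * stateNorm (R · 0) (A · 0) (β 0)) ≤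
        K * (Real.exp (-(a * t)) * X) := by gcongr
    -- The velocity and field profiles contain a factor `s`, unbounded at high frequency: this is
    -- the extra derivative on the initial densities.
    have hgen : ∀ b : ℝ, |b| ≤ K → ‖((b * s : ℝ) : ℂ) * z‖ ≤
        K * (Real.exp (-(a * t)) * (s ^ 1 * ∑ α, ‖R α 0‖)) := fun b hb => by
      rw [norm_mul, Complex.norm_real, Real.norm_eq_abs, abs_mul, abs_of_pos hs]
      calc |b| * s * ‖z‖ ≤ K * s * (Real.exp (-(a * t)) * ∑ α, ‖R α 0‖) := by gcongr
        _ = _ := by ring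
    refine ⟨fun α => ?_, fun α => ?_, ?_⟩
    · refine (norm_sub_le _ _).trans ((add_le_add ((h1 α).trans hB)
        (hzn.trans (le_mul_of_one_le_left (by positivity) hK₃))).trans (le_of_eq ?_))
      ring
    · refine (norm_sub_le _ _).trans ((add_le_add ((h2 α).trans hB)
        (hgen P.μ₁ (by rwa [abs_of_pos hμ]))).trans (le_of_eq ?_))
      ring
    · refine (norm_add_le _ _).trans ((add_le_add (h3.trans hB) (hgen P.χ hK₅)).trans (le_of_eq ?_))
      ring

theorem norm_neg_symbol_mul_le {ξ : E3} (hξ : 0 < waveNumber ξ) (j : Fin 3) (w : ℂ) :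
    ‖-(derivSymbol j ξ / waveNumber ξ) * w‖ ≤ ‖w‖ := by
  rw [norm_mul, norm_neg, norm_div, Complex.norm_real, Real.norm_of_nonneg hξ.le]
  exact mul_le_of_le_one_left (norm_nonneg _)
    ((div_le_one hξ).2 (norm_derivSymbol_le j ξ))

/-- The Fourier transform of the diffusive density profile. -/
noncomputable def profileHat (P : PlasmaParams) (Gρ : Species → E3 → ℂ) (t : ℝ) (ξ : E3) : ℂ :=
  (Real.exp (-(P.μ₁ * waveNumber ξ ^ 2 * t)) : ℝ) * P.cMeanDensity (fun α => Gρ α ξ)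

theorem InitialData.HasFourier.ρbar {p : ℝ≥0∞} [Fact (1 ≤ p)] {U : InitialData p}
    {Gρ : Species → E3 → ℂ} {Gu : Species → Fin 3 → E3 → ℂ} {GE : Fin 3 → E3 → ℂ}
    (h : U.HasFourier Gρ Gu GE) (P : PlasmaParams) {t : ℝ} (ht : 0 ≤ t) :
    _root_.HasFourier (ρbar P U t) (profileHat P Gρ t) := by
  have h1 : _root_.HasFourier (U.ρbar₀ P) fun ξ => P.cMeanDensity fun α => Gρ α ξ :=
    HasFourier.sum _ fun α _ => (h.ρ α).real_smul _
  have h2 := Represents.heatFlow h1 (mul_nonneg P.μ₁_pos.le ht)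
  refine HasFourier.congr_ae h2 (Filter.Eventually.of_forall fun ξ => ?_)
  simp only [heatSymbol, profileHat, waveNumber]
  congr 4
  ring

theorem exists_hasFourier {p p' : ℝ≥0∞} [Fact (1 ≤ p)] [Fact (1 ≤ p')] [p.HolderConjugate p']
    (hp : p ≤ 2) (U : InitialData p) : ∃ Gρ Gu GE, U.HasFourier Gρ Gu GE := by
  choose Gρ hρ using fun α => exists_represents_fourier_toDist (p' := p') hp (U.ρ α)
  choose Gu hu using fun α j => exists_represents_fourier_toDist (p' := p') hp (U.u α j)
  choose GE hE using fun j => exists_represents_fourier_toDist (p' := p') hp (U.E j)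
  exact ⟨Gρ, Gu, GE, hρ, hu, hE⟩

theorem fact_one_le_conjExponent (p : ℝ≥0∞) : Fact (1 ≤ (1 - p⁻¹)⁻¹) :=
  ⟨ENNReal.one_le_inv.2 tsub_le_self⟩

theorem conjExponent_le_two {q : ℝ≥0∞} (hq : 2 ≤ q) : (1 - q⁻¹)⁻¹ ≤ 2 := by
  rw [← inv_inv (2 : ℝ≥0∞), ENNReal.inv_le_inv]
  have h : q⁻¹ ≤ 2⁻¹ := ENNReal.inv_le_inv.2 hq
  calc (2 : ℝ≥0∞)⁻¹ = 1 - 2⁻¹ := ENNReal.one_sub_inv_two.symm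
    _ ≤ 1 - q⁻¹ := tsub_le_tsub_left h 1

theorem theorem4p1 (P : PlasmaParams) (hdisc : P.g.discr ≠ 0) :
    ∃ lam : ℝ, 0 < lam ∧
      ∀ (m : ℕ) (p r q : ℝ≥0∞) [Fact (1 ≤ p)] [Fact (1 ≤ r)] [Fact (1 ≤ q)] (ℓ : ℝ),
        1 ≤ m → p ≤ 2 → r ≤ 2 → 2 ≤ q → 0 ≤ ℓ →
        ∃ C : ℝ, 0 < C ∧
          ∀ (U₀ : InitialData p) (ρ : Species → ℝ → L2) (u : Species → ℝ → Fin 3 → L2)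
            (E : ℝ → Fin 3 → L2),
            U₀.Compatible P → IsFluidSolution P U₀ ρ u E →
            ∀ t : ℝ, 0 ≤ t →
              (∀ α, gradNorm m q (toDist (ρ α t) - ρbar P U₀ t) ≤
                decayBound U₀ C lam m 1 m r q ℓ t) ∧
              (∀ α, ∑ j, gradNorm m q (toDist (u α t j) - ubar P U₀ t j) ≤
                decayBound U₀ C lam m 2 (m + 1) r q ℓ t) ∧
              ∑ j, gradNorm m q (toDist (E t j) - Ebar P U₀ t j) ≤
                decayBound U₀ C lam m 2 (m + 1) r q ℓ t := by
  obtain ⟨a, c, K, ha, hc, hK, hmode⟩ := mode_sub_profile_le P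
  refine ⟨a, ha, fun m p r q hp1 hr1 hq1 ℓ _ hp hr hq hℓ => ?_⟩
  have := ENNReal.HolderConjugate.inv_one_sub_inv' hp1.out
  have := ENNReal.HolderConjugate.inv_one_sub_inv' hr1.out
  have hqc := ENNReal.HolderConjugate.inv_one_sub_inv' hq1.out
  have := hqc.symm
  have := fact_one_le_conjExponent p
  have := fact_one_le_conjExponent r
  have := fact_one_le_conjExponent q
  -- The first index is the gain in powers of `s` at low frequency, the second the loss at high
  -- frequency: one and none for the densities, two and one for velocities and field.
  obtain ⟨C₁, hC₁, h₁⟩ := gradNorm_le_decayBound m 1 0 p r q (1 - p⁻¹)⁻¹ (1 - r⁻¹)⁻¹ (1 - q⁻¹)⁻¹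
    hp hr hq (conjExponent_le_two hq) hℓ ha hc hK
  obtain ⟨C₂, hC₂, h₂⟩ := gradNorm_le_decayBound m 2 1 p r q (1 - p⁻¹)⁻¹ (1 - r⁻¹)⁻¹ (1 - q⁻¹)⁻¹
    hp hr hq (conjExponent_le_two hq) hℓ ha hc hK
  refine ⟨C₁ + 3 * C₂, by positivity, fun U₀ ρ u E hU hsol t ht => ?_⟩
  obtain ⟨Gρ, Gu, GE, hG⟩ := exists_hasFourier (p' := (1 - p⁻¹)⁻¹) hp U₀
  have hbar := hG.ρbar P ht
  have hpt : ∀ᵐ ξ, ∃ (R A : Species → ℝ → ℂ) (β : ℝ → ℂ), 0 < waveNumber ξ ∧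
      IsComplexMode P (waveNumber ξ) R A β ∧ (∀ α, hatL2 (ρ α t) ξ = R α t) ∧
      (∀ α j, hatL2 (u α t j) ξ = -(derivSymbol j ξ / waveNumber ξ) * A α t) ∧
      (∀ j, hatL2 (E t j) ξ = -(derivSymbol j ξ / waveNumber ξ) * β t) ∧
      stateNorm (R · 0) (A · 0) (β 0) ≤ dataSize Gρ Gu GE ξ ∧
      profileHat P Gρ t ξ = (Real.exp (-(P.μ₁ * waveNumber ξ ^ 2 * t)) : ℝ) *
        P.cMeanDensity (R · 0) ∧ ∑ α, ‖R α 0‖ = densitySize Gρ ξ := by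
    filter_upwards [hsol.exists_mode hU hG.ρ hG.u hG.E ht] with ξ hξ
    obtain ⟨R, A, β, hs, hM, e1, e2, e3, e4, e5, e6⟩ := hξ
    refine ⟨R, A, β, hs, hM, e1, e2, e3, ?_, ?_, ?_⟩
    · rw [stateNorm, dataSize, densitySize]
      simp only [e4]
      gcongr with α
      exact e5 α
    · simp only [profileHat, e4]
    · simp only [densitySize, e4]
  have hsum : ∀ g : Fin 3 → ℝ≥0∞, (∀ j, g j ≤ decayBound U₀ C₂ a m 2 (m + 1) r q ℓ t) →
      ∑ j, g j ≤ decayBound U₀ (C₁ + 3 * C₂) a m 2 (m + 1) r q ℓ t := fun g hg => by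
    refine (Finset.sum_le_sum fun j _ => hg j).trans ?_
    rw [Finset.sum_const, Finset.card_univ, Fintype.card_fin, nsmul_eq_mul]
    have h3 : ((3 : ℕ) : ℝ≥0∞) = ENNReal.ofReal 3 := by simp
    rw [h3, mul_decayBound U₀ (by norm_num)]
    exact decayBound_mono U₀ (by linarith) _ _ _ _ _ _ ht
  refine ⟨fun α => ?_, fun α => hsum _ fun j => ?_, hsum _ fun j => ?_⟩
  · refine (h₁ U₀ Gρ Gu GE hG _ _ ((hasFourier_hatL2 (ρ α t)).sub hbar) t ht ?_ ?_).trans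
      (decayBound_mono U₀ (by linarith) _ _ _ _ _ _ ht)
    all_goals
      filter_upwards [hpt] with ξ hξ hs1
      obtain ⟨R, A, β, hs, hM, e1, -, -, e4, e5, e6⟩ := hξ
      rw [e1 α]
      have hb := hmode _ R A β _ hs hM e4 t ht _ e5
    · exact (hb.1 hs1).1 α
    · rw [← e6]
      exact (hb.2 hs1).1 α
  · refine h₂ U₀ Gρ Gu GE hG _ _ ((hasFourier_hatL2 (u α t j)).sub
      ((hbar.pd j).real_smul (-P.μ₁))) t ht ?_ ?_
    all_goals
      filter_upwards [hpt] with ξ hξ hs1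
      obtain ⟨R, A, β, hs, hM, -, e2, -, e4, e5, e6⟩ := hξ
      have hs' : (waveNumber ξ : ℂ) ≠ 0 := by exact_mod_cast hs.ne'
      -- Solution and profile both point along `-i k_j / |k|`, a factor of modulus at most one, so
      -- only the scalar difference has to be estimated.
      have e : hatL2 (u α t j) ξ - ((-P.μ₁ : ℝ) : ℂ) * (derivSymbol j ξ * profileHat P Gρ t ξ) =
          -(derivSymbol j ξ / waveNumber ξ) *
            (A α t - (P.μ₁ * waveNumber ξ : ℝ) * profileHat P Gρ t ξ) := by
        rw [e2 α j]
        push_cast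
        field_simp
        ring
      rw [e]
      refine (norm_neg_symbol_mul_le hs j _).trans ?_
      have hb := hmode _ R A β _ hs hM e4 t ht _ e5
    · exact (hb.1 hs1).2.1 α
    · rw [← e6]
      exact (hb.2 hs1).2.1 α
  · refine h₂ U₀ Gρ Gu GE hG _ _ ((hasFourier_hatL2 (E t j)).sub
      ((hbar.pd j).real_smul P.χ)) t ht ?_ ?_
    all_goals
      filter_upwards [hpt] with ξ hξ hs1
      obtain ⟨R, A, β, hs, hM, -, -, e3, e4, e5, e6⟩ := hξ
      have hs' : (waveNumber ξ : ℂ) ≠ 0 := by exact_mod_cast hs.ne'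
      have e : hatL2 (E t j) ξ - (P.χ : ℂ) * (derivSymbol j ξ * profileHat P Gρ t ξ) =
          -(derivSymbol j ξ / waveNumber ξ) *
            (β t + (P.χ * waveNumber ξ : ℝ) * profileHat P Gρ t ξ) := by
        rw [e3 j]
        push_cast
        field_simp
        ring
      rw [e]
      refine (norm_neg_symbol_mul_le hs j _).trans ?_
      have hb := hmode _ R A β _ hs hM e4 t ht _ e5
    · exact (hb.1 hs1).2.2
    · rw [← e6]
      exact (hb.2 hs1).2.2
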